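/- Let $p$ be $0$ or an odd prime, and let $X_{Fld,p}$ be the standard Borel space of fields of characteristic $p$ with domain $\mathbb N$, i.e. the Borel subspace of $(\mathbb N^{\mathbb N\times\mathbb N})^2$ consisting of the pairs $(+,\cdot)$ of binary operations on $\mathbb N$ that make $\mathbb N$ a field of characteristic $p$. For $K,L\in X_{Fld,p}$ write $K\sqsubseteq_{Fld,p}L$ if there is a field homomorphism $K\to L$ (necessarily injective), and $K\cong L$ if $K$ and $L$ are isomorphic fields. A subset of a standard Borel space $X$ is analytic if it is the projection of a Borel subset of $X\times Z$ for some Polish space $Z$. A quasi-order (reflexive transitive relation) or an equivalence relation on $X$ is analytic if it is an analytic subset of $X\times X$. A relation $P$ on $X$ is Borel reducible to a relation $R$ on $Y$ if there is a Borel map $f:X\to Y$ with $x\mathrel P x'\iff f(x)\mathrel R f(x')$ for all $x,x'\in X$; $P$ and $R$ are Borel bi-reducible if each is Borel reducible to the other. **Theorem.** The quasi-order $\sqsubseteq_{Fld,p}$ is invariantly universal (with respect to isomorphism). That is, $\sqsubseteq_{Fld,p}$ is an analytic quasi-order on $X_{Fld,p}$, the relation $\cong$ is an analytic equivalence relation contained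 in $\sqsubseteq_{Fld,p}$, and for every analytic quasi-order $R$ on a standard Borel space there is a Borel set $B\subseteq X_{Fld,p}$, closed under $\cong$, such that the restriction of $\sqsubseteq_{Fld,p}$ to $B$ is Borel bi-reducible with $R$. -/

import Mathlib

universe u v w

namespace InvUniv

/-! ### Analytic quasi-orders, Borel reducibility, invariant universality -/

/-- A subset of a standard Borel space `X` is analytic if it is the projection of a Borel subset
of `X × Z` for some Polish (equivalently, standard Borel) space `Z`. -/
def IsAnalytic {X : Type u} [MeasurableSpace X] (A : Set X) : Prop :=
  ∃ (Z : Type) (_ : MeasurableSpace Z) (_ : StandardBorelSpace Z) (C : Set (X × Z)),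
    MeasurableSet C ∧ A = {x | ∃ z, (x, z) ∈ C}

/-- A binary relation is analytic if its graph is an analytic subset of the product. -/
def IsAnalyticRel {X : Type u} [MeasurableSpace X] (R : X → X → Prop) : Prop :=
  IsAnalytic {q : X × X | R q.1 q.2}

/-- An analytic quasi-order: a reflexive and transitive analytic relation. -/
structure IsAnalyticQuasiOrder {X : Type u} [MeasurableSpace X] (R : X → X → Prop) : Prop where
  refl : ∀ x, R x x
  trans : ∀ x y z, R x y → R y z → R x z
  analytic : IsAnalyticRel R

/-- `P` is Borel reducible to `R`. -/
def BorelReducible {X : Type u} {Y : Type v} [MeasurableSpace X] [MeasurableSpace Y]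
    (P : X → X → Prop) (R : Y → Y → Prop) : Prop :=
  ∃ f : X → Y, Measurable f ∧ ∀ x y, P x y ↔ R (f x) (f y)

/-- `P` and `R` are Borel bi-reducible, i.e. `P` is essentially `R`. -/
def BorelBireducible {X : Type u} {Y : Type v} [MeasurableSpace X] [MeasurableSpace Y]
    (P : X → X → Prop) (R : Y → Y → Prop) : Prop :=
  BorelReducible P R ∧ BorelReducible R P

/-- The restriction of a relation to a subset (a subset of a standard Borel space carries the
trace of the Borel structure). -/
def restrict {X : Type u} (P : X → X → Prop) (B : Set X) : B → B → Prop :=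
  fun x y => P x y

/-- `P` is invariantly universal with respect to `E`: `P` is an analytic quasi-order, `E` is an
analytic equivalence relation contained in `P`, and every analytic quasi-order on a standard Borel
space is Borel bi-reducible with the restriction of `P` to some `E`-invariant Borel set. -/
structure InvariantlyUniversal {X : Type u} [MeasurableSpace X] [StandardBorelSpace X]
    (P E : X → X → Prop) : Prop where
  quasiOrder : IsAnalyticQuasiOrder P
  equivalence : Equivalence E
  analytic : IsAnalyticRel E
  sub : ∀ x y, E x y → P x y
  universal : ∀ (Y : Type w) [MeasurableSpace Y] [StandardBorelSpace Y] (R : Y → Y → Prop),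
    IsAnalyticQuasiOrder R →
      ∃ B : Set X, MeasurableSet B ∧ (∀ x y, E x y → x ∈ B → y ∈ B) ∧
        BorelBireducible (restrict P B) R

/-! ### The standard Borel space of fields of characteristic `p` with domain `ℕ` -/

/-- Pairs (addition, multiplication) of binary operations on `ℕ`, with the product Borel structure
(that of the product topology, `ℕ` being discrete). -/
abbrev Ops : Type := (ℕ → ℕ → ℕ) × (ℕ → ℕ → ℕ)

/-- The domain `ℕ` of a structure, stripped of the usual arithmetic of `ℕ`. -/
def Ops.Carrier (_ : Ops) : Type := ℕ

/-- The first operation, as an operation on the domain. -/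
def Ops.add (x : Ops) : x.Carrier → x.Carrier → x.Carrier := x.1

/-- The second operation, as an operation on the domain. -/
def Ops.mul (x : Ops) : x.Carrier → x.Carrier → x.Carrier := x.2

/-- The two given operations on `ℕ` are the addition and the multiplication of a field of
characteristic `p`. -/
def IsFieldOfChar (p : ℕ) (x : Ops) : Prop :=
  ∃ _ : Field x.Carrier, (∀ a b : x.Carrier, a + b = x.add a b) ∧
    (∀ a b : x.Carrier, a * b = x.mul a b) ∧ CharP x.Carrier p

/-- The space of fields of characteristic `p` with domain `ℕ`. -/
def FieldSpace (p : ℕ) : Type := {x : Ops // IsFieldOfChar p x}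

instance (p : ℕ) : MeasurableSpace (FieldSpace p) :=
  inferInstanceAs (MeasurableSpace {x : Ops // IsFieldOfChar p x})

/-- The `n`-fold sum of `e`, starting from `z`. -/
def Ops.multiple (x : Ops) (z e : x.Carrier) : ℕ → x.Carrier
  | 0 => z
  | n + 1 => x.add (x.multiple z e n) e

/-- The field axioms and the characteristic, spelled out for two operations with zero `z`
and unit `e`. -/
structure Ops.Axioms (p : ℕ) (x : Ops) (z e : x.Carrier) : Prop where
  add_assoc : ∀ a b c, x.add (x.add a b) c = x.add a (x.add b c)
  zero_add : ∀ a, x.add z a = a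
  neg : ∀ a, ∃ b, x.add b a = z
  mul_assoc : ∀ a b c, x.mul (x.mul a b) c = x.mul a (x.mul b c)
  mul_comm : ∀ a b, x.mul a b = x.mul b a
  one_mul : ∀ a, x.mul e a = a
  inv : ∀ a, a = z ∨ ∃ b, x.mul a b = e
  distrib : ∀ a b c, x.mul a (x.add b c) = x.add (x.mul a b) (x.mul a c)
  ne : z ≠ e
  char : ∀ n, x.multiple z e n = z ↔ p ∣ n

theorem isFieldOfChar_iff (p : ℕ) (x : Ops) :
    IsFieldOfChar p x ↔ ∃ z e : x.Carrier, x.Axioms p z e := by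
  constructor
  · rintro ⟨F, hadd, hmul, hchar⟩
    have hcast : ∀ n : ℕ, x.multiple 0 1 n = Nat.cast (R := x.Carrier) n := by
      intro n
      induction n with
      | zero => exact Nat.cast_zero.symm
      | succ n ih => rw [Ops.multiple, ih, Nat.cast_succ, hadd]
    refine ⟨0, 1, ⟨?_, ?_, ?_, ?_, ?_, ?_, ?_, ?_, ?_, ?_⟩⟩
    · intro a b c
      simpa only [hadd] using _root_.add_assoc a b c
    · intro a
      simpa only [hadd] using _root_.zero_add a
    · intro a
      exact ⟨-a, by simpa only [hadd] using neg_add_cancel a⟩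
    · intro a b c
      simpa only [hmul] using _root_.mul_assoc a b c
    · intro a b
      simpa only [hmul] using _root_.mul_comm a b
    · intro a
      simpa only [hmul] using _root_.one_mul a
    · intro a
      by_cases h0 : a = 0
      · exact Or.inl h0
      · exact Or.inr ⟨a⁻¹, by simpa only [hmul] using mul_inv_cancel₀ h0⟩
    · intro a b c
      simpa only [hadd, hmul] using mul_add a b c
    · exact zero_ne_one
    · intro n
      rw [hcast]
      exact CharP.cast_eq_zero_iff x.Carrier p n
  · rintro ⟨z, e, h⟩
    choose ng hng using h.neg
    have hinv : ∀ a, ∃ b, (a ≠ z → x.mul a b = e) ∧ (a = z → b = z) := by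
      intro a
      by_cases ha : a = z
      · exact ⟨z, fun h => absurd ha h, fun _ => rfl⟩
      · obtain ⟨b, hb⟩ := (h.inv a).resolve_left ha
        exact ⟨b, fun _ => hb, fun h => absurd h ha⟩
    choose iv hiv hiv0 using hinv
    let : Add x.Carrier := ⟨x.add⟩
    let : Mul x.Carrier := ⟨x.mul⟩
    let : Neg x.Carrier := ⟨ng⟩
    let : Inv x.Carrier := ⟨iv⟩
    let : Zero x.Carrier := ⟨z⟩
    let : One x.Carrier := ⟨e⟩
    let F : Field x.Carrier := Field.ofMinimalAxioms x.Carrier h.add_assoc h.zero_add hng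
      h.mul_assoc h.mul_comm h.one_mul hiv (hiv0 z rfl) h.distrib ⟨z, e, h.ne⟩
    refine ⟨F, fun _ _ => rfl, fun _ _ => rfl, ⟨fun n => ?_⟩⟩
    have hcast : ∀ n : ℕ, Nat.cast (R := x.Carrier) n = x.multiple z e n := by
      intro n
      induction n with
      | zero => exact Nat.cast_zero
      | succ n ih => rw [Nat.cast_succ, ih]; rfl
    rw [hcast]
    exact h.char n

theorem measurableSet_exists {α : Type u} [MeasurableSpace α] {q : ℕ → α → Prop}
    (h : ∀ n, MeasurableSet {x | q n x}) : MeasurableSet {x | ∃ n, q n x} := by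
  have e : {x | ∃ n, q n x} = ⋃ n, {x | q n x} := by ext x; simp
  rw [e]
  exact MeasurableSet.iUnion h

theorem measurableSet_forall {α : Type u} [MeasurableSpace α] {q : ℕ → α → Prop}
    (h : ∀ n, MeasurableSet {x | q n x}) : MeasurableSet {x | ∀ n, q n x} := by
  have e : {x | ∀ n, q n x} = ⋂ n, {x | q n x} := by ext x; simp
  rw [e]
  exact MeasurableSet.iInter h

theorem measurable_apply {α : Type u} [MeasurableSpace α] {β : Type v} [MeasurableSpace β]
    {g : α → ℕ → β} {h : α → ℕ} (hg : Measurable g) (hh : Measurable h) :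
    Measurable fun x => g x (h x) := by
  have h1 : Measurable fun q : α × ℕ => g q.1 q.2 :=
    measurable_from_prod_countable_left fun n => (measurable_pi_apply n).comp hg
  exact h1.comp (measurable_id.prodMk hh)

theorem measurable_add {f g : Ops → ℕ} (hf : Measurable f) (hg : Measurable g) :
    Measurable fun x : Ops => x.1 (f x) (g x) :=
  measurable_apply (measurable_apply measurable_fst hf) hg

theorem measurable_mul {f g : Ops → ℕ} (hf : Measurable f) (hg : Measurable g) :
    Measurable fun x : Ops => x.2 (f x) (g x) :=
  measurable_apply (measurable_apply measurable_snd hf) hg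

theorem measurable_multiple (z e n : ℕ) :
    Measurable fun x : Ops => (x.multiple z e n : ℕ) := by
  induction n with
  | zero => exact measurable_const
  | succ n ih => exact measurable_add ih measurable_const

theorem measurableSet_isFieldOfChar (p : ℕ) : MeasurableSet {x : Ops | IsFieldOfChar p x} := by
  have key : {x : Ops | IsFieldOfChar p x} = {x : Ops | ∃ z e : ℕ,
      (∀ a b c, x.1 (x.1 a b) c = x.1 a (x.1 b c)) ∧ (∀ a, x.1 z a = a) ∧
      (∀ a, ∃ b, x.1 b a = z) ∧ (∀ a b c, x.2 (x.2 a b) c = x.2 a (x.2 b c)) ∧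
      (∀ a b, x.2 a b = x.2 b a) ∧ (∀ a, x.2 e a = a) ∧ (∀ a, a = z ∨ ∃ b, x.2 a b = e) ∧
      (∀ a b c, x.2 a (x.1 b c) = x.1 (x.2 a b) (x.2 a c)) ∧ z ≠ e ∧
      (∀ n, (x.multiple z e n : ℕ) = z ↔ p ∣ n)} := by
    ext x
    refine (isFieldOfChar_iff p x).trans ?_
    refine exists_congr fun z => exists_congr fun e => ⟨?_, ?_⟩
    · rintro ⟨h1, h2, h3, h4, h5, h6, h7, h8, h9, h10⟩
      exact ⟨h1, h2, h3, h4, h5, h6, h7, h8, h9, h10⟩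
    · rintro ⟨h1, h2, h3, h4, h5, h6, h7, h8, h9, h10⟩
      exact ⟨h1, h2, h3, h4, h5, h6, h7, h8, h9, h10⟩
  have c : ∀ n : ℕ, Measurable fun _ : Ops => n := fun n => measurable_const
  have eq : ∀ {f g : Ops → ℕ}, Measurable f → Measurable g → MeasurableSet {x | f x = g x} :=
    fun hf hg => measurableSet_eq_fun hf hg
  rw [key]
  refine measurableSet_exists fun z => measurableSet_exists fun e => ?_
  refine .inter (measurableSet_forall fun i => measurableSet_forall fun j => measurableSet_forall fun k =>
    eq (measurable_add (measurable_add (c i) (c j)) (c k))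
      (measurable_add (c i) (measurable_add (c j) (c k)))) ?_
  refine .inter (measurableSet_forall fun i => eq (measurable_add (c z) (c i)) (c i)) ?_
  refine .inter (measurableSet_forall fun i => measurableSet_exists fun j =>
    eq (measurable_add (c j) (c i)) (c z)) ?_
  refine .inter (measurableSet_forall fun i => measurableSet_forall fun j => measurableSet_forall fun k =>
    eq (measurable_mul (measurable_mul (c i) (c j)) (c k))
      (measurable_mul (c i) (measurable_mul (c j) (c k)))) ?_
  refine .inter (measurableSet_forall fun i => measurableSet_forall fun j =>
    eq (measurable_mul (c i) (c j)) (measurable_mul (c j) (c i))) ?_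
  refine .inter (measurableSet_forall fun i => eq (measurable_mul (c e) (c i)) (c i)) ?_
  refine .inter (measurableSet_forall fun i => .union (.const _) (measurableSet_exists fun j =>
    eq (measurable_mul (c i) (c j)) (c e))) ?_
  refine .inter (measurableSet_forall fun i => measurableSet_forall fun j => measurableSet_forall fun k =>
    eq (measurable_mul (c i) (measurable_add (c j) (c k)))
      (measurable_add (measurable_mul (c i) (c j)) (measurable_mul (c i) (c k)))) ?_
  refine .inter (.const _) ?_
  refine measurableSet_forall fun n => ?_
  have hn : MeasurableSet {x : Ops | x.multiple z e n = z} :=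
    eq (measurable_multiple z e n) (c z)
  by_cases h : p ∣ n
  · have h' : {x : Ops | x.multiple z e n = z ↔ p ∣ n} = {x : Ops | x.multiple z e n = z} := by
      ext x
      exact iff_true_right h
    exact h' ▸ hn
  · have h' : {x : Ops | x.multiple z e n = z ↔ p ∣ n} = {x : Ops | x.multiple z e n = z}ᶜ := by
      ext x
      exact iff_false_right h
    exact h' ▸ hn.compl

instance (p : ℕ) : StandardBorelSpace (FieldSpace p) :=
  (measurableSet_isFieldOfChar p).standardBorel

namespace FieldSpace

variable {p : ℕ}

/-- The underlying set `ℕ` of a point of the space, on which the coded field structure lives. -/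
def Carrier (x : FieldSpace p) : Type := x.1.Carrier

/-- The field coded by `x`; its addition and multiplication are the given operations. -/
noncomputable instance (x : FieldSpace p) : Field x.Carrier := x.2.choose

theorem add_def (x : FieldSpace p) (a b : x.Carrier) : a + b = x.1.add a b :=
  x.2.choose_spec.1 a b

theorem mul_def (x : FieldSpace p) (a b : x.Carrier) : a * b = x.1.mul a b :=
  x.2.choose_spec.2.1 a b

instance (x : FieldSpace p) : CharP x.Carrier p := x.2.choose_spec.2.2

/-- Embeddability of fields: there is a field homomorphism (automatically injective). -/
def Embeds (x y : FieldSpace p) : Prop := Nonempty (x.Carrier →+* y.Carrier)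

/-- Isomorphism of fields. -/
def Iso (x y : FieldSpace p) : Prop := Nonempty (x.Carrier ≃+* y.Carrier)

end FieldSpace

end InvUniv

/-!
The proof codes an analytic quasi-order on the Cantor space by labelled trees, and labelled trees by
countable fields, in such a way that nothing is lost: the homomorphisms between the fields are
controlled by the embeddings of the trees, and the automorphisms of the fields are as few as
possible.

*From quasi-orders to trees.* Every analytic quasi-order is the restriction along a Borel injection
of a quasi-order `R` on `ℕ → Bool` that is a continuous image of the Baire space
(`exists_cantor_quasiOrder`). A pair belongs to `R` if and only if there is `α : ℕ → ℕ` such that,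
for all `n`, finite chains of approximations bounded by `α` lead from the first point to the second;
here compactness is used (`rel_of_forall_approx`). Label the tree of finite sequences of natural
numbers by the approximations to a point `a`. Translation by a bound `α` embeds the tree of `a` into
that of `b`, and an embedding yields a bound by looking at the sequences of zeros; so embeddability
of the labelled trees is `R` (`exists_isEmbedding_iff`). Further labels make the tree rigid and make
`a` recoverable from it (`eq_self_of_labels_eq`, `labels_injective`).

*From trees to fields.* Let `κ` be the algebraic closure of the prime field, and let `x_v` be
independent variables indexed by the vertices. The field attached to a labelled tree is generated
over the prime field by the monomials `x ^ γ`, where `γ` runs through a group of rational exponents,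
and by the square roots `√(1 + x_v)`. All `x_v` are divisible by the powers of one prime; labels and
edges are recorded by the divisibility of `x_v`, or of the product of two variables, by other
primes. All primes are large compared with the characteristic.

The variables can be recognized algebraically, up to powers of the characteristic exponent: a
nonconstant element `a` that has roots of arbitrarily large order and for which `1 + a` is a square
is `x_v ^ p ^ i` (`eq_var_pow_of_roots`). For one variable `t` over an algebraically closed field
this has two parts. First, an element `f + g √(1 + t)` with roots of large order is a monomial
`c t ^ α`: its quotient by its conjugate gives a solution of Pell's equation for `1 + t`, whose
degree would be too small if it were not trivial (`Conj.sq_mem_of_pow`). Second, if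
`1 + c t ^ α` is a square and `α ≠ 0`, then `1 + c t ^ α` is `1 + t` to a power of the
characteristic exponent, since the multiplicities of the roots have the right parity only then
(`Conj.eq_one_of_one_add_sq`). An element that is constant in each variable is constant, by the
matroid of algebraic independence (`mem_range_of_forall_mem_baseField`).

Hence a homomorphism between the fields induces a map of vertices. It preserves labels and edges
since a monomial has a root of odd prime order in the field only if this is visible in the group of
exponents (`mem_of_pow_eq_mon`): otherwise a character of the group of exponents gives an
automorphism of the big field that moves the root but whose square fixes the field. So embeddability
of the fields is embeddability of the labelled trees (`Forest.nonempty_ringHom_iff`).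

*The invariant Borel set.* Since the trees are rigid and roots of unity of large prime order do not
lie in the fields, an automorphism of one of the fields can only change the signs of the elements
`√(1 + x_v)`, and all changes of signs do occur (`exists_signs_equiv`). Therefore every field on `ℕ`
isomorphic to the field attached to `a` has exactly one isomorphism with it for which each
`√(1 + x_v)` has a smaller index than `-√(1 + x_v)`. The points of the space of fields that are
isomorphic to one of the coding fields are thus the injective Borel image of a Borel set, hence form
a Borel set, and `a` depends on the point in a Borel way, by the theorem of Lusin and Souslin
(`IsRigidFamily.exists_borel_coding`).
-/

open Polynomial

namespace InvUniv

/-! ### Polynomials: multiplicities of roots and Pell's equation -/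

section OneVariable

variable {E : Type*} [Field E]

theorem separable_one_add_C_mul_X_pow {c : E} (hc : c ≠ 0) {m : ℕ} (hm : (m : E) ≠ 0) :
    (1 + C c * X ^ m : E[X]).Separable := by
  have h : (1 + C c * X ^ m : E[X]) = C c * (X ^ m - C (-c⁻¹)) := by
    rw [mul_sub, ← C_mul]
    simp [hc, add_comm]
  rw [h]
  exact (separable_X_pow_sub_C _ hm (by simpa using hc)).unit_mul (by simpa using hc)

theorem separable_one_add_X_pow {m : ℕ} (hm : (m : E) ≠ 0) : (1 + X ^ m : E[X]).Separable := by
  simpa using separable_one_add_C_mul_X_pow (one_ne_zero (α := E)) hm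

theorem one_add_C_mul_X_pow_ne_zero (c : E) {m : ℕ} (hm : m ≠ 0) :
    (1 + C c * X ^ m : E[X]) ≠ 0 := by
  intro h
  have := congrArg (eval 0) h
  simp [hm] at this

theorem natDegree_one_add_C_mul_X_pow {c : E} (hc : c ≠ 0) (m : ℕ) (hm : m ≠ 0) :
    (1 + C c * X ^ m : E[X]).natDegree = m := by
  rw [add_comm, natDegree_add_eq_left_of_natDegree_lt] <;> rw [natDegree_C_mul_X_pow m c hc]
  simpa using Nat.pos_of_ne_zero hm

variable [IsAlgClosed E]

/-- In the polynomial `U(X ^ Q)` a nonzero root has multiplicity at most `deg U`; so only monomials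
occur in it with a higher multiplicity. -/
theorem exists_eq_monomial_of_pow_dvd_expand {P U : E[X]} {Q n : ℕ} (hU : U ≠ 0)
    (hQ : (Q : E) ≠ 0) (hn : U.natDegree < n) (h : P ^ n ∣ expand E Q U) :
    ∃ c i, P = C c * X ^ i := by
  have hQ0 : 0 < Q := Nat.pos_of_ne_zero fun h => hQ (by simp [h])
  have hP : P ≠ 0 := by
    rintro rfl
    rw [zero_pow (by omega), zero_dvd_iff, expand_eq_zero hQ0] at h
    exact hU h
  -- at a nonzero root `ρ` of `P`, the polynomial `X ^ Q - ρ ^ Q` has a simple zero, so that the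
  -- multiplicity of `ρ` in `U(X ^ Q)` is that of `ρ ^ Q` in `U`
  have hroot : ∀ ρ ∈ P.roots, ρ = 0 := by
    intro ρ hρ
    by_contra hρ0
    have h1 : (X - C ρ) ^ n ∣ expand E Q U :=
      (pow_dvd_pow_of_dvd (dvd_iff_isRoot.2 (isRoot_of_mem_roots hρ)) n).trans h
    obtain ⟨g, hg, hgr⟩ := exists_eq_pow_rootMultiplicity_mul_and_not_dvd U hU (ρ ^ Q)
    set m := rootMultiplicity (ρ ^ Q) U
    have hm : m ≤ U.natDegree :=
      by classical exact (count_roots U ▸ Multiset.count_le_card _ _).trans (card_roots' U)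
    have hsep : (X ^ Q - C (ρ ^ Q) : E[X]).Separable :=
      separable_X_pow_sub_C _ hQ (pow_ne_zero _ hρ0)
    obtain ⟨k, hk⟩ : X - C ρ ∣ (X ^ Q - C (ρ ^ Q) : E[X]) := dvd_iff_isRoot.2 (by simp)
    have hp : Prime (X - C ρ) := prime_X_sub_C ρ
    have hk' : ¬ X - C ρ ∣ k := by
      rintro ⟨l, rfl⟩
      refine hp.not_isUnit (hsep.squarefree (X - C ρ) ⟨l, ?_⟩)
      rw [hk]; ring
    have hg' : ¬ X - C ρ ∣ expand E Q g := by
      rw [dvd_iff_isRoot, IsRoot.def, expand_eval]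
      rwa [dvd_iff_isRoot, IsRoot.def] at hgr
    have h2 : expand E Q U = (X - C ρ) ^ m * (k ^ m * expand E Q g) := by
      conv_lhs => rw [hg]
      rw [map_mul, map_pow, map_sub, expand_X, expand_C, hk, mul_pow, mul_assoc]
    rw [h2] at h1
    have h3 : (X - C ρ) ^ n ∣ (X - C ρ) ^ m := by
      refine IsCoprime.dvd_of_dvd_mul_right ?_ h1
      refine IsCoprime.pow_left ((hp.irreducible.coprime_iff_not_dvd).2 fun hd => ?_)
      rcases hp.dvd_or_dvd hd with hd | hd
      · exact hk' (hp.dvd_of_dvd_pow hd)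
      · exact hg' hd
    have := (pow_dvd_pow_iff hp.ne_zero hp.not_isUnit).1 h3
    omega
  have hs := (IsAlgClosed.splits P).eq_prod_roots
  rw [Multiset.eq_replicate_of_mem hroot, Multiset.map_replicate, Multiset.prod_replicate] at hs
  exact ⟨_, _, by simpa using hs⟩

omit [IsAlgClosed E] in
theorem exists_eq_monomial_of_dvd {P : E[X]} {c : E} (hc : c ≠ 0) {k : ℕ}
    (h : P ∣ C c * X ^ k) : ∃ c i, P = C c * X ^ i := by
  have h1 : P ∣ X ^ k := by
    have : Associated (C c * X ^ k : E[X]) (X ^ k) :=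
      associated_unit_mul_left _ _ (by simpa using hc)
    exact this.dvd_iff_dvd_right.1 h
  obtain ⟨i, _, hi⟩ := (dvd_prime_pow prime_X k).1 h1
  obtain ⟨u, hu⟩ := hi.symm
  obtain ⟨c, hc, hcu⟩ := Polynomial.isUnit_iff.1 u.isUnit
  exact ⟨c, i, by rw [← hu, ← hcu, mul_comm]⟩

/-- If `β + β⁻¹ = P / D`, then `β ^ n + β⁻¹ ^ n = pellNum P D n / D ^ n`. -/
noncomputable def pellNum {R : Type*} [CommRing R] (P D : R) : ℕ → R
  | 0 => 2
  | 1 => P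
  | n + 2 => P * pellNum P D (n + 1) - D ^ 2 * pellNum P D n

theorem pellNum_eq {F : Type*} [Field F] {β P D : F} (hβ : β ≠ 0) (h : (β + β⁻¹) * D = P) (n : ℕ) :
    (β ^ n + β⁻¹ ^ n) * D ^ n = pellNum P D n := by
  induction n using Nat.twoStepInduction with
  | zero => simp [pellNum]; norm_num
  | one => simpa [pellNum] using h
  | more n h1 h2 =>
    rw [pellNum, ← h1, ← h2, ← h]
    have : β * β⁻¹ = 1 := mul_inv_cancel₀ hβ
    linear_combination (-(β⁻¹ ^ n * D ^ (n + 2)) - β ^ n * D ^ (n + 2)) * this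

theorem map_pellNum {R S : Type*} [CommRing R] [CommRing S] (f : R →+* S) (P D : R) (n : ℕ) :
    f (pellNum P D n) = pellNum (f P) (f D) n := by
  induction n using Nat.twoStepInduction with
  | zero => exact map_ofNat f 2
  | one => simp [pellNum]
  | more n h1 h2 => simp [pellNum, h1, h2]

/-- The fraction `pellNum P D n / D ^ n` is in lowest terms if `P / D` is. -/
theorem isCoprime_pellNum {R : Type*} [CommRing R] {P D : R} (h : IsCoprime P D) (n : ℕ) :
    IsCoprime (pellNum P D (n + 1)) D := by
  induction n with
  | zero => simpa [pellNum] using h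
  | succ n ih =>
    have : pellNum P D (n + 2) = P * pellNum P D (n + 1) + D * (-(D * pellNum P D n)) := by
      rw [pellNum]; ring
    rw [this]
    exact IsCoprime.add_mul_left_left (h.mul_left ih) _

omit [IsAlgClosed E] in
theorem natDegree_pellNum {P D : E[X]} (h : D.natDegree < P.natDegree) (n : ℕ) :
    (pellNum P D n).natDegree = n * P.natDegree := by
  induction n using Nat.twoStepInduction with
  | zero =>
    rw [pellNum, zero_mul]
    exact natDegree_ofNat 2
  | one => simp [pellNum]
  | more n h1 h2 =>
    have hP : P ≠ 0 := by rintro rfl; simp at h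
    have hR : pellNum P D (n + 1) ≠ 0 := by
      intro h0
      rw [h0, natDegree_zero] at h2
      nlinarith
    have h3 : (P * pellNum P D (n + 1)).natDegree = (n + 2) * P.natDegree := by
      rw [natDegree_mul hP hR, h2]; ring
    rw [pellNum, natDegree_sub_eq_left_of_natDegree_lt, h3]
    rw [h3]
    calc (D ^ 2 * pellNum P D n).natDegree ≤ 2 * D.natDegree + n * P.natDegree := by
          refine natDegree_mul_le.trans (add_le_add natDegree_pow_le h1.le)
      _ < _ := by nlinarith

omit [IsAlgClosed E] in
/-- The degree of `β ^ n + β⁻¹ ^ n` as a rational function is `n` times that of `β + β⁻¹ = P / D`;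
so the latter is small if the former is a rational function `U / W` of `X ^ Q`. -/
theorem natDegree_mul_le_of_pellNum {P D U W : E[X]} {Q n : ℕ} (hcop : IsCoprime P D) (hD : D ≠ 0)
    (hW : W ≠ 0) (hQ : 0 < Q) (hn : 0 < n)
    (h : pellNum P D n * expand E Q W = expand E Q U * D ^ n) :
    max P.natDegree D.natDegree * n ≤ Q * (U.natDegree + W.natDegree) := by
  obtain ⟨n, rfl⟩ : ∃ k, n = k + 1 := ⟨n - 1, by omega⟩
  have hW' : expand E Q W ≠ 0 := (expand_ne_zero hQ).2 hW
  have h1 : D ^ (n + 1) ∣ expand E Q W :=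
    ((isCoprime_pellNum hcop n).symm.pow_left).dvd_of_dvd_mul_left (h ▸ dvd_mul_left _ _)
  have h2 := natDegree_le_of_dvd h1 hW'
  rw [natDegree_pow, natDegree_expand] at h2
  rcases le_or_gt P.natDegree D.natDegree with hPD | hPD
  · rw [max_eq_right hPD]
    nlinarith
  · rw [max_eq_left hPD.le]
    have hR := natDegree_pellNum hPD (n + 1)
    have hR0 : pellNum P D (n + 1) ≠ 0 := by
      intro h0
      rw [h0, natDegree_zero] at hR
      nlinarith
    have hU : expand E Q U ≠ 0 := by
      intro h0
      rw [h0, zero_mul] at h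
      exact mul_ne_zero hR0 hW' h
    have h3 := congrArg natDegree h
    rw [natDegree_mul hR0 hW', natDegree_mul hU (pow_ne_zero _ hD), hR, natDegree_expand,
      natDegree_expand, natDegree_pow] at h3
    nlinarith

omit [IsAlgClosed E] in
/-- Let `P ^ 2 - (1 + X ^ (M * Q)) G ^ 2 = 4 D ^ 2`, which is Pell's equation for the unit `β` with
`β + β⁻¹ = P / D`. If `β ^ n + β⁻¹ ^ n` is a rational function `U / W` of `X ^ Q`, where `n` is
large compared with the degrees of `U` and `W`, then the solution is trivial: otherwise the degree
of `P / D` would be at least `M * Q / 2`. -/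
theorem pell_trivial {P D G U W : E[X]} {M Q n : ℕ} (hcop : IsCoprime P D) (hD : D ≠ 0)
    (hW : W ≠ 0) (hQ : 0 < Q) (hM : 0 < M)
    (h : pellNum P D n * expand E Q W = expand E Q U * D ^ n)
    (hpell : (1 + X ^ (M * Q)) * G ^ 2 = P ^ 2 - 4 * D ^ 2)
    (hn : 2 * (U.natDegree + W.natDegree) < n) : G = 0 := by
  by_contra hG
  have h1 := natDegree_mul_le_of_pellNum hcop hD hW hQ (by omega) h
  have hN : M * Q ≠ 0 := by positivity
  have h2 : (1 + X ^ (M * Q) : E[X]).natDegree = M * Q := by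
    simpa using natDegree_one_add_C_mul_X_pow (one_ne_zero (α := E)) (M * Q) hN
  have h0 : (1 + X ^ (M * Q) : E[X]) ≠ 0 := by
    simpa using one_add_C_mul_X_pow_ne_zero (1 : E) hN
  have h3 := congrArg natDegree hpell
  rw [natDegree_mul h0 (pow_ne_zero _ hG), h2, natDegree_pow] at h3
  have h4 : (P ^ 2 - 4 * D ^ 2).natDegree ≤ 2 * max P.natDegree D.natDegree := by
    refine (natDegree_sub_le _ _).trans (max_le ?_ ?_)
    · exact natDegree_pow_le.trans (by gcongr; exact le_max_left _ _)
    · refine natDegree_mul_le.trans ?_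
      have : (4 : E[X]).natDegree = 0 := natDegree_ofNat 4
      rw [this, zero_add]
      exact natDegree_pow_le.trans (by gcongr; exact le_max_right _ _)
  have h5 : M * Q ≤ 2 * max P.natDegree D.natDegree := by omega
  have h6 : M * Q * n ≤ 2 * (Q * (U.natDegree + W.natDegree)) := by nlinarith
  have h7 : Q * (2 * (U.natDegree + W.natDegree)) < Q * n := by gcongr
  have h8 : Q * n ≤ M * Q * n := by nlinarith [Nat.zero_le (Q * n)]
  nlinarith

omit [IsAlgClosed E] in
theorem rootMultiplicity_pow_eq (P : E[X]) (ρ : E) (n : ℕ) :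
    rootMultiplicity ρ (P ^ n) = n * rootMultiplicity ρ P := by
  classical
  rw [← count_roots, ← count_roots, roots_pow, Multiset.count_nsmul]

/-- Separable polynomials with the same roots agree up to a constant factor, which is `1` here
because of the constant coefficients. -/
theorem eq_of_separable_of_same_roots {c : E} (hc : c ≠ 0) {m N : ℕ} (hm : (m : E) ≠ 0)
    (hN : (N : E) ≠ 0)
    (h : ∀ ρ : E, 1 + c * ρ ^ m = 0 ↔ 1 + ρ ^ N = 0) : c = 1 ∧ m = N := by
  have hm0 : m ≠ 0 := fun h => hm (by simp [h])
  have hN0 : N ≠ 0 := fun h => hN (by simp [h])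
  have e1 : (1 + X ^ N : E[X]) = 1 + C 1 * X ^ N := by simp
  set A : E[X] := 1 + C c * X ^ m with hA
  set B : E[X] := 1 + X ^ N with hB
  have hA0 : A ≠ 0 := one_add_C_mul_X_pow_ne_zero c hm0
  have hB0 : B ≠ 0 := e1 ▸ one_add_C_mul_X_pow_ne_zero 1 hN0
  have hr : A.roots = B.roots := by
    refine (Multiset.Nodup.ext (nodup_roots (separable_one_add_C_mul_X_pow hc hm))
      (nodup_roots (separable_one_add_X_pow hN))).2 fun ρ => ?_
    rw [mem_roots hA0, mem_roots hB0]
    simpa [hA, hB] using h ρ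
  have hAs := (IsAlgClosed.splits A).eq_prod_roots
  have hBs := (IsAlgClosed.splits B).eq_prod_roots
  have hdeg : m = N := by
    have h1 := (IsAlgClosed.splits A).natDegree_eq_card_roots
    have h2 := (IsAlgClosed.splits B).natDegree_eq_card_roots
    rw [hr, ← h2, e1, hA, natDegree_one_add_C_mul_X_pow hc m hm0,
      natDegree_one_add_C_mul_X_pow one_ne_zero N hN0] at h1
    exact h1
  refine ⟨?_, hdeg⟩
  have hBm : B.leadingCoeff = 1 := by
    rw [leadingCoeff, e1, natDegree_one_add_C_mul_X_pow one_ne_zero N hN0]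
    simp [coeff_one, hN0]
  have hAm : A.leadingCoeff = c := by
    rw [leadingCoeff, hA, natDegree_one_add_C_mul_X_pow hc m hm0]
    simp [coeff_one, hm0]
  have hAB : A = C c * B := by
    rw [hAs, hr, hAm, hBs, hBm]
    simp
  have := congrArg (eval 0) hAB
  simpa [hA, hB, hm0, hN0, eq_comm] using this

/-- If `1 + c X ^ m` is a square times `u X ^ k` times a power of `1 + X ^ N`, in the field of
rational functions, then `c = 1`, the degree `m` is `N` times a power of the characteristic exponent,
and `k` is even. This compares the parities of the multiplicities of the roots. -/
theorem eq_one_of_sq_mul_eq {p : ℕ} [ExpChar E p] (hp : p ≠ 2) {D P : E[X]} {c u : E} {m N k η : ℕ}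
    (hD : D ≠ 0) (hc : c ≠ 0) (hu : u ≠ 0) (hm : m ≠ 0) (hN : (N : E) ≠ 0)
    (h : D ^ 2 * (1 + C c * X ^ m) = C u * X ^ k * P ^ 2 * (1 + X ^ N) ^ η) :
    c = 1 ∧ (∃ i, m = N * p ^ i) ∧ Even k := by
  have hN0 : N ≠ 0 := fun h => hN (by simp [h])
  have hp1 : Odd p := by
    rcases ‹ExpChar E p› with _ | ⟨hpr⟩
    · exact odd_one
    · exact hpr.odd_of_ne_two hp
  -- write `1 + c X ^ m` as a power, of odd exponent, of a separable polynomial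
  obtain ⟨i, m₁, hm₁, rfl⟩ : ∃ (i m₁ : ℕ), (m₁ : E) ≠ 0 ∧ m = m₁ * p ^ i := by
    rcases ‹ExpChar E p› with _ | ⟨hpr⟩
    · exact ⟨0, m, by exact_mod_cast hm, by simp⟩
    · obtain ⟨i, m₁, h1, h2⟩ := Nat.exists_eq_pow_mul_and_not_dvd hm p hpr.ne_one
      exact ⟨i, m₁, fun h => h1 ((CharP.cast_eq_zero_iff E p m₁).1 h), by rw [h2, mul_comm]⟩
  have hm0 : m₁ ≠ 0 := by rintro rfl; simp at hm
  have hpi : Odd (p ^ i) := hp1.pow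
  obtain ⟨d, rfl⟩ : ∃ d, d ^ p ^ i = c := IsAlgClosed.exists_pow_nat_eq c hpi.pos
  have hd : d ≠ 0 := by rintro rfl; exact hc (zero_pow hpi.pos.ne')
  have hH : (1 + C (d ^ p ^ i) * X ^ (m₁ * p ^ i) : E[X]) = (1 + C d * X ^ m₁) ^ p ^ i := by
    rw [add_pow_expChar_pow, one_pow, mul_pow, C_pow, pow_mul]
  rw [hH] at h
  set A : E[X] := 1 + C d * X ^ m₁ with hA
  set B : E[X] := 1 + X ^ N with hB
  have e1 : B = 1 + C 1 * X ^ N := by simp [hB]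
  have hA0 : A ≠ 0 := one_add_C_mul_X_pow_ne_zero d hm0
  have hB0 : B ≠ 0 := e1 ▸ one_add_C_mul_X_pow_ne_zero 1 hN0
  have hl : D ^ 2 * A ^ p ^ i ≠ 0 := mul_ne_zero (pow_ne_zero _ hD) (pow_ne_zero _ hA0)
  have hP : P ≠ 0 := by
    rintro rfl
    rw [h] at hl; simp at hl
  have hX : (C u * X ^ k : E[X]) ≠ 0 := by simp [hu]
  have key : ∀ ρ : E, 2 * rootMultiplicity ρ D + p ^ i * rootMultiplicity ρ A =
      rootMultiplicity ρ (C u * X ^ k : E[X]) + 2 * rootMultiplicity ρ P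
        + η * rootMultiplicity ρ B := by
    intro ρ
    have := congrArg (rootMultiplicity ρ) h
    rwa [rootMultiplicity_mul hl, rootMultiplicity_pow_eq, rootMultiplicity_pow_eq,
      rootMultiplicity_mul (h ▸ hl), rootMultiplicity_mul (mul_ne_zero hX (pow_ne_zero _ hP)),
      rootMultiplicity_pow_eq, rootMultiplicity_pow_eq] at this
  have hA1 : ∀ ρ, rootMultiplicity ρ A ≤ 1 :=
    fun ρ => rootMultiplicity_le_one_of_separable (separable_one_add_C_mul_X_pow hd hm₁) ρ
  have hB1 : ∀ ρ, rootMultiplicity ρ B ≤ 1 :=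
    fun ρ => rootMultiplicity_le_one_of_separable (separable_one_add_X_pow hN) ρ
  have hXr : ∀ ρ : E, ρ ≠ 0 → rootMultiplicity ρ (C u * X ^ k : E[X]) = 0 := fun ρ hρ =>
    rootMultiplicity_eq_zero (by simp [hu, hρ])
  have hAr : ∀ ρ, 0 < rootMultiplicity ρ A ↔ 1 + d * ρ ^ m₁ = 0 := fun ρ => by
    rw [rootMultiplicity_pos hA0]; simp [hA]
  have hBr : ∀ ρ, 0 < rootMultiplicity ρ B ↔ 1 + ρ ^ N = 0 := fun ρ => by
    rw [rootMultiplicity_pos hB0]; simp [hB]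
  have par : ∀ ρ : E, ρ ≠ 0 →
      (Odd (rootMultiplicity ρ A) ↔ Odd (η * rootMultiplicity ρ B)) := by
    intro ρ hρ
    have := key ρ
    rw [hXr ρ hρ] at this
    have h2 : Odd (p ^ i * rootMultiplicity ρ A) ↔ Odd (rootMultiplicity ρ A) := by
      simp [Nat.odd_mul, hpi]
    rw [← h2]
    constructor <;> rintro ⟨w, hw⟩ <;> rw [Nat.odd_iff] <;> omega
  have oddA : ∀ ρ, Odd (rootMultiplicity ρ A) ↔ 0 < rootMultiplicity ρ A := fun ρ => by
    have := hA1 ρ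
    rw [Nat.odd_iff]; omega
  have oddB : ∀ ρ, Odd (rootMultiplicity ρ B) ↔ 0 < rootMultiplicity ρ B := fun ρ => by
    have := hB1 ρ
    rw [Nat.odd_iff]; omega
  -- the left hand side has a root of odd multiplicity, so that the factor `1 + X ^ N` is present
  have hη : Odd η := by
    obtain ⟨ρ, hρ⟩ := IsAlgClosed.exists_pow_nat_eq (-d⁻¹) (Nat.pos_of_ne_zero hm0)
    have hρ' : 1 + d * ρ ^ m₁ = 0 := by rw [hρ]; field_simp; ring
    have hρ0 : ρ ≠ 0 := by rintro rfl; simp [hm0] at hρ'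
    exact (Nat.odd_mul.1 ((par ρ hρ0).1 ((oddA ρ).2 ((hAr ρ).2 hρ')))).1
  have same : ∀ ρ : E, 1 + d * ρ ^ m₁ = 0 ↔ 1 + ρ ^ N = 0 := by
    intro ρ
    by_cases hρ : ρ = 0
    · simp [hρ, hm0, hN0]
    · rw [← hAr, ← hBr, ← oddA, ← oddB, par ρ hρ, Nat.odd_mul]
      exact and_iff_right hη
  obtain ⟨hd1, hmN⟩ := eq_of_separable_of_same_roots hd hm₁ hN same
  refine ⟨by simp [hd1], ⟨i, by rw [hmN]⟩, ?_⟩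
  have h0 := key 0
  have hA2 : rootMultiplicity 0 A = 0 := rootMultiplicity_eq_zero (by simp [hA, hm0])
  have hB2 : rootMultiplicity 0 B = 0 := rootMultiplicity_eq_zero (by simp [hB, hN0])
  have hX2 : rootMultiplicity 0 (C u * X ^ k : E[X]) = k := by
    have : (C u * X ^ k : E[X]) = C u * (X - C 0) ^ k := by simp
    rw [this, rootMultiplicity_mul (by simpa using hX), rootMultiplicity_C,
      rootMultiplicity_X_sub_C_pow, zero_add]
  rw [hA2, hB2, hX2] at h0
  rw [Nat.even_iff]
  omega

end OneVariable

end InvUniv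

open Polynomial

namespace InvUniv

/-! ### Rational powers of a transcendental element -/

/-- A compatible system `α ↦ t ^ α` of rational powers of an element `t` of `Ω` that is
transcendental over `E`. -/
structure RationalPowers (E Ω : Type*) [Field E] [Field Ω] [Algebra E Ω] where
  /-- the power `t ^ α` -/
  e : ℚ → Ω
  e_zero : e 0 = 1
  e_add : ∀ a b, e (a + b) = e a * e b
  transcendental : Transcendental E (e 1)

namespace RationalPowers

open IntermediateField

variable {E Ω : Type*} [Field E] [Field Ω] [Algebra E Ω] (x : RationalPowers E Ω)

theorem e_ne_zero (α : ℚ) : x.e α ≠ 0 := by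
  intro h
  have := x.e_add α (-α)
  rw [h, add_neg_cancel, x.e_zero, zero_mul] at this
  exact one_ne_zero this

theorem e_neg (α : ℚ) : x.e (-α) = (x.e α)⁻¹ := by
  refine eq_inv_of_mul_eq_one_left ?_
  rw [← x.e_add, neg_add_cancel, x.e_zero]

theorem e_nat_mul (n : ℕ) (α : ℚ) : x.e (n * α) = x.e α ^ n := by
  induction n with
  | zero => simp [x.e_zero]
  | succ n ih => rw [Nat.cast_succ, add_mul, x.e_add, ih, one_mul, pow_succ]

/-- The element `t ^ (1 / N)`. -/
def root (N : ℕ) : Ω := x.e (1 / N)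

theorem root_pow {N : ℕ} (hN : N ≠ 0) (m : ℕ) : x.root N ^ m = x.e (m / N) := by
  rw [root, ← x.e_nat_mul]
  congr 1
  field_simp

theorem root_pow_self {N : ℕ} (hN : N ≠ 0) : x.root N ^ N = x.e 1 := by
  rw [x.root_pow hN, div_self (by exact_mod_cast hN)]

theorem root_mul_pow {N : ℕ} (hN : N ≠ 0) {Q : ℕ} (hQ : Q ≠ 0) : x.root (N * Q) ^ Q = x.root N := by
  rw [x.root_pow (mul_ne_zero hN hQ), root]
  congr 1
  push_cast
  field_simp

theorem root_transcendental {N : ℕ} (hN : N ≠ 0) : Transcendental E (x.root N) := fun h =>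
  x.transcendental (x.root_pow_self hN ▸ h.pow N)

theorem aeval_injective {N : ℕ} (hN : N ≠ 0) :
    Function.Injective (aeval (R := E) (x.root N)) :=
  transcendental_iff_injective.1 (x.root_transcendental hN)

theorem aeval_eq_zero {N : ℕ} (hN : N ≠ 0) {P : E[X]} : aeval (x.root N) P = 0 ↔ P = 0 :=
  map_eq_zero_iff _ (x.aeval_injective hN)

/-- Rational functions of `t ^ (1 / N)` with coefficients in `E`. -/
def rat (N : ℕ) : IntermediateField E Ω := E⟮x.root N⟯

theorem root_mem_rat (N : ℕ) : x.root N ∈ x.rat N := mem_adjoin_simple_self E _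

theorem rat_le {N Q : ℕ} (hN : N ≠ 0) (hQ : Q ≠ 0) : x.rat N ≤ x.rat (N * Q) := by
  rw [rat, adjoin_simple_le_iff, ← x.root_mul_pow hN hQ]
  exact pow_mem (x.root_mem_rat _) _

/-- A polynomial in `t ^ (1 / N)` is a polynomial in the `Q`-th power of `t ^ (1 / (N * Q))`. -/
theorem aeval_root {N Q : ℕ} (hN : N ≠ 0) (hQ : Q ≠ 0) (U : E[X]) :
    aeval (x.root N) U = aeval (x.root (N * Q)) (expand E Q U) := by
  rw [expand_aeval, x.root_mul_pow hN hQ]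

/-- Rational functions of `t ^ (1 / N)` are fractions of polynomials in lowest terms. -/
theorem exists_isCoprime {N : ℕ} (hN : N ≠ 0) {a : Ω} (ha : a ∈ x.rat N) :
    ∃ P D : E[X], D ≠ 0 ∧ IsCoprime P D ∧ a * aeval (x.root N) D = aeval (x.root N) P := by
  classical
  obtain ⟨r, s, rfl⟩ := (mem_adjoin_simple_iff E _).1 ha
  by_cases hs : s = 0
  · exact ⟨0, 1, one_ne_zero, isCoprime_one_right, by simp [hs]⟩
  obtain ⟨s', hs'⟩ := EuclideanDomain.gcd_dvd_right r s
  obtain ⟨r', hr'⟩ := EuclideanDomain.gcd_dvd_left r s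
  have hg : EuclideanDomain.gcd r s ≠ 0 := fun h => hs (by rw [hs', h, zero_mul])
  have hs0 : s' ≠ 0 := fun h => hs (by rw [hs', h, mul_zero])
  refine ⟨r', s', hs0, ?_, ?_⟩
  · have h := EuclideanDomain.gcd_eq_gcd_ab r s
    refine ⟨EuclideanDomain.gcdA r s, EuclideanDomain.gcdB r s, mul_left_cancel₀ hg ?_⟩
    calc _ = (EuclideanDomain.gcd r s * r') * EuclideanDomain.gcdA r s +
          (EuclideanDomain.gcd r s * s') * EuclideanDomain.gcdB r s := by ring
      _ = _ := by rw [← hs', ← hr', mul_one, ← h]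
  · have h1 : aeval (x.root N) (EuclideanDomain.gcd r s) ≠ 0 := by
      rwa [Ne, x.aeval_eq_zero hN]
    have h2 : aeval (x.root N) s' ≠ 0 := by rwa [Ne, x.aeval_eq_zero hN]
    rw [div_mul_eq_mul_div, div_eq_iff (by rwa [Ne, x.aeval_eq_zero hN]), hr', hs', map_mul,
      map_mul]
    simp only [← hs']
    ring

/-- A nontrivial rational power of a transcendental element is not a constant. -/
theorem e_eq_zero_of_mem {α : ℚ} {c : E} (h : x.e α = algebraMap E Ω c) : α = 0 := by
  by_contra hα
  have key : ∀ β : ℚ, 0 < β → ∀ d : E, x.e β ≠ algebraMap E Ω d := by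
    intro β hβ d hd
    have h1 : x.e 1 ^ β.num.toNat = algebraMap E Ω (d ^ β.den) := by
      rw [map_pow, ← hd, ← x.e_nat_mul, ← x.e_nat_mul, mul_one]
      congr 1
      have : ((β.num.toNat : ℤ) : ℚ) = β.num := by
        rw [Int.toNat_of_nonneg (Rat.num_nonneg.2 hβ.le)]
      rw [mul_comm, Rat.mul_den_eq_num, ← this]
      rfl
    have h2 : 0 < β.num.toNat := by
      have := Rat.num_pos.2 hβ
      omega
    refine x.transcendental (IsAlgebraic.of_pow h2 ?_)
    rw [h1]
    exact isAlgebraic_algebraMap _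
  rcases lt_or_gt_of_ne hα with h0 | h0
  · refine key (-α) (by linarith) c⁻¹ ?_
    rw [e_neg, h, map_inv₀]
  · exact key α h0 c h

/-- A quotient `P / D` of two monomials in `t ^ (1 / N)` is a constant times a power of `t`. -/
theorem exists_e_of_monomial {N : ℕ} (hN : N ≠ 0) {a : Ω} {P D : E[X]} (hD : D ≠ 0)
    (h : a * aeval (x.root N) D = aeval (x.root N) P) {c d : E} {i j : ℕ}
    (hP : P = C c * X ^ i) (hD' : D = C d * X ^ j) :
    ∃ (c' : E) (k : ℤ), a = algebraMap E Ω c' * x.e (k / N) := by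
  refine ⟨c / d, i - j, ?_⟩
  have hd : d ≠ 0 := by rintro rfl; simp at hD'; exact hD hD'
  have hd' : algebraMap E Ω d ≠ 0 := by simpa using hd
  have h1 : ((i - j : ℤ) : ℚ) / N = i / N + -(j / N) := by push_cast; ring
  rw [h1, x.e_add, e_neg, ← x.root_pow hN, ← x.root_pow hN, map_div₀]
  rw [hP, hD'] at h
  simp only [map_mul, aeval_C, map_pow, aeval_X] at h
  have h3 : x.root N ^ j ≠ 0 := by rw [x.root_pow hN]; exact x.e_ne_zero _
  field_simp
  linear_combination h

/-- The exponent of a monomial that is a rational function of `t ^ (1 / N)` is a multiple of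
`1 / N`. -/
theorem exists_exponent {N : ℕ} (hN : N ≠ 0) {c : E} (hc : c ≠ 0) {α : ℚ}
    (h : algebraMap E Ω c * x.e α ∈ x.rat N) : ∃ k : ℤ, α = k / N := by
  obtain ⟨P, D, hD, hcop, hPD⟩ := x.exists_isCoprime hN h
  have hden : 0 < α.den := α.den_pos
  have hc' : algebraMap E Ω c ≠ 0 := by simpa using hc
  -- raising to the power of the denominator turns `t ^ α` into an integral power of `t`
  have hpow : (algebraMap E Ω c * x.e α) ^ (N * α.den) =
      algebraMap E Ω (c ^ (N * α.den)) * x.e ((α.num * N : ℤ)) := by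
    rw [mul_pow, ← x.e_nat_mul, map_pow]
    congr 2
    push_cast
    rw [mul_assoc, Rat.den_mul_eq_num, mul_comm]
  have hk : N * α.den ≠ 0 := by positivity
  have hint : ∀ m : ℕ, x.e m = aeval (x.root N) (X ^ (N * m) : E[X]) := by
    intro m
    rw [map_pow, aeval_X, pow_mul, x.root_pow_self hN, ← x.e_nat_mul, mul_one]
  have hpq : ∃ m n : ℕ, C (c ^ (N * α.den)) * X ^ (N * m) * D ^ (N * α.den) =
      X ^ (N * n) * P ^ (N * α.den) := by
    obtain ⟨m, n, hmn⟩ : ∃ m n : ℕ, (α.num * N : ℤ) = m - n := by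
      rcases Int.eq_nat_or_neg (α.num * N) with ⟨m, h | h⟩
      · exact ⟨m, 0, by simp [h]⟩
      · exact ⟨0, m, by simp [h]⟩
    refine ⟨m, n, x.aeval_injective hN ?_⟩
    have h2 : x.e m = x.e ((α.num * N : ℤ)) * x.e n := by
      rw [← x.e_add, hmn]; congr 1; push_cast; ring
    rw [map_mul, map_mul, aeval_C, ← hint, map_mul, ← hint, map_pow _ P, ← hPD, mul_pow, hpow, h2,
      map_pow _ D]
    ring
  obtain ⟨m, n, hmn⟩ := hpq
  have hPX : P ∣ C (c ^ (N * α.den)) * X ^ (N * m) := by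
    refine (dvd_pow_self P hk).trans ?_
    exact (hcop.pow (m := N * α.den) (n := N * α.den)).dvd_of_dvd_mul_right (hmn ▸ dvd_mul_left _ _)
  have hDX : D ∣ C 1 * X ^ (N * n) := by
    refine (dvd_pow_self D hk).trans ?_
    rw [C_1, one_mul]
    exact (hcop.symm.pow (m := N * α.den) (n := N * α.den)).dvd_of_dvd_mul_right
      (hmn ▸ dvd_mul_left _ _)
  obtain ⟨c₁, i, hi⟩ := exists_eq_monomial_of_dvd (pow_ne_zero _ hc) hPX
  obtain ⟨c₂, j, hj⟩ := exists_eq_monomial_of_dvd one_ne_zero hDX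
  obtain ⟨c', k, hk⟩ := x.exists_e_of_monomial hN hD hPD hi hj
  refine ⟨k, sub_eq_zero.1 (x.e_eq_zero_of_mem (c := c' / c) ?_)⟩
  rw [sub_eq_add_neg, x.e_add, e_neg, map_div₀]
  have := x.e_ne_zero (k / N)
  field_simp
  linear_combination hk

variable [IsAlgClosed E]

/-- A rational function that is an `n`-th power for arbitrarily large `n`, after adjoining roots of
`t` of order prime to the characteristic, is a monomial. -/
theorem exists_monomial_of_pow {a : Ω} {M : ℕ} (hM : (M : E) ≠ 0) (ha0 : a ≠ 0) (ha : a ∈ x.rat M)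
    (h : ∀ k, ∃ n ≥ k, ∃ Q : ℕ, (Q : E) ≠ 0 ∧ ∃ b ∈ x.rat (M * Q), b ^ n = a) :
    ∃ (c : E) (α : ℚ), a = algebraMap E Ω c * x.e α := by
  have hM0 : M ≠ 0 := by rintro rfl; simp at hM
  obtain ⟨U, W, hW, hUW, haUW⟩ := x.exists_isCoprime hM0 ha
  obtain ⟨n, hn, Q, hQ, b, hb, rfl⟩ := h (U.natDegree + W.natDegree + 1)
  have hQ0 : Q ≠ 0 := by rintro rfl; simp at hQ
  have hMQ := mul_ne_zero hM0 hQ0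
  obtain ⟨P, D, hD, hcop, hPD⟩ := x.exists_isCoprime hMQ hb
  have hU : U ≠ 0 := by
    rintro rfl
    rw [map_zero, mul_eq_zero, x.aeval_eq_zero hM0] at haUW
    exact haUW.elim ha0 hW
  have key : P ^ n * expand E Q W = expand E Q U * D ^ n := by
    apply x.aeval_injective hMQ
    rw [x.aeval_root hM0 hQ0, x.aeval_root hM0 hQ0] at haUW
    rw [map_mul, map_mul, map_pow, map_pow, ← hPD, ← haUW]
    ring
  obtain ⟨c, i, hi⟩ := exists_eq_monomial_of_pow_dvd_expand (P := P) (n := n) hU hQ (by omega)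
    ((hcop.pow (m := n) (n := n)).dvd_of_dvd_mul_right (key ▸ dvd_mul_right _ _))
  obtain ⟨d, j, hj⟩ := exists_eq_monomial_of_pow_dvd_expand (P := D) (n := n) hW hQ (by omega)
    ((hcop.symm.pow (m := n) (n := n)).dvd_of_dvd_mul_left (key ▸ dvd_mul_left _ _))
  obtain ⟨c', k, hk⟩ := x.exists_e_of_monomial hMQ hD hPD hi hj
  refine ⟨c' ^ n, n * (k / (M * Q : ℕ)), ?_⟩
  rw [hk, mul_pow, x.e_nat_mul, map_pow]

end RationalPowers

end InvUniv

open Polynomial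

namespace InvUniv

namespace RationalPowers

open IntermediateField

variable {E Ω : Type*} [Field E] [Field Ω] [Algebra E Ω]

/-! ### Adjoining the square root of `1 + t` -/

/-- A square root `s` of `1 + t` together with an endomorphism of `Ω` that fixes `E` and all powers
of `t` and changes the sign of `s`. -/
structure Conj (x : RationalPowers E Ω) where
  /-- the square root of `1 + t` -/
  s : Ω
  s_sq : s ^ 2 = 1 + x.e 1
  /-- the conjugation -/
  σ : Ω →ₐ[E] Ω
  σ_e : ∀ α, σ (x.e α) = x.e α
  σ_s : σ s = -s

namespace Conj

variable {x : RationalPowers E Ω} (y : x.Conj)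

/-- The elements `f + g √(1 + t)` with `f`, `g` rational functions of `t ^ (1 / N)`. -/
def quad (N : ℕ) : Set Ω := {a | ∃ f ∈ x.rat N, ∃ g ∈ x.rat N, a = f + g * y.s}

theorem σ_rat {N : ℕ} {a : Ω} (ha : a ∈ x.rat N) : y.σ a = a := by
  obtain ⟨P, D, rfl⟩ := (mem_adjoin_simple_iff E _).1 ha
  rw [map_div₀, ← aeval_algHom_apply, ← aeval_algHom_apply, root, y.σ_e]

theorem one_add_mem {N : ℕ} (hN : N ≠ 0) : 1 + x.e 1 ∈ x.rat N := by
  rw [← x.root_pow_self hN]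
  exact add_mem (one_mem _) (pow_mem (x.root_mem_rat N) _)

theorem s_sq_mem {N : ℕ} (hN : N ≠ 0) : y.s ^ 2 ∈ x.rat N := y.s_sq ▸ one_add_mem hN

theorem s_ne_zero : y.s ≠ 0 := by
  intro h
  have := y.s_sq
  rw [h, zero_pow two_ne_zero] at this
  refine one_ne_zero (x.e_eq_zero_of_mem (α := 1) (c := -1) ?_)
  rw [_root_.map_neg, _root_.map_one]
  linear_combination -this

theorem quad_mono {N Q : ℕ} (hN : N ≠ 0) (hQ : Q ≠ 0) : y.quad N ⊆ y.quad (N * Q) := by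
  rintro _ ⟨f, hf, g, hg, rfl⟩
  exact ⟨f, x.rat_le hN hQ hf, g, x.rat_le hN hQ hg, rfl⟩

theorem rat_subset {N : ℕ} {a : Ω} (ha : a ∈ x.rat N) : a ∈ y.quad N :=
  ⟨a, ha, 0, zero_mem _, by simp⟩

theorem add_mem_quad {N : ℕ} {a b : Ω} (ha : a ∈ y.quad N) (hb : b ∈ y.quad N) :
    a + b ∈ y.quad N := by
  obtain ⟨f, hf, g, hg, rfl⟩ := ha
  obtain ⟨f', hf', g', hg', rfl⟩ := hb
  exact ⟨_, add_mem hf hf', _, add_mem hg hg', by ring⟩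

theorem neg_mem_quad {N : ℕ} {a : Ω} (ha : a ∈ y.quad N) : -a ∈ y.quad N := by
  obtain ⟨f, hf, g, hg, rfl⟩ := ha
  exact ⟨_, neg_mem hf, _, neg_mem hg, by ring⟩

theorem mul_mem_quad {N : ℕ} (hN : N ≠ 0) {a b : Ω} (ha : a ∈ y.quad N) (hb : b ∈ y.quad N) :
    a * b ∈ y.quad N := by
  obtain ⟨f, hf, g, hg, rfl⟩ := ha
  obtain ⟨f', hf', g', hg', rfl⟩ := hb
  refine ⟨f * f' + g * g' * y.s ^ 2, ?_, f * g' + g * f', ?_, by ring⟩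
  · exact add_mem (mul_mem hf hf') (mul_mem (mul_mem hg hg') (y.s_sq_mem hN))
  · exact add_mem (mul_mem hf hg') (mul_mem hg hf')

theorem inv_mem_quad {N : ℕ} (hN : N ≠ 0) {a : Ω} (ha : a ∈ y.quad N) : a⁻¹ ∈ y.quad N := by
  obtain ⟨f, hf, g, hg, rfl⟩ := ha
  by_cases h0 : f + g * y.s = 0
  · rw [h0, inv_zero]
    exact y.rat_subset (zero_mem _)
  have h1 : f - g * y.s ≠ 0 := by
    intro h
    apply h0
    have : y.σ (f - g * y.s) = f + g * y.s := by
      rw [map_sub, map_mul, y.σ_rat hf, y.σ_rat hg, y.σ_s]; ring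
    rw [← this, h, map_zero]
  have hν : f ^ 2 - g ^ 2 * y.s ^ 2 ∈ x.rat N :=
    sub_mem (pow_mem hf 2) (mul_mem (pow_mem hg 2) (y.s_sq_mem hN))
  refine ⟨f / (f ^ 2 - g ^ 2 * y.s ^ 2), div_mem hf hν, -g / (f ^ 2 - g ^ 2 * y.s ^ 2),
    div_mem (neg_mem hg) hν, ?_⟩
  have h2 : f ^ 2 - g ^ 2 * y.s ^ 2 ≠ 0 := by
    have := mul_ne_zero h0 h1
    convert this using 1; ring
  field_simp
  ring

theorem two_ne_zero' (h2 : (2 : E) ≠ 0) : (2 : Ω) ≠ 0 := by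
  rw [← map_ofNat (algebraMap E Ω) 2]
  simpa using h2

/-- An element of `quad N` whose square is fixed by the conjugation is a rational function or a
rational multiple of `s`. -/
theorem sq_cases (h2 : (2 : E) ≠ 0) {N : ℕ} {b : Ω} (hb : b ∈ y.quad N)
    (h : y.σ (b ^ 2) = b ^ 2) : ∃ f ∈ x.rat N, b = f ∨ b = f * y.s := by
  have h2' := two_ne_zero' (Ω := Ω) h2
  obtain ⟨f, hf, g, hg, rfl⟩ := hb
  have h3 : y.σ (f + g * y.s) = f - g * y.s := by
    rw [map_add, map_mul, y.σ_rat hf, y.σ_rat hg, y.σ_s]; ring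
  rw [map_pow, h3] at h
  have h4 : (2 * 2 * y.s) * (f * g) = 0 := by linear_combination -h
  have h5 := (mul_eq_zero.1 h4).resolve_left (mul_ne_zero (mul_ne_zero h2' h2') y.s_ne_zero)
  rcases mul_eq_zero.1 h5 with rfl | rfl
  · exact ⟨g, hg, Or.inr (by simp)⟩
  · exact ⟨f, hf, Or.inl (by simp)⟩

theorem sq_mem_of_cases {N : ℕ} (hN : N ≠ 0) {b f : Ω} (hf : f ∈ x.rat N)
    (h : b = f ∨ b = f * y.s) : b ^ 2 ∈ x.rat N := by
  rcases h with rfl | rfl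
  · exact pow_mem hf 2
  · rw [mul_pow]
    exact mul_mem (pow_mem hf 2) (y.s_sq_mem hN)

/-- If `b` is a root of `a` of order large compared with the degree of `a`, then `b ^ 2` is a
rational function: the quotient `β = b / σ b` has norm one, so that its trace and the coefficient of
`s` in it solve Pell's equation, and by `pell_trivial` the solution is trivial, that is,
`β ^ 2 = 1`. -/
theorem sq_mem_of_pow (h2 : (2 : E) ≠ 0) {M : ℕ} (hM : (M : E) ≠ 0) {a : Ω} (ha0 : a ≠ 0)
    (ha : a ∈ y.quad M) : ∃ k, ∀ n ≥ k, ∀ Q : ℕ, (Q : E) ≠ 0 → ∀ b ∈ y.quad (M * Q), b ^ n = a →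
      b ^ 2 ∈ x.rat (M * Q) := by
  have hM0 : M ≠ 0 := by rintro rfl; simp at hM
  -- the trace of the norm-one element attached to `a` or to one of its roots
  have trace : ∀ N : ℕ, N ≠ 0 → ∀ b ∈ y.quad N, b ≠ 0 →
      b / y.σ b + (b / y.σ b)⁻¹ ∈ x.rat N ∧
      ∃ S ∈ x.rat N, b / y.σ b - (b / y.σ b)⁻¹ = S * y.s := by
    rintro N hN _ ⟨f, hf, g, hg, rfl⟩ hb0
    have h3 : y.σ (f + g * y.s) = f - g * y.s := by
      rw [map_add, map_mul, y.σ_rat hf, y.σ_rat hg, y.σ_s]; ring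
    have hσ0 : f - g * y.s ≠ 0 := h3 ▸ (map_ne_zero y.σ).2 hb0
    have hν : f ^ 2 - g ^ 2 * y.s ^ 2 ∈ x.rat N :=
      sub_mem (pow_mem hf 2) (mul_mem (pow_mem hg 2) (y.s_sq_mem hN))
    have hν0 : f ^ 2 - g ^ 2 * y.s ^ 2 ≠ 0 := by
      have := mul_ne_zero hb0 hσ0
      convert this using 1; ring
    have h2m : (2 : Ω) ∈ x.rat N := ofNat_mem _ 2
    rw [h3]
    refine ⟨?_, 2 * 2 * f * g / (f ^ 2 - g ^ 2 * y.s ^ 2), ?_, ?_⟩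
    · have : (f + g * y.s) / (f - g * y.s) + ((f + g * y.s) / (f - g * y.s))⁻¹ =
          2 * (f ^ 2 + g ^ 2 * y.s ^ 2) / (f ^ 2 - g ^ 2 * y.s ^ 2) := by
        field_simp
        ring
      rw [this]
      exact div_mem (mul_mem h2m (add_mem (pow_mem hf 2)
        (mul_mem (pow_mem hg 2) (y.s_sq_mem hN)))) hν
    · exact div_mem (mul_mem (mul_mem (mul_mem h2m h2m) hf) hg) hν
    · field_simp
      ring
  obtain ⟨U, W, hW, -, haUW⟩ := x.exists_isCoprime hM0 (trace M hM0 a ha ha0).1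
  refine ⟨2 * (U.natDegree + W.natDegree) + 1, ?_⟩
  rintro n hn Q hQ b hb rfl
  have hQ0 : Q ≠ 0 := by rintro rfl; simp at hQ
  have hMQ := mul_ne_zero hM0 hQ0
  have hb0 : b ≠ 0 := by
    rintro rfl
    exact ha0 (zero_pow (by omega))
  have hσb : y.σ b ≠ 0 := (map_ne_zero y.σ).2 hb0
  obtain ⟨hT, S, hS, hTS⟩ := trace _ hMQ b hb hb0
  set β := b / y.σ b with hβ
  have hβ0 : β ≠ 0 := div_ne_zero hb0 hσb
  obtain ⟨P, D, hD, hcop, hPD⟩ := x.exists_isCoprime hMQ hT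
  have hD0 : aeval (x.root (M * Q)) D ≠ 0 := by rwa [Ne, x.aeval_eq_zero hMQ]
  have hDm : aeval (x.root (M * Q)) D ∈ x.rat (M * Q) :=
    (mem_adjoin_simple_iff E _).2 ⟨D, 1, by simp⟩
  obtain ⟨G, G₂, hG₂, hGcop, hG⟩ := x.exists_isCoprime hMQ (mul_mem hS hDm)
  have hone : aeval (x.root (M * Q)) (1 + X ^ (M * Q) : E[X]) = y.s ^ 2 := by
    rw [y.s_sq, map_add, map_one, map_pow, aeval_X, x.root_pow_self hMQ]
  have hββ : β * β⁻¹ = 1 := mul_inv_cancel₀ hβ0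
  have hpell : (1 + X ^ (M * Q)) * G ^ 2 = (P ^ 2 - 4 * D ^ 2) * G₂ ^ 2 := by
    apply x.aeval_injective hMQ
    rw [map_mul, hone, map_mul, map_sub, map_mul, map_pow, map_pow, map_pow, map_pow, ← hG, ← hPD,
      map_ofNat]
    have h5 : S ^ 2 * y.s ^ 2 = (β - β⁻¹) ^ 2 := by rw [hTS]; ring
    linear_combination
      (aeval (x.root (M * Q)) D ^ 2 * aeval (x.root (M * Q)) G₂ ^ 2) * h5
        - 4 * (aeval (x.root (M * Q)) D ^ 2 * aeval (x.root (M * Q)) G₂ ^ 2) * hββ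
  -- the denominator of the coefficient of `s` is constant since `1 + X ^ (M * Q)` is squarefree
  have hunit : IsUnit G₂ := by
    have h6 : G₂ ^ 2 ∣ (1 + X ^ (M * Q)) :=
      (hGcop.symm.pow (m := 2) (n := 2)).dvd_of_dvd_mul_right
        (Dvd.intro_left _ hpell.symm)
    refine (separable_one_add_X_pow (E := E) (m := M * Q) ?_).squarefree G₂ (by rwa [← sq])
    push_cast
    exact mul_ne_zero hM hQ
  obtain ⟨v, hv⟩ := hunit.exists_right_inv
  have hpell' : (1 + X ^ (M * Q)) * (G * v) ^ 2 = P ^ 2 - 4 * D ^ 2 := by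
    calc _ = ((1 + X ^ (M * Q)) * G ^ 2) * v ^ 2 := by ring
      _ = (P ^ 2 - 4 * D ^ 2) * (G₂ * v) ^ 2 := by rw [hpell]; ring
      _ = _ := by rw [hv]; ring
  have hnum : pellNum P D n * expand E Q W = expand E Q U * D ^ n := by
    apply x.aeval_injective hMQ
    rw [x.aeval_root hM0 hQ0, x.aeval_root hM0 hQ0] at haUW
    have h7 := pellNum_eq hβ0 hPD n
    have h8 : aeval (x.root (M * Q)) (pellNum P D n) =
        pellNum (aeval (x.root (M * Q)) P) (aeval (x.root (M * Q)) D) n :=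
      map_pellNum (aeval (R := E) (x.root (M * Q))).toRingHom P D n
    have h9 : b ^ n / y.σ (b ^ n) = β ^ n := by rw [map_pow, hβ, div_pow]
    rw [map_mul, map_mul, map_pow, h8, ← h7, ← haUW, h9, inv_pow]
    ring
  have hG0 : G * v = 0 :=
    pell_trivial hcop hD hW (Nat.pos_of_ne_zero hQ0) (Nat.pos_of_ne_zero hM0) hnum hpell' (by omega)
  have hG0' : G = 0 := (mul_eq_zero.1 hG0).resolve_right (right_ne_zero_of_mul_eq_one hv)
  rw [hG0', map_zero, mul_eq_zero, x.aeval_eq_zero hMQ] at hG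
  have hS0 : S = 0 := (mul_eq_zero.1 (hG.resolve_right hG₂)).resolve_right hD0
  rw [hS0, zero_mul, sub_eq_zero] at hTS
  have hββ' : β * β = 1 := by nth_rewrite 2 [hTS]; exact hββ
  have hb2 : y.σ (b ^ 2) = b ^ 2 := by
    have : β ^ 2 = 1 := by rw [sq, hββ']
    rw [hβ, div_pow, div_eq_one_iff_eq (pow_ne_zero _ hσb)] at this
    rw [map_pow, this]
  obtain ⟨f, hf, h⟩ := y.sq_cases h2 hb hb2
  exact y.sq_mem_of_cases hMQ hf h

variable [IsAlgClosed E]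

/-- An element of `⋃ N, quad N` that has roots of arbitrarily large order there is a monomial. -/
theorem exists_monomial_of_pow (h2 : (2 : E) ≠ 0) {a : Ω} {M : ℕ} (hM : (M : E) ≠ 0) (ha0 : a ≠ 0)
    (ha : a ∈ y.quad M)
    (h : ∀ k, ∃ n ≥ k, ∃ Q : ℕ, (Q : E) ≠ 0 ∧ ∃ b ∈ y.quad (M * Q), b ^ n = a) :
    ∃ (c : E) (α : ℚ), a = algebraMap E Ω c * x.e α := by
  have hM0 : M ≠ 0 := by rintro rfl; simp at hM
  obtain ⟨k₀, hk₀⟩ := y.sq_mem_of_pow h2 hM ha0 ha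
  have hroots : ∀ k, ∃ n ≥ k, ∃ Q : ℕ, (Q : E) ≠ 0 ∧ ∃ b ∈ x.rat (M * Q), b ^ n = a ^ 2 := by
    intro k
    obtain ⟨n, hn, Q, hQ, b, hb, hba⟩ := h (max k k₀)
    refine ⟨n, (le_max_left _ _).trans hn, Q, hQ, b ^ 2,
      hk₀ n ((le_max_right _ _).trans hn) Q hQ b hb hba, ?_⟩
    rw [← hba, ← pow_mul, ← pow_mul, mul_comm]
  have ha2 : a ^ 2 ∈ x.rat M := by
    obtain ⟨n, hn, Q, hQ, b, hb, hba⟩ := hroots 0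
    have hσ : y.σ (a ^ 2) = a ^ 2 := by rw [← hba, map_pow, y.σ_rat hb]
    obtain ⟨f, hf, h⟩ := y.sq_cases h2 ha hσ
    exact y.sq_mem_of_cases hM0 hf h
  obtain ⟨c, α, hc⟩ := x.exists_monomial_of_pow hM (pow_ne_zero _ ha0) ha2 hroots
  obtain ⟨d, rfl⟩ := IsAlgClosed.exists_pow_nat_eq c two_pos
  have h3 : a ^ 2 = (algebraMap E Ω d * x.e (α / 2)) ^ 2 := by
    rw [hc, mul_pow, ← x.e_nat_mul, map_pow]
    congr 2
    push_cast; ring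
  rcases sq_eq_sq_iff_eq_or_eq_neg.1 h3 with h | h
  · exact ⟨_, _, h⟩
  · exact ⟨-d, α / 2, by rw [h, _root_.map_neg]; ring⟩

/-- If `1 + c t ^ α` is a square in some `quad N`, `N` odd, then `c t ^ α` is constant or it is `t`
to a power of the characteristic exponent. -/
theorem eq_one_of_one_add_sq {p : ℕ} [ExpChar E p] (hp : p ≠ 2) {N : ℕ} (hN : (N : E) ≠ 0)
    (hodd : Odd N) {c : E} (hc : c ≠ 0) {α : ℚ} {b : Ω} (hb : b ∈ y.quad N)
    (h : 1 + algebraMap E Ω c * x.e α = b ^ 2) :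
    α = 0 ∨ c = 1 ∧ ∃ i : ℕ, α = p ^ i := by
  have hN0 : N ≠ 0 := by rintro rfl; simp at hN
  have hp1 : Odd p := by
    rcases ‹ExpChar E p› with _ | ⟨hpr⟩
    · exact odd_one
    · exact hpr.odd_of_ne_two hp
  have h2 : (2 : E) ≠ 0 := by
    rcases ‹ExpChar E p› with _ | ⟨hpr⟩
    · exact two_ne_zero
    · intro h0
      have := (CharP.cast_eq_zero_iff E p 2).1 (by exact_mod_cast h0)
      exact hp ((Nat.prime_dvd_prime_iff_eq hpr Nat.prime_two).1 this)
  have hσ : y.σ (b ^ 2) = b ^ 2 := by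
    rw [← h, map_add, map_one, map_mul, y.σ_e, AlgHom.commutes]
  obtain ⟨f, hf, hbf⟩ := y.sq_cases h2 hb hσ
  obtain ⟨η, hη⟩ : ∃ η : ℕ, b ^ 2 = f ^ 2 * (1 + x.e 1) ^ η := by
    rcases hbf with rfl | rfl
    · exact ⟨0, by simp⟩
    · exact ⟨1, by rw [mul_pow, y.s_sq, pow_one]⟩
  have hmem : algebraMap E Ω c * x.e α ∈ x.rat N := by
    have h3 : algebraMap E Ω c * x.e α = b ^ 2 - 1 := by rw [← h]; ring
    rw [h3]
    exact sub_mem (y.sq_mem_of_cases hN0 hf hbf) (one_mem _)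
  obtain ⟨k, hk⟩ := x.exists_exponent hN0 hc hmem
  obtain ⟨P, D, hD, -, hPD⟩ := x.exists_isCoprime hN0 hf
  have hone : aeval (x.root N) (1 + X ^ N : E[X]) = 1 + x.e 1 := by
    rw [map_add, map_one, map_pow, aeval_X, x.root_pow_self hN0]
  have hfin : ∀ i : ℕ, ((N * p ^ i : ℕ) : ℚ) / N = p ^ i := by
    intro i
    have : (N : ℚ) ≠ 0 := by exact_mod_cast hN0
    push_cast
    field_simp
  rcases lt_trichotomy k 0 with hk0 | hk0 | hk0
  · -- `1 + c X ^ (-m)` is `c X ^ (-m) * (1 + c⁻¹ X ^ m)`, where `m` is odd by the comparison of the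
    -- roots other than zero and even by that of the order at zero
    exfalso
    obtain ⟨m, hm⟩ : ∃ m : ℕ, k = -m := ⟨k.natAbs, by omega⟩
    have hm0 : m ≠ 0 := by omega
    have e1 : x.e α = (x.root N ^ m)⁻¹ := by
      rw [x.root_pow hN0, ← x.e_neg, hk, hm]; congr 1; push_cast; ring
    have hy0 : x.root N ^ m ≠ 0 := by rw [x.root_pow hN0]; exact x.e_ne_zero _
    have hc' : algebraMap E Ω c ≠ 0 := by simpa using hc
    have key : D ^ 2 * (1 + C c⁻¹ * X ^ m) = C c⁻¹ * X ^ m * P ^ 2 * (1 + X ^ N) ^ η := by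
      apply x.aeval_injective hN0
      rw [map_mul, map_mul, map_mul, map_mul, map_pow _ (1 + X ^ N), hone, map_add, map_mul,
        map_pow, map_pow, map_pow, aeval_C, aeval_X, map_one, ← hPD]
      have h4 : 1 + algebraMap E Ω c * (x.root N ^ m)⁻¹ = f ^ 2 * (1 + x.e 1) ^ η := by
        rw [← hη, ← h, e1]
      have h5 : x.root N ^ m * (x.root N ^ m)⁻¹ = 1 := mul_inv_cancel₀ hy0
      have h6 : algebraMap E Ω c⁻¹ * algebraMap E Ω c = 1 := by
        rw [← map_mul, inv_mul_cancel₀ hc, map_one]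
      linear_combination (aeval (x.root N) D ^ 2 * algebraMap E Ω c⁻¹ * x.root N ^ m) * h4
        - (aeval (x.root N) D ^ 2 * algebraMap E Ω c⁻¹ * algebraMap E Ω c) * h5
        - aeval (x.root N) D ^ 2 * h6
    obtain ⟨-, ⟨i, hi⟩, hev⟩ :=
      eq_one_of_sq_mul_eq hp hD (inv_ne_zero hc) (inv_ne_zero hc) hm0 hN key
    exact Nat.not_even_iff_odd.2 (hi ▸ hodd.mul hp1.pow) hev
  · exact Or.inl (by rw [hk, hk0]; simp)
  · right
    obtain ⟨m, hm⟩ : ∃ m : ℕ, k = m := ⟨k.natAbs, by omega⟩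
    have e1 : x.e α = x.root N ^ m := by
      rw [x.root_pow hN0, hk, hm]; congr 1
    have key : D ^ 2 * (1 + C c * X ^ m) = C 1 * X ^ 0 * P ^ 2 * (1 + X ^ N) ^ η := by
      apply x.aeval_injective hN0
      rw [map_mul, map_mul, map_mul, map_mul, map_pow _ (1 + X ^ N), hone, map_add, map_mul,
        map_pow, map_pow, map_pow, map_pow, aeval_C, aeval_C, aeval_X, map_one, map_one, ← hPD]
      have h4 : 1 + algebraMap E Ω c * x.root N ^ m = f ^ 2 * (1 + x.e 1) ^ η := by
        rw [← hη, ← h, e1]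
      linear_combination (aeval (x.root N) D ^ 2) * h4
    obtain ⟨h1, ⟨i, hi⟩, -⟩ := eq_one_of_sq_mul_eq hp hD hc one_ne_zero (by omega) hN key
    refine ⟨h1, i, ?_⟩
    rw [hk, hm, hi, ← hfin i]
    rfl

end Conj

end RationalPowers

end InvUniv

open Polynomial

namespace InvUniv

namespace RationalPowers

open IntermediateField

variable {E Ω : Type*} [Field E] [Field Ω] [Algebra E Ω] (x : RationalPowers E Ω)

/-! ### Existence of the conjugation -/

theorem e_mem_rat {N : ℕ} (hN : N ≠ 0) (k : ℤ) : x.e (k / N) ∈ x.rat N := by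
  rcases Int.eq_nat_or_neg k with ⟨m, rfl | rfl⟩
  · have := x.root_pow hN m
    push_cast
    rw [← this]
    exact pow_mem (x.root_mem_rat N) m
  · have : x.e ((-(m : ℤ) : ℤ) / N) = (x.root N ^ m)⁻¹ := by
      rw [x.root_pow hN, ← x.e_neg]; congr 1; push_cast; ring
    rw [this]
    exact inv_mem (pow_mem (x.root_mem_rat N) m)

theorem e_mem_rat_den (α : ℚ) : x.e α ∈ x.rat α.den := by
  have := x.e_mem_rat α.den_nz α.num
  rwa [Rat.num_div_den] at this

variable [IsAlgClosed E]

/-- The element `1 + t` is not a square of a rational function: the comparison of roots with `(1 + X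
^ m) ^ 0` for `m = 1` and for `m = 2` would show that `N` is odd and even. -/
theorem sqrt_notMem_rat {p : ℕ} [ExpChar E p] (hp : p ≠ 2) {s : Ω} (hs : s ^ 2 = 1 + x.e 1) {N : ℕ}
    (hN : N ≠ 0) : s ∉ x.rat N := by
  intro h
  have hp1 : Odd p := by
    rcases ‹ExpChar E p› with _ | ⟨hpr⟩
    · exact odd_one
    · exact hpr.odd_of_ne_two hp
  have h2 : ((2 : ℕ) : E) ≠ 0 := by
    rcases ‹ExpChar E p› with _ | ⟨hpr⟩
    · exact Nat.cast_ne_zero.2 two_ne_zero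
    · intro h0
      exact hp ((Nat.prime_dvd_prime_iff_eq hpr Nat.prime_two).1
        ((CharP.cast_eq_zero_iff E p 2).1 h0))
  obtain ⟨P, D, hD, -, hPD⟩ := x.exists_isCoprime hN h
  have key : D ^ 2 * (1 + C 1 * X ^ N) = C 1 * X ^ 0 * P ^ 2 := by
    apply x.aeval_injective hN
    rw [map_mul, map_mul, map_mul, map_add, map_mul, map_pow, map_pow, map_pow, map_pow, aeval_C,
      aeval_X, map_one, map_one, ← hPD, x.root_pow_self hN]
    linear_combination -(aeval (x.root N) D ^ 2) * hs
  have key' : ∀ m : ℕ, D ^ 2 * (1 + C 1 * X ^ N) = C 1 * X ^ 0 * P ^ 2 * (1 + X ^ m) ^ 0 := by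
    intro m
    rw [pow_zero (1 + X ^ m : E[X]), mul_one]
    exact key
  have h1 : ((1 : ℕ) : E) ≠ 0 := by rw [Nat.cast_one]; exact one_ne_zero
  obtain ⟨-, ⟨i, hi⟩, -⟩ := eq_one_of_sq_mul_eq hp hD one_ne_zero one_ne_zero hN h1 (key' 1)
  obtain ⟨-, ⟨j, hj⟩, -⟩ := eq_one_of_sq_mul_eq hp hD one_ne_zero one_ne_zero hN h2 (key' 2)
  rw [hi, one_mul] at hj
  exact Nat.not_even_iff_odd.2 (hp1.pow (n := i)) (hj ▸ even_two_mul _)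

/-- The conjugation exists if the ambient field is the algebraic closure of the field of rational
functions of all powers of `t`, as `s` and `-s` are conjugate over the latter. -/
theorem exists_conj {p : ℕ} [ExpChar E p] (hp : p ≠ 2) [IsAlgClosed Ω] {s : Ω}
    (hs : s ^ 2 = 1 + x.e 1)
    (halg : Algebra.IsAlgebraic (adjoin E (Set.range x.e)) Ω) : ∃ y : x.Conj, y.s = s := by
  set F := adjoin E (Set.range x.e) with hF
  have hF' : ∀ a ∈ F, ∃ N ≠ 0, a ∈ x.rat N := by
    intro a ha
    induction ha using adjoin_induction with
    | mem a ha =>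
      obtain ⟨α, rfl⟩ := ha
      exact ⟨α.den, α.den_nz, x.e_mem_rat_den α⟩
    | algebraMap a => exact ⟨1, one_ne_zero, _root_.algebraMap_mem _ a⟩
    | add a b _ _ ha hb =>
      obtain ⟨M, hM, ha⟩ := ha
      obtain ⟨N, hN, hb⟩ := hb
      exact ⟨M * N, mul_ne_zero hM hN,
        add_mem (x.rat_le hM hN ha) (mul_comm N M ▸ x.rat_le hN hM hb)⟩
    | inv a _ ha =>
      obtain ⟨M, hM, ha⟩ := ha
      exact ⟨M, hM, inv_mem ha⟩
    | mul a b _ _ ha hb =>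
      obtain ⟨M, hM, ha⟩ := ha
      obtain ⟨N, hN, hb⟩ := hb
      exact ⟨M * N, mul_ne_zero hM hN,
        mul_mem (x.rat_le hM hN ha) (mul_comm N M ▸ x.rat_le hN hM hb)⟩
  have hsF : s ∉ F := by
    intro h
    obtain ⟨N, hN, h⟩ := hF' s h
    exact x.sqrt_notMem_rat hp hs hN h
  have hmem : ∀ α, x.e α ∈ F := fun α => subset_adjoin _ _ ⟨α, rfl⟩
  have ht : 1 + x.e 1 ∈ F := add_mem (one_mem _) (hmem 1)
  have hint : IsIntegral F s := (halg.isAlgebraic s).isIntegral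
  set f : F[X] := X ^ 2 - C ⟨_, ht⟩ with hf
  have hfm : f.Monic := monic_X_pow_sub_C _ two_ne_zero
  have hfd : f.natDegree = 2 := natDegree_X_pow_sub_C
  have hf0 : ∀ a : Ω, a ^ 2 = 1 + x.e 1 → aeval a f = 0 := by
    intro a ha
    rw [hf, map_sub, map_pow, aeval_X, aeval_C, ha]
    exact sub_self _
  have h2 : 2 ≤ (minpoly F s).natDegree := by
    rw [minpoly.two_le_natDegree_iff hint]
    rintro ⟨a, rfl⟩
    exact hsF a.2
  have hmin : f = minpoly F s :=
    eq_of_monic_of_dvd_of_natDegree_le (minpoly.monic hint) hfm (minpoly.dvd F s (hf0 s hs))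
      (by rw [hfd]; exact h2)
  obtain ⟨φ, hφ⟩ := exists_algHom_of_splits_of_aeval (F := F) (E := Ω) (K := Ω)
    (fun a => ⟨(halg.isAlgebraic a).isIntegral, IsAlgClosed.splits _⟩) (x := s) (y := -s)
    (by rw [← hmin]; exact hf0 _ (by rw [neg_sq, hs]))
  exact ⟨{ s := s
           s_sq := hs
           σ := φ.restrictScalars E
           σ_e := fun α => φ.commutes ⟨_, hmem α⟩
           σ_s := hφ }, rfl⟩

end RationalPowers

/-! ### The ambient field -/

/-- The algebraic closure of the field of fractions of the group algebra over `κ` of the group of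
finitely supported functions `V → ℚ`; that is, of the field generated over `κ` by independent
variables `x_v`, `v ∈ V`, and all their rational powers. -/
def BigField (κ V : Type) [Field κ] : Type :=
  AlgebraicClosure (FractionRing (AddMonoidAlgebra κ (V →₀ ℚ)))

namespace BigField

variable {κ V : Type} [Field κ]

noncomputable instance : Field (BigField κ V) :=
  inferInstanceAs (Field (AlgebraicClosure (FractionRing (AddMonoidAlgebra κ (V →₀ ℚ)))))

instance : IsAlgClosed (BigField κ V) :=
  inferInstanceAs (IsAlgClosed (AlgebraicClosure (FractionRing (AddMonoidAlgebra κ (V →₀ ℚ)))))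

noncomputable instance : Algebra κ (BigField κ V) :=
  inferInstanceAs (Algebra κ (AlgebraicClosure (FractionRing (AddMonoidAlgebra κ (V →₀ ℚ)))))

noncomputable instance : Algebra (AddMonoidAlgebra κ (V →₀ ℚ)) (BigField κ V) :=
  inferInstanceAs (Algebra (AddMonoidAlgebra κ (V →₀ ℚ))
    (AlgebraicClosure (FractionRing (AddMonoidAlgebra κ (V →₀ ℚ)))))

instance : IsScalarTower κ (AddMonoidAlgebra κ (V →₀ ℚ)) (BigField κ V) :=
  inferInstanceAs (IsScalarTower κ (AddMonoidAlgebra κ (V →₀ ℚ))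
    (AlgebraicClosure (FractionRing (AddMonoidAlgebra κ (V →₀ ℚ)))))

instance : FaithfulSMul (AddMonoidAlgebra κ (V →₀ ℚ)) (BigField κ V) := by
  rw [faithfulSMul_iff_algebraMap_injective]
  have h1 := IsFractionRing.injective (AddMonoidAlgebra κ (V →₀ ℚ))
    (FractionRing (AddMonoidAlgebra κ (V →₀ ℚ)))
  have h2 := (algebraMap (FractionRing (AddMonoidAlgebra κ (V →₀ ℚ)))
    (AlgebraicClosure (FractionRing (AddMonoidAlgebra κ (V →₀ ℚ))))).injective
  exact h2.comp h1

instance : Algebra.IsAlgebraic (AddMonoidAlgebra κ (V →₀ ℚ)) (BigField κ V) :=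
  (IsFractionRing.comap_isAlgebraic_iff (A := AddMonoidAlgebra κ (V →₀ ℚ))
    (K := FractionRing (AddMonoidAlgebra κ (V →₀ ℚ)))
    (C := AlgebraicClosure (FractionRing (AddMonoidAlgebra κ (V →₀ ℚ))))).2 inferInstance

instance [Countable κ] [Countable V] : Countable (BigField κ V) := by
  have : Countable (AddMonoidAlgebra κ (V →₀ ℚ)) := by
    have h : Function.Injective (AddMonoidAlgebra.coeff : AddMonoidAlgebra κ (V →₀ ℚ) → _) := by
      rintro ⟨a⟩ ⟨b⟩ h
      exact congrArg _ h
    exact h.countable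
  have h := Algebra.IsAlgebraic.cardinalMk_le_max (AddMonoidAlgebra κ (V →₀ ℚ)) (BigField κ V)
  rw [← Cardinal.mk_le_aleph0_iff]
  exact h.trans (max_le (Cardinal.mk_le_aleph0_iff.2 this) le_rfl)

/-- Injective homomorphisms into an algebraically closed field extend to algebraic extensions. -/
theorem exists_ringHom_extending {R Ω M : Type*} [CommRing R] [IsDomain R] [Field Ω] [Algebra R Ω]
    [FaithfulSMul R Ω] [Algebra.IsAlgebraic R Ω] [Field M] [IsAlgClosed M] (h : R →+* M)
    (hinj : Function.Injective h) : ∃ Θ : Ω →+* M, ∀ a, Θ (algebraMap R Ω a) = h a := by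
  let _ := h.toAlgebra
  have : FaithfulSMul R M := (faithfulSMul_iff_algebraMap_injective R M).2 hinj
  exact ⟨(IsAlgClosed.lift : Ω →ₐ[R] M).toRingHom, fun a => AlgHom.commutes _ a⟩

/-- The monomial `x ^ γ`. -/
noncomputable def mon (γ : V →₀ ℚ) : BigField κ V :=
  algebraMap (AddMonoidAlgebra κ (V →₀ ℚ)) _ (AddMonoidAlgebra.single γ 1)

theorem mon_zero : mon (κ := κ) (0 : V →₀ ℚ) = 1 := by
  rw [mon, ← AddMonoidAlgebra.one_def, map_one]

theorem mon_add (γ δ : V →₀ ℚ) : mon (κ := κ) (γ + δ) = mon γ * mon δ := by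
  rw [mon, mon, mon, ← map_mul, AddMonoidAlgebra.single_mul_single, one_mul]

theorem mon_ne_zero (γ : V →₀ ℚ) : mon (κ := κ) γ ≠ 0 := by
  intro h
  have := mon_add (κ := κ) γ (-γ)
  rw [h, add_neg_cancel, mon_zero, zero_mul] at this
  exact one_ne_zero this

theorem mon_nsmul (n : ℕ) (γ : V →₀ ℚ) : mon (κ := κ) (n • γ) = mon γ ^ n := by
  induction n with
  | zero => simp [mon_zero]
  | succ n ih => rw [succ_nsmul, mon_add, ih, pow_succ]

theorem mon_neg (γ : V →₀ ℚ) : mon (κ := κ) (-γ) = (mon γ)⁻¹ := by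
  refine eq_inv_of_mul_eq_one_left ?_
  rw [← mon_add, neg_add_cancel, mon_zero]

theorem algebraMap_single (γ : V →₀ ℚ) (c : κ) :
    algebraMap (AddMonoidAlgebra κ (V →₀ ℚ)) (BigField κ V) (AddMonoidAlgebra.single γ c) =
      algebraMap κ _ c * mon γ := by
  rw [mon, IsScalarTower.algebraMap_apply κ (AddMonoidAlgebra κ (V →₀ ℚ)) (BigField κ V),
    ← map_mul]
  congr 1
  rw [AddMonoidAlgebra.coe_algebraMap]
  simp [AddMonoidAlgebra.single_mul_single]

theorem algebraMap_injective' :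
    Function.Injective (algebraMap (AddMonoidAlgebra κ (V →₀ ℚ)) (BigField κ V)) :=
  FaithfulSMul.algebraMap_injective _ _

/-- Substitutions `c x ^ γ ↦ σ(c) χ(γ) x ^ h(γ)` of monomials extend to the big field. -/
theorem exists_substitution {W : Type} (σ : κ →+* κ) (χ : Multiplicative (V →₀ ℚ) →* κˣ)
    (h : (V →₀ ℚ) →+ (W →₀ ℚ)) (hinj : Function.Injective h) :
    ∃ Θ : BigField κ V →+* BigField κ W, (∀ c, Θ (algebraMap κ _ c) = algebraMap κ _ (σ c)) ∧
      ∀ γ, Θ (mon γ) = algebraMap κ _ (χ (Multiplicative.ofAdd γ)) * mon (h γ) := by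
  let g : Multiplicative (V →₀ ℚ) →* AddMonoidAlgebra κ (W →₀ ℚ) :=
    { toFun := fun γ => AddMonoidAlgebra.single (h γ.toAdd) (χ γ : κ)
      map_one' := by
        rw [map_one χ, toAdd_one, map_zero h, Units.val_one, AddMonoidAlgebra.one_def]
      map_mul' := fun a b => by
        rw [map_mul χ, toAdd_mul, map_add h, Units.val_mul, AddMonoidAlgebra.single_mul_single] }
  let θ : AddMonoidAlgebra κ (V →₀ ℚ) →+* AddMonoidAlgebra κ (W →₀ ℚ) :=
    AddMonoidAlgebra.liftNCRingHom ((algebraMap κ _).comp σ) g fun _ _ => mul_comm _ _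
  have hθ : ∀ γ c, θ (AddMonoidAlgebra.single γ c) =
      AddMonoidAlgebra.single (h γ) (σ c * χ (Multiplicative.ofAdd γ)) := by
    intro γ c
    have h1 : θ (AddMonoidAlgebra.single γ c) = algebraMap κ (AddMonoidAlgebra κ (W →₀ ℚ)) (σ c) *
        g (Multiplicative.ofAdd γ) := AddMonoidAlgebra.liftNC_single _ _ _ _
    rw [h1, AddMonoidAlgebra.coe_algebraMap]
    simp [g, AddMonoidAlgebra.single_mul_single]
  have hcoeff : ∀ a γ, (θ a).coeff (h γ) = σ (a.coeff γ) * χ (Multiplicative.ofAdd γ) := by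
    intro a γ
    induction a using AddMonoidAlgebra.induction_linear with
    | zero => simp
    | add a b ha hb => simp [ha, hb, add_mul]
    | single δ c =>
      classical
      rw [hθ, AddMonoidAlgebra.coeff_single, AddMonoidAlgebra.coeff_single, Finsupp.single_apply,
        Finsupp.single_apply]
      by_cases hδ : δ = γ
      · simp [hδ]
      · simp [hδ, hinj.eq_iff]
  have hθinj : Function.Injective θ := by
    rw [injective_iff_map_eq_zero]
    intro a ha
    ext γ
    have := hcoeff a γ
    rw [ha] at this
    simpa using this.symm
  obtain ⟨Θ, hΘ⟩ := exists_ringHom_extending (Ω := BigField κ V)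
    ((algebraMap (AddMonoidAlgebra κ (W →₀ ℚ)) (BigField κ W)).comp θ)
    (algebraMap_injective'.comp hθinj)
  refine ⟨Θ, fun c => ?_, fun γ => ?_⟩
  · have h1 := hΘ (AddMonoidAlgebra.single 0 c)
    rw [RingHom.comp_apply, hθ, algebraMap_single, algebraMap_single, mon_zero, map_zero h,
      mon_zero, ofAdd_zero, map_one χ] at h1
    simpa using h1
  · rw [mon, hΘ, RingHom.comp_apply, hθ, algebraMap_single]
    simp

/-- The variable `x_v`. -/
noncomputable def var (v : V) : BigField κ V := mon (Finsupp.single v 1)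

theorem algebraicIndependent_var : AlgebraicIndependent κ (var : V → BigField κ V) := by
  rw [algebraicIndependent_iff_injective_aeval]
  let i : (V →₀ ℕ) →+ (V →₀ ℚ) := Finsupp.mapRange.addMonoidHom (Nat.castAddMonoidHom ℚ)
  have hi : Function.Injective i :=
    Finsupp.mapRange_injective _ (Nat.cast_zero) Nat.cast_injective
  let φ : MvPolynomial V κ →ₐ[κ] AddMonoidAlgebra κ (V →₀ ℚ) :=
    AddMonoidAlgebra.mapDomainAlgHom κ κ i
  have hφ : Function.Injective φ := AddMonoidAlgebra.mapDomain_injective hi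
  have h : MvPolynomial.aeval (var : V → BigField κ V) =
      (IsScalarTower.toAlgHom κ (AddMonoidAlgebra κ (V →₀ ℚ)) (BigField κ V)).comp φ := by
    refine MvPolynomial.algHom_ext fun v => ?_
    rw [MvPolynomial.aeval_X, AlgHom.comp_apply]
    have : φ (MvPolynomial.X v) = AddMonoidAlgebra.single (Finsupp.single v 1) 1 := by
      have h1 : φ (MvPolynomial.X v) = AddMonoidAlgebra.mapDomain i
        (AddMonoidAlgebra.single (Finsupp.single v 1) 1) := rfl
      rw [h1, AddMonoidAlgebra.mapDomain_single]
      simp [i]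
    rw [this]
    rfl
  rw [h]
  exact algebraMap_injective'.comp hφ

/-! ### The elements that do not depend on a given variable -/

open IntermediateField

/-- The elements algebraic over the variables other than `x_v`. -/
noncomputable def baseField (v : V) : IntermediateField κ (BigField κ V) :=
  (algebraicClosure (adjoin κ (var (κ := κ) '' {v}ᶜ)) (BigField κ V)).restrictScalars κ

noncomputable instance (v : V) : IsAlgClosed (baseField (κ := κ) v) :=
  show IsAlgClosed (algebraicClosure (adjoin κ (var (κ := κ) '' {v}ᶜ)) (BigField κ V)) from
  (algebraicClosure.isAlgClosure (adjoin κ (var (κ := κ) '' {v}ᶜ)) (BigField κ V)).isAlgClosed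

theorem mem_baseField {v : V} {a : BigField κ V} :
    a ∈ baseField v ↔ IsAlgebraic (Algebra.adjoin κ (var (κ := κ) '' {v}ᶜ)) a := by
  rw [← isAlgebraic_adjoin_iff, baseField, mem_restrictScalars, mem_algebraicClosure_iff]

theorem mem_baseField_of_pow {v : V} {a : BigField κ V} {n : ℕ} (hn : 0 < n)
    (h : a ^ n ∈ baseField v) : a ∈ baseField v := by
  rw [mem_baseField] at h ⊢
  exact h.of_pow hn

theorem var_mem_baseField {v w : V} (h : w ≠ v) : var w ∈ baseField (κ := κ) v := by
  rw [mem_baseField]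
  exact isAlgebraic_algebraMap
    (⟨var w, Algebra.subset_adjoin ⟨w, h, rfl⟩⟩ : Algebra.adjoin κ (var (κ := κ) '' {v}ᶜ))

theorem mon_single_mem {S : IntermediateField κ (BigField κ V)} {w : V} {α : ℚ}
    (hw : var w ∈ S) (hS : ∀ a n, 0 < n → a ^ n ∈ S → a ∈ S) : mon (Finsupp.single w α) ∈ S := by
  refine hS _ α.den α.den_pos ?_
  have h1 : α.den • Finsupp.single w α = Finsupp.single w (α.num : ℚ) := by
    rw [Finsupp.smul_single, nsmul_eq_mul, Rat.den_mul_eq_num]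
  have h2 : ∀ n : ℕ, mon (κ := κ) (Finsupp.single w (n : ℚ)) ∈ S := by
    intro n
    have : Finsupp.single w (n : ℚ) = n • Finsupp.single w 1 := by simp
    rw [this, mon_nsmul]
    exact pow_mem hw n
  rw [← mon_nsmul, h1]
  rcases Int.eq_nat_or_neg α.num with ⟨n, h | h⟩
  · rw [h]; exact h2 n
  · rw [h]
    push_cast
    rw [Finsupp.single_neg, mon_neg]
    exact inv_mem (h2 n)

theorem mon_mem_baseField {v : V} {γ : V →₀ ℚ} (h : γ v = 0) : mon γ ∈ baseField (κ := κ) v := by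
  induction γ using Finsupp.induction with
  | zero => rw [mon_zero]; exact one_mem _
  | single_add w α f hw hα ih =>
    have hwv : w ≠ v := by
      rintro rfl
      rw [Finsupp.add_apply, Finsupp.single_eq_same, Finsupp.notMem_support_iff.1 hw,
        add_zero] at h
      exact hα h
    rw [Finsupp.add_apply, Finsupp.single_eq_of_ne hwv.symm, zero_add] at h
    rw [mon_add]
    exact mul_mem (mon_single_mem (var_mem_baseField hwv) fun a n hn => mem_baseField_of_pow hn)
      (ih h)

theorem transcendental_var (v : V) :
    Transcendental (baseField (κ := κ) v) (var (κ := κ) v) := by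
  have h1 : Transcendental (Algebra.adjoin κ (var (κ := κ) '' {v}ᶜ)) (var (κ := κ) v) :=
    algebraicIndependent_var.transcendental_adjoin (by simp)
  have h2 := transcendental_adjoin_iff.2 h1
  exact h2.extendScalars (algebraicClosure (adjoin κ (var (κ := κ) '' {v}ᶜ)) (BigField κ V))

/-- The rational powers of the variable `x_v`. -/
noncomputable def powers (v : V) : RationalPowers (baseField (κ := κ) v) (BigField κ V) where
  e α := mon (Finsupp.single v α)
  e_zero := by rw [Finsupp.single_zero, mon_zero]
  e_add α β := by rw [Finsupp.single_add, mon_add]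
  transcendental := transcendental_var v

/-- The big field is algebraic over the powers of one variable and the elements independent of it.
-/
theorem isAlgebraic_powers (v : V) : Algebra.IsAlgebraic
    (adjoin (baseField (κ := κ) v) (Set.range (powers (κ := κ) v).e)) (BigField κ V) := by
  classical
  set F := adjoin (baseField (κ := κ) v) (Set.range (powers (κ := κ) v).e) with hF
  have hmem : ∀ a, algebraMap (AddMonoidAlgebra κ (V →₀ ℚ)) (BigField κ V) a ∈ F := by
    intro a
    induction a using AddMonoidAlgebra.induction_linear with
    | zero => rw [map_zero]; exact zero_mem _
    | add a b ha hb => rw [map_add]; exact add_mem ha hb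
    | single γ c =>
      rw [algebraMap_single]
      have h1 : γ = γ.erase v + Finsupp.single v (γ v) := (Finsupp.erase_add_single v γ).symm
      have hE : ∀ b ∈ baseField (κ := κ) v, b ∈ F := fun b hb => F.algebraMap_mem ⟨b, hb⟩
      rw [h1, mon_add]
      refine mul_mem (hE _ ((baseField v).algebraMap_mem c)) (mul_mem (hE _ ?_) ?_)
      · exact mon_mem_baseField (by simp)
      · exact subset_adjoin _ _ ⟨γ v, rfl⟩
  let _ : Algebra (AddMonoidAlgebra κ (V →₀ ℚ)) F :=
    ((algebraMap (AddMonoidAlgebra κ (V →₀ ℚ)) (BigField κ V)).codRestrict F hmem).toAlgebra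
  have : IsScalarTower (AddMonoidAlgebra κ (V →₀ ℚ)) F (BigField κ V) :=
    IsScalarTower.of_algebraMap_eq fun _ => rfl
  have hinj : Function.Injective (algebraMap (AddMonoidAlgebra κ (V →₀ ℚ)) F) := fun a b h =>
    algebraMap_injective' (congrArg Subtype.val h)
  exact ⟨fun a => (Algebra.IsAlgebraic.isAlgebraic (R := AddMonoidAlgebra κ (V →₀ ℚ))
    a).extendScalars hinj⟩

/-- An element that is algebraic over the variables other than `x_v`, for every `v`, is constant. -/
theorem mem_range_of_forall_mem_baseField [IsAlgClosed κ] [Nonempty V] {a : BigField κ V}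
    (h : ∀ v, a ∈ baseField (κ := κ) v) : ∃ c, algebraMap κ _ c = a := by
  set M := AlgebraicIndependent.matroid κ (BigField κ V)
  have hI : M.Indep (Set.range var) :=
    AlgebraicIndependent.matroid_indep_iff.2 algebraicIndependent_var.to_subtype_range
  have hinj : Function.Injective (var : V → BigField κ V) := algebraicIndependent_var.injective
  -- the closures of subsets of an independent set intersect in the closure of the intersection
  have h1 := hI.closure_sInter_eq_biInter_closure_of_forall_subset
    (Js := Set.range fun v : V => (var (κ := κ) '' {v}ᶜ : Set (BigField κ V)))
    (Set.range_nonempty _)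
    (by rintro _ ⟨v, rfl⟩; exact Set.image_subset_range _ _)
  have h2 : ⋂₀ (Set.range fun v : V => (var (κ := κ) '' {v}ᶜ : Set (BigField κ V))) = ∅ := by
    rw [Set.eq_empty_iff_forall_notMem]
    intro b hb
    rw [Set.sInter_range, Set.mem_iInter] at hb
    obtain ⟨w, -, rfl⟩ := hb (Classical.arbitrary V)
    obtain ⟨u, hu, hu'⟩ := hb w
    exact hu (hinj hu')
  have h3 : a ∈ M.closure ∅ := by
    rw [← h2, h1]
    simp only [Set.biInter_range, Set.mem_iInter]
    intro v
    rw [AlgebraicIndependent.matroid_closure_eq]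
    exact mem_baseField.1 (h v)
  rw [AlgebraicIndependent.matroid_closure_eq] at h3
  have h4 : IsAlgebraic (Algebra.adjoin κ (∅ : Set (BigField κ V))) a := h3
  have h5 : IsAlgebraic κ a := by
    have : Algebra.IsAlgebraic κ (Algebra.adjoin κ (∅ : Set (BigField κ V))) :=
      (Subalgebra.isAlgebraic_iff _).1 <|
        (Algebra.isAlgebraic_adjoin_iff (R := κ) (s := (∅ : Set (BigField κ V)))).2
          fun x hx => absurd hx (Set.notMem_empty x)
    exact h4.restrictScalars κ
  exact minpoly.mem_range_of_degree_eq_one κ a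
    (IsAlgClosed.degree_eq_one_of_irreducible κ (minpoly.irreducible h5.isIntegral))

end BigField

namespace BigField

variable {κ V : Type} [Field κ]

open IntermediateField

/-! ### Square roots and subfields given by groups of exponents -/

theorem exists_sqrt (v : V) : ∃ s : BigField κ V, s ^ 2 = 1 + var v :=
  IsAlgClosed.exists_pow_nat_eq _ two_pos

/-- A square root of `1 + x_v`. -/
noncomputable def sqrtVar (v : V) : BigField κ V := (exists_sqrt v).choose

theorem sqrtVar_sq (v : V) : sqrtVar (κ := κ) v ^ 2 = 1 + var v := (exists_sqrt v).choose_spec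

/-- The subfield generated, over the prime field, by the monomials with exponent in `Γ` and the
square roots of the elements `1 + x_v`. -/
noncomputable def subfield (κ : Type) [Field κ] (Γ : AddSubgroup (V →₀ ℚ)) :
    Subfield (BigField κ V) :=
  Subfield.closure (mon '' (Γ : Set (V →₀ ℚ)) ∪ Set.range sqrtVar)

variable {Γ : AddSubgroup (V →₀ ℚ)}

theorem mon_mem {γ : V →₀ ℚ} (h : γ ∈ Γ) : mon γ ∈ subfield κ Γ :=
  Subfield.subset_closure (Or.inl ⟨γ, h, rfl⟩)

theorem sqrtVar_mem (v : V) : sqrtVar v ∈ subfield κ Γ :=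
  Subfield.subset_closure (Or.inr ⟨v, rfl⟩)

theorem ringHom_ext_of_generators {M : Type*} [Field M] {φ ψ : subfield κ Γ →+* M}
    (h1 : ∀ γ (h : γ ∈ Γ), φ ⟨mon γ, mon_mem h⟩ = ψ ⟨mon γ, mon_mem h⟩)
    (h2 : ∀ v, φ ⟨sqrtVar v, sqrtVar_mem v⟩ = ψ ⟨sqrtVar v, sqrtVar_mem v⟩) : φ = ψ := by
  have key : ∀ a (ha : a ∈ subfield κ Γ), φ ⟨a, ha⟩ = ψ ⟨a, ha⟩ := by
    intro a ha
    induction ha using Subfield.closure_induction with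
    | mem a h =>
      rcases h with ⟨γ, hγ, rfl⟩ | ⟨v, rfl⟩
      · exact h1 γ hγ
      · exact h2 v
    | one => exact (map_one φ).trans (map_one ψ).symm
    | add a b ha hb iha ihb =>
      have := congrArg₂ (· + ·) iha ihb
      simp only [← map_add] at this
      exact this
    | neg a ha iha =>
      have := congrArg Neg.neg iha
      simp only [← map_neg] at this
      exact this
    | inv a ha iha =>
      have := congrArg Inv.inv iha
      simp only [← map_inv₀] at this
      exact this
    | mul a b ha hb iha ihb =>
      have := congrArg₂ (· * ·) iha ihb
      simp only [← map_mul] at this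
      exact this
  exact RingHom.ext fun a => key a.1 a.2

theorem map_mem_of_generators {W : Type} {Γ' : AddSubgroup (W →₀ ℚ)}
    (Θ : BigField κ V →+* BigField κ W) (h1 : ∀ γ ∈ Γ, Θ (mon γ) ∈ subfield κ Γ')
    (h2 : ∀ v, Θ (sqrtVar v) ∈ subfield κ Γ') {a : BigField κ V} (ha : a ∈ subfield κ Γ) :
    Θ a ∈ subfield κ Γ' := by
  have : subfield κ Γ ≤ (subfield κ Γ').comap Θ := by
    refine (Subfield.closure_le).2 ?_
    rintro _ (⟨γ, hγ, rfl⟩ | ⟨v, rfl⟩)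
    · exact h1 γ hγ
    · exact h2 v
  exact this ha

theorem eq_id_of_generators (Θ : BigField κ V →+* BigField κ V) (h1 : ∀ γ ∈ Γ, Θ (mon γ) = mon γ)
    (h2 : ∀ v, Θ (sqrtVar v) = sqrtVar v) {a : BigField κ V} (ha : a ∈ subfield κ Γ) :
    Θ a = a := by
  have : subfield κ Γ ≤ RingHom.eqLocusField Θ (RingHom.id _) := by
    refine (Subfield.closure_le).2 ?_
    rintro _ (⟨γ, hγ, rfl⟩ | ⟨v, rfl⟩)
    · exact h1 γ hγ
    · exact h2 v
  exact this ha

/-- A homomorphism that sends the variable `x_v` to `x_w` sends `√(1 + x_v)` to `√(1 + x_w)`, up to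
sign. -/
theorem map_sqrtVar {W : Type} {Θ : BigField κ V →+* BigField κ W} {v : V} {w : W}
    (h : Θ (var v) = var w) :
    Θ (sqrtVar v) = sqrtVar w ∨ Θ (sqrtVar v) = -sqrtVar w := by
  rw [← sq_eq_sq_iff_eq_or_eq_neg, ← map_pow, sqrtVar_sq, sqrtVar_sq, map_add, map_one, h]

/-- An endomorphism that fixes `x ^ γ`, `γ ∈ Γ`, may move `√(1 + x_v)`, but its square does not. -/
theorem map_map_eq_self (hΓ : ∀ v, Finsupp.single v 1 ∈ Γ) {Θ : BigField κ V →+* BigField κ V}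
    (h : ∀ γ ∈ Γ, Θ (mon γ) = mon γ) {a : BigField κ V} (ha : a ∈ subfield κ Γ) :
    Θ (Θ a) = a := by
  refine eq_id_of_generators (Θ.comp Θ) (fun γ hγ => ?_) (fun v => ?_) ha
  · rw [RingHom.comp_apply, h γ hγ, h γ hγ]
  · rw [RingHom.comp_apply]
    rcases map_sqrtVar (h _ (hΓ v)) with h1 | h1
    · rw [h1, h1]
    · rw [h1, map_neg, h1, neg_neg]

/-! ### Roots of monomials and roots of unity in the subfields -/

/-- Roots of monomials in the big field are monomials with a root of unity as coefficient. -/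
theorem eq_algebraMap_mul_mon [IsAlgClosed κ] {b : BigField κ V} {n : ℕ} (hn : n ≠ 0)
    {γ : V →₀ ℚ} (hb : b ^ n = mon (n • γ)) :
    ∃ ζ : κ, ζ ^ n = 1 ∧ b = algebraMap κ _ ζ * mon γ := by
  have h0 := mon_ne_zero (κ := κ) γ
  have h1 : (b / mon γ) ^ n = 1 := by
    rw [div_pow, hb, mon_nsmul, div_self (pow_ne_zero _ h0)]
  have h2 : IsIntegral κ (b / mon γ) := by
    refine IsIntegral.of_pow (Nat.pos_of_ne_zero hn) ?_
    rw [h1]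
    exact isIntegral_one
  obtain ⟨ζ, hζ⟩ := minpoly.mem_range_of_degree_eq_one κ (b / mon γ)
    (IsAlgClosed.degree_eq_one_of_irreducible κ (minpoly.irreducible h2))
  refine ⟨ζ, ?_, ?_⟩
  · apply (algebraMap κ (BigField κ V)).injective
    rw [map_pow, hζ, h1, map_one]
  · rw [hζ, div_mul_cancel₀ _ h0]

/-- An element whose order modulo `Γ` is a prime `ℓ` is detected by a character that is trivial on
`Γ`: map it to a primitive `ℓ`-th root of unity, and extend the character, since the multiplicative
group of an algebraically closed field is divisible, hence injective. -/
theorem exists_character [IsAlgClosed κ] {A : Type} [AddCommGroup A] (Γ : AddSubgroup A) {δ : A}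
    {ℓ : ℕ} (hℓ : ℓ.Prime) (hκ : (ℓ : κ) ≠ 0) (h : ℓ • δ ∈ Γ) (hδ : δ ∉ Γ) :
    ∃ χ : Multiplicative A →* κˣ, (∀ γ ∈ Γ, χ (Multiplicative.ofAdd γ) = 1) ∧
      χ (Multiplicative.ofAdd δ) ≠ 1 := by
  have : NeZero (ℓ : κ) := ⟨hκ⟩
  obtain ⟨η, hη⟩ := IsAlgClosed.exists_root (Polynomial.cyclotomic ℓ κ)
    (Polynomial.degree_cyclotomic_pos ℓ κ hℓ.pos).ne'
  have hη := Polynomial.isRoot_cyclotomic_iff.1 hη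
  obtain ⟨u, rfl⟩ := hη.isUnit hℓ.ne_zero
  have hu : u ^ ℓ = 1 := Units.ext (by simpa using hη.pow_eq_one)
  have hu1 : u ≠ 1 := fun h => hη.ne_one hℓ.one_lt (by rw [h, Units.val_one])
  let _ : DivisibleBy (Additive κˣ) ℤ := by
    have : DivisibleBy (Additive κˣ) ℕ := by
      refine divisibleByOfSMulRightSurj _ _ ?_
      intro n hn a
      obtain ⟨z, hz⟩ := IsAlgClosed.exists_pow_nat_eq ((a.toMul : κˣ) : κ) (Nat.pos_of_ne_zero hn)
      have hz0 : z ≠ 0 := by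
        rintro rfl
        rw [zero_pow hn] at hz
        exact a.toMul.ne_zero hz.symm
      refine ⟨Additive.ofMul (Units.mk0 z hz0), ?_⟩
      show n • Additive.ofMul (Units.mk0 z hz0) = a
      rw [← ofMul_pow, ← ofMul_toMul a]
      congr 1
      exact Units.ext (by simpa using hz)
    exact AddGroup.divisibleByIntOfDivisibleByNat _
  have : Fact ℓ.Prime := ⟨hℓ⟩
  let d : A ⧸ Γ := QuotientAddGroup.mk δ
  have hd : ((zmultiplesHom (A ⧸ Γ)) d) (ℓ : ℤ) = 0 := by
    rw [zmultiplesHom_apply, natCast_zsmul, ← QuotientAddGroup.mk_nsmul]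
    exact (QuotientAddGroup.eq_zero_iff _).2 h
  have hd0 : d ≠ 0 := fun h => hδ ((QuotientAddGroup.eq_zero_iff _).1 h)
  let i : ZMod ℓ →+ A ⧸ Γ := ZMod.lift ℓ ⟨zmultiplesHom _ d, hd⟩
  have hi1 : i 1 = d := by
    have := ZMod.lift_coe ℓ (⟨zmultiplesHom _ d, hd⟩ : {f : ℤ →+ A ⧸ Γ // f ℓ = 0}) 1
    simpa using this
  have hi : Function.Injective i := by
    rw [injective_iff_map_eq_zero]
    intro a ha
    by_contra ha0
    have h1 : (a⁻¹.val : ZMod ℓ) * a = 1 := by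
      rw [ZMod.natCast_zmod_val, inv_mul_cancel₀ ha0]
    have h2 := congrArg i h1
    rw [← nsmul_eq_mul, map_nsmul, ha, smul_zero, hi1] at h2
    exact hd0 h2.symm
  have hg : ((zmultiplesHom (Additive κˣ)) (Additive.ofMul u)) (ℓ : ℤ) = 0 := by
    rw [zmultiplesHom_apply, natCast_zsmul, ← ofMul_pow, hu, ofMul_one]
  let g : ZMod ℓ →+ Additive κˣ := ZMod.lift ℓ ⟨zmultiplesHom _ (Additive.ofMul u), hg⟩
  have hg1 : g 1 = Additive.ofMul u := by
    have := ZMod.lift_coe ℓ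
      (⟨zmultiplesHom _ (Additive.ofMul u), hg⟩ : {f : ℤ →+ Additive κˣ // f ℓ = 0}) 1
    simpa using this
  obtain ⟨c, hc⟩ := (Module.Baer.of_divisible (Additive κˣ)).extension_property_addMonoidHom i hi g
  refine ⟨AddMonoidHom.toMultiplicativeLeft (c.comp (QuotientAddGroup.mk' Γ)), fun γ hγ => ?_, ?_⟩
  · have h1 : QuotientAddGroup.mk' Γ γ = 0 := (QuotientAddGroup.eq_zero_iff γ).2 hγ
    show (c (QuotientAddGroup.mk' Γ γ)).toMul = 1
    rw [h1, map_zero, toMul_zero]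
  · intro h1
    have h2 : (c d).toMul = 1 := h1
    rw [← hi1, ← AddMonoidHom.comp_apply, hc, hg1] at h2
    exact hu1 h2

/-- A root of odd prime order of a monomial in the subfield is already given by the group of
exponents: otherwise, a character trivial on `Γ` gives an endomorphism of the big field that
multiplies the root by a root of unity of order `ℓ`, but whose square fixes the subfield. -/
theorem mem_of_pow_eq_mon [IsAlgClosed κ] (hΓ : ∀ v, Finsupp.single v 1 ∈ Γ) {b : BigField κ V}
    (hb : b ∈ subfield κ Γ) {ℓ : ℕ} (hℓ : ℓ.Prime) (hodd : ℓ ≠ 2) (hκ : (ℓ : κ) ≠ 0)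
    {δ : V →₀ ℚ} (hδ : ℓ • δ ∈ Γ) (h : b ^ ℓ = mon (ℓ • δ)) : δ ∈ Γ := by
  by_contra hn
  obtain ⟨χ, hχ, hχδ⟩ := exists_character (κ := κ) Γ hℓ hκ hδ hn
  obtain ⟨Θ, hc, hΘ⟩ := exists_substitution (RingHom.id κ) χ (AddMonoidHom.id (V →₀ ℚ))
    Function.injective_id
  have h1 : ∀ γ ∈ Γ, Θ (mon γ) = mon γ := fun γ hγ => by
    rw [hΘ, hχ γ hγ, Units.val_one, map_one, one_mul, AddMonoidHom.id_apply]
  obtain ⟨ζ, -, rfl⟩ := eq_algebraMap_mul_mon hℓ.ne_zero h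
  have h2 := map_map_eq_self hΓ h1 hb
  simp only [map_mul, hc, hΘ, RingHom.id_apply, AddMonoidHom.id_apply] at h2
  have hζ : algebraMap κ (BigField κ V) ζ ≠ 0 := by
    intro h0
    rw [h0, zero_mul, zero_pow hℓ.ne_zero] at h
    exact mon_ne_zero _ h.symm
  set u := χ (Multiplicative.ofAdd δ)
  have h3 : u ^ 2 = 1 := by
    have h4 := mul_left_cancel₀ hζ h2
    rw [← mul_assoc, mul_eq_right₀ (mon_ne_zero _), ← map_mul, ← map_one (algebraMap κ _)] at h4
    refine Units.ext ?_
    rw [sq, Units.val_mul]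
    exact (algebraMap κ (BigField κ V)).injective h4
  have h4 : u ^ ℓ = 1 := by
    rw [← hχ _ hδ, ofAdd_nsmul, map_pow]
  have h5 : u ^ Nat.gcd 2 ℓ = 1 := pow_gcd_eq_one.2 ⟨h3, h4⟩
  rw [(Nat.coprime_primes Nat.prime_two hℓ).2 hodd.symm, pow_one] at h5
  exact hχδ h5

/-- A constant in the subfield is fixed by the square of every endomorphism of the field of
constants. -/
theorem map_map_eq_of_mem (hΓ : ∀ v, Finsupp.single v 1 ∈ Γ) {c : κ}
    (hc : algebraMap κ (BigField κ V) c ∈ subfield κ Γ) (σ : κ →+* κ) : σ (σ c) = c := by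
  obtain ⟨Θ, h, hΘ⟩ := exists_substitution σ 1 (AddMonoidHom.id (V →₀ ℚ)) Function.injective_id
  have h1 := map_map_eq_self hΓ (fun γ _ => by
    rw [hΘ, MonoidHom.one_apply, Units.val_one, map_one, one_mul, AddMonoidHom.id_apply]) hc
  rw [h, h] at h1
  exact (algebraMap κ (BigField κ V)).injective h1

end BigField

/-- The properties of the field of constants: it is algebraic over its prime field and every root
of unity of large prime order is moved by the square of some endomorphism. -/
structure IsConstantField (κ : Type) [Field κ] (p : ℕ) : Prop where
  algebraic : ∀ c : κ, ∃ q : Polynomial ℤ, q.map (Int.castRingHom κ) ≠ 0 ∧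
    Polynomial.aeval c q = 0
  moved : ∀ r : ℕ, r.Prime → p + 4 < r → ∀ c : κ, c ^ r = 1 → c ≠ 1 →
    ∃ σ : κ →+* κ, σ (σ c) ≠ c

namespace BigField

variable {κ V : Type} [Field κ] {Γ : AddSubgroup (V →₀ ℚ)}

/-- All prime factors of `N` exceed `p + 4`. -/
def LargeFactors (p N : ℕ) : Prop := N ≠ 0 ∧ ∀ r : ℕ, r.Prime → r ∣ N → p + 4 < r

theorem LargeFactors.mul {p N M : ℕ} (h : LargeFactors p N) (h' : LargeFactors p M) :
    LargeFactors p (N * M) :=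
  ⟨mul_ne_zero h.1 h'.1, fun r hr hd => (hr.dvd_mul.1 hd).elim (h.2 r hr) (h'.2 r hr)⟩

theorem LargeFactors.pow {p N : ℕ} (h : LargeFactors p N) (n : ℕ) : LargeFactors p (N ^ n) :=
  ⟨pow_ne_zero _ h.1, fun r hr hd => h.2 r hr (hr.dvd_of_dvd_pow hd)⟩

theorem LargeFactors.of_dvd {p N M : ℕ} (h : LargeFactors p N) (hd : M ∣ N) : LargeFactors p M :=
  ⟨ne_zero_of_dvd_ne_zero h.1 hd, fun r hr hr' => h.2 r hr (hr'.trans hd)⟩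

theorem LargeFactors.one (p : ℕ) : LargeFactors p 1 :=
  ⟨one_ne_zero, fun _ hr hd => absurd hd hr.not_dvd_one⟩

theorem LargeFactors.of_prime {p r : ℕ} (hr : r.Prime) (h : p + 4 < r) : LargeFactors p r :=
  ⟨hr.ne_zero, fun _ hq hd => (Nat.prime_dvd_prime_iff_eq hq hr).1 hd ▸ h⟩

theorem LargeFactors.odd {p N : ℕ} (h : LargeFactors p N) : Odd N := by
  rw [← Nat.not_even_iff_odd, even_iff_two_dvd]
  intro h2
  have := h.2 2 Nat.prime_two h2
  omega

theorem LargeFactors.cast_ne_zero {p N : ℕ} (h : LargeFactors p N) [ExpChar κ p] :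
    (N : κ) ≠ 0 := by
  rcases ‹ExpChar κ p› with _ | hp
  · exact Nat.cast_ne_zero.2 h.1
  · intro h0
    have := h.2 p hp ((CharP.cast_eq_zero_iff κ p N).1 h0)
    omega

/-- The subfields contain no nontrivial roots of unity of an order with large prime factors. -/
theorem eq_one_of_pow_eq_one (hΓ : ∀ v, Finsupp.single v 1 ∈ Γ) {p : ℕ} (hκ : IsConstantField κ p)
    {c : κ} (hc : algebraMap κ (BigField κ V) c ∈ subfield κ Γ) {N : ℕ} (hN : LargeFactors p N)
    (h : c ^ N = 1) : c = 1 := by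
  rw [← orderOf_eq_one_iff]
  by_contra h1
  obtain ⟨r, hr, hd⟩ := Nat.exists_prime_and_dvd h1
  have hrN := hN.2 r hr (hd.trans (orderOf_dvd_of_pow_eq_one h))
  obtain ⟨m, hm⟩ := hd
  have hm0 : m ≠ 0 := by
    rintro rfl
    rw [mul_zero, orderOf_eq_zero_iff'] at hm
    exact hm N (Nat.pos_of_ne_zero hN.1) h
  have h2 : (c ^ m) ^ r = 1 := by
    rw [← pow_mul, mul_comm, ← hm, pow_orderOf_eq_one]
  have h3 : c ^ m ≠ 1 := by
    intro h4
    have h5 := Nat.le_of_dvd (Nat.pos_of_ne_zero hm0) (orderOf_dvd_of_pow_eq_one h4)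
    rw [hm] at h5
    have := hr.two_le
    have := Nat.pos_of_ne_zero hm0
    nlinarith
  obtain ⟨σ, hσ⟩ := hκ.moved r hr hrN _ h2 h3
  exact hσ (map_map_eq_of_mem hΓ (by rw [map_pow]; exact pow_mem hc m) σ)

/-! ### Elements of the subfields as functions of one variable -/

variable {p : ℕ} [ExpChar κ p]

instance (v : V) : ExpChar (baseField (κ := κ) v) p :=
  expChar_of_injective_algebraMap (algebraMap κ (baseField (κ := κ) v)).injective p

/-- The big field has an endomorphism that changes the sign of `√(1 + x_v)` and fixes the
powers of `x_v` and all elements independent of `x_v`. -/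
theorem exists_conj_sqrtVar (p : ℕ) [ExpChar κ p] (hp : p ≠ 2) (v : V) :
    ∃ y : (powers (κ := κ) v).Conj, y.s = sqrtVar v :=
  (powers v).exists_conj hp (sqrtVar_sq v) (isAlgebraic_powers v)

/-- All denominators of the exponents in `Γ` have only prime factors larger than `p + 4`. -/
def LargeDenominators (p : ℕ) (Γ : AddSubgroup (V →₀ ℚ)) : Prop :=
  ∀ γ ∈ Γ, ∀ v, LargeFactors p (γ v).den

theorem sqrtVar_mem_baseField {v w : V} (h : w ≠ v) : sqrtVar w ∈ baseField (κ := κ) v := by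
  refine mem_baseField_of_pow two_pos ?_
  rw [sqrtVar_sq]
  exact add_mem (one_mem _) (var_mem_baseField h)

theorem mem_quad_of_mem_baseField {v : V} (y : (powers (κ := κ) v).Conj) {a : BigField κ V}
    (h : a ∈ baseField v) (N : ℕ) : a ∈ y.quad N :=
  y.rat_subset (((powers v).rat N).algebraMap_mem ⟨a, h⟩)

theorem quad_mono_left {v : V} (y : (powers (κ := κ) v).Conj) {N M : ℕ} (hN : N ≠ 0) (hM : M ≠ 0)
    {a : BigField κ V} (h : a ∈ y.quad M) : a ∈ y.quad (N * M) :=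
  mul_comm M N ▸ y.quad_mono hM hN h

omit [ExpChar κ p] in
/-- The elements of the subfield, regarded as functions of the variable `x_v`, are of the form `f +
g √(1 + x_v)` with rational functions `f`, `g` of some root of `x_v`. -/
theorem exists_mem_quad (hΓ : LargeDenominators p Γ) {v : V} (y : (powers (κ := κ) v).Conj)
    (hy : y.s = sqrtVar v) {a : BigField κ V} (ha : a ∈ subfield κ Γ) :
    ∃ N, LargeFactors p N ∧ a ∈ y.quad N := by
  induction ha using Subfield.closure_induction with
  | mem a h =>
    rcases h with ⟨γ, hγ, rfl⟩ | ⟨w, rfl⟩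
    · have hN := hΓ γ hγ v
      refine ⟨_, hN, ?_⟩
      have h1 : mon (κ := κ) γ = mon (γ.erase v) * mon (Finsupp.single v (γ v)) := by
        rw [← mon_add, Finsupp.erase_add_single]
      rw [h1]
      refine y.mul_mem_quad hN.1 (mem_quad_of_mem_baseField y
        (mon_mem_baseField (γ := γ.erase v) (by simp)) _) (y.rat_subset ?_)
      exact (powers (κ := κ) v).e_mem_rat_den (γ v)
    · by_cases hw : w = v
      · subst hw
        exact ⟨1, LargeFactors.one p, 0, zero_mem _, 1, one_mem _, by rw [hy]; ring⟩
      · exact ⟨1, LargeFactors.one p, mem_quad_of_mem_baseField y (sqrtVar_mem_baseField hw) _⟩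
  | one => exact ⟨1, LargeFactors.one p, mem_quad_of_mem_baseField y (one_mem _) _⟩
  | add a b _ _ iha ihb =>
    obtain ⟨N, hN, ha⟩ := iha
    obtain ⟨M, hM, hb⟩ := ihb
    exact ⟨N * M, hN.mul hM, y.add_mem_quad (y.quad_mono hN.1 hM.1 ha)
      (quad_mono_left y hN.1 hM.1 hb)⟩
  | neg a _ iha =>
    obtain ⟨N, hN, ha⟩ := iha
    exact ⟨N, hN, y.neg_mem_quad ha⟩
  | inv a _ iha =>
    obtain ⟨N, hN, ha⟩ := iha
    exact ⟨N, hN, y.inv_mem_quad hN.1 ha⟩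
  | mul a b _ _ iha ihb =>
    obtain ⟨N, hN, ha⟩ := iha
    obtain ⟨M, hM, hb⟩ := ihb
    exact ⟨N * M, hN.mul hM, y.mul_mem_quad (mul_ne_zero hN.1 hM.1) (y.quad_mono hN.1 hM.1 ha)
      (quad_mono_left y hN.1 hM.1 hb)⟩

theorem two_ne_zero_of_expChar (p : ℕ) [ExpChar κ p] (hp : p ≠ 2) : (2 : κ) ≠ 0 := by
  rcases ‹ExpChar κ p› with _ | hp'
  · exact two_ne_zero
  · have : NeZero (2 : κ) := by
      have := Ring.two_ne_zero (R := κ) (by rwa [ringChar.eq κ p])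
      exact ⟨this⟩
    exact two_ne_zero

/-- An element with roots of unboundedly large order such that `1 + a` is a square is constant or a
power of a variable. -/
theorem eq_var_pow_of_roots [IsAlgClosed κ] [Nonempty V] (hp : p ≠ 2) (hΓ : LargeDenominators p Γ)
    {a : BigField κ V} (ha0 : a ≠ 0) (ha : ∀ k, ∃ n ≥ k, ∃ b ∈ subfield κ Γ, b ^ n = a)
    (ha1 : ∃ b ∈ subfield κ Γ, b ^ 2 = 1 + a) :
    (∃ c, algebraMap κ _ c = a) ∨ ∃ (v : V) (i : ℕ), a = var v ^ p ^ i := by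
  by_cases hne : ∃ (v : V) (i : ℕ), a = var v ^ p ^ i
  · exact Or.inr hne
  refine Or.inl (mem_range_of_forall_mem_baseField fun v => ?_)
  obtain ⟨y, hy⟩ := exists_conj_sqrtVar (κ := κ) p hp v
  obtain ⟨n₀, -, b₀, hb₀, hbn⟩ := ha 0
  have haK : a ∈ subfield κ Γ := hbn ▸ pow_mem hb₀ n₀
  obtain ⟨M, hM, haM⟩ := exists_mem_quad hΓ y hy haK
  have h2 : (2 : baseField (κ := κ) v) ≠ 0 := two_ne_zero_of_expChar p hp
  obtain ⟨c, α, hc⟩ := y.exists_monomial_of_pow h2 hM.cast_ne_zero ha0 haM fun k => by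
    obtain ⟨n, hn, b, hb, h⟩ := ha k
    obtain ⟨Q, hQ, hbQ⟩ := exists_mem_quad hΓ y hy hb
    exact ⟨n, hn, Q, hQ.cast_ne_zero, b, quad_mono_left y hM.1 hQ.1 hbQ, h⟩
  have hc0 : c ≠ 0 := by
    rintro rfl
    rw [map_zero, zero_mul] at hc
    exact ha0 hc
  obtain ⟨b, hb, hb2⟩ := ha1
  obtain ⟨N, hN, hbN⟩ := exists_mem_quad hΓ y hy hb
  rcases y.eq_one_of_one_add_sq hp hN.cast_ne_zero hN.odd hc0 hbN (hc ▸ hb2.symm) with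
    rfl | ⟨rfl, i, rfl⟩
  · rw [(powers v).e_zero, mul_one] at hc
    rw [hc]
    exact c.2
  · refine absurd ⟨v, i, ?_⟩ hne
    rw [hc, map_one, one_mul, var, ← mon_nsmul]
    simp [powers]

/-- Homomorphisms between the subfields send variables to powers of variables with exponent a power
of the characteristic exponent. -/
theorem exists_map_var_eq [IsAlgClosed κ] (hp : p ≠ 2) (hκ : IsConstantField κ p)
    {W : Type} {Γ : AddSubgroup (V →₀ ℚ)} {Γ' : AddSubgroup (W →₀ ℚ)} [Nonempty W]
    (hΓ' : LargeDenominators p Γ') (φ : subfield κ Γ →+* subfield κ Γ') (v : V)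
    (hv : ∀ k : ℕ, ∃ n > k, Finsupp.single v (1 / n : ℚ) ∈ Γ) (hΓ : Finsupp.single v 1 ∈ Γ) :
    ∃ (w : W) (i : ℕ), (φ ⟨var v, mon_mem hΓ⟩ : BigField κ W) = var w ^ p ^ i := by
  set a := φ ⟨var v, mon_mem hΓ⟩ with ha
  have ha0 : (a : BigField κ W) ≠ 0 := by
    have h1 : (⟨var v, mon_mem hΓ⟩ : subfield κ Γ) ≠ 0 :=
      fun h => mon_ne_zero _ (congrArg Subtype.val h)
    intro h2
    exact h1 ((map_eq_zero φ).1 (Subtype.ext h2))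
  refine (eq_var_pow_of_roots hp hΓ' ha0 (fun k => ?_) ?_).resolve_left ?_
  · obtain ⟨n, hn, h⟩ := hv k
    refine ⟨n, hn.le, φ ⟨_, mon_mem h⟩, Subtype.property _, ?_⟩
    have h1 : (⟨mon (Finsupp.single v (1 / n : ℚ)), mon_mem h⟩ : subfield κ Γ) ^ n =
        ⟨var v, mon_mem hΓ⟩ := by
      refine Subtype.ext ?_
      show mon _ ^ n = var v
      have hn0 : (n : ℚ) ≠ 0 := Nat.cast_ne_zero.2 (by omega)
      rw [← mon_nsmul, Finsupp.smul_single, nsmul_eq_mul, mul_one_div_cancel hn0, var]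
    rw [ha, ← h1, map_pow]
    rfl
  · refine ⟨φ ⟨sqrtVar v, sqrtVar_mem v⟩, Subtype.property _, ?_⟩
    have h1 : (⟨sqrtVar v, sqrtVar_mem v⟩ : subfield κ Γ) ^ 2 = 1 + ⟨var v, mon_mem hΓ⟩ :=
      Subtype.ext (sqrtVar_sq v)
    have h2 := congrArg φ h1
    rw [map_pow, map_add, map_one] at h2
    exact congrArg Subtype.val h2
  · -- the image of a variable is not constant, as constants are algebraic over the prime field
    rintro ⟨c, hc⟩
    obtain ⟨q, hq, hqc⟩ := hκ.algebraic c
    have h1 : Polynomial.aeval (a : BigField κ W) q = 0 := by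
      rw [← hc, Polynomial.aeval_algebraMap_apply, hqc, map_zero]
    have h2 : Polynomial.aeval a q = 0 := by
      refine Subtype.ext ?_
      exact (Polynomial.aeval_algHom_apply (subfield κ Γ').subtype.toIntAlgHom a q).symm.trans h1
    have h3 : Polynomial.aeval (⟨var v, mon_mem hΓ⟩ : subfield κ Γ) q = 0 := by
      refine (map_eq_zero φ).1 ?_
      rw [← h2, ha]
      exact (Polynomial.aeval_algHom_apply φ.toIntAlgHom _ q).symm
    have h4 : Polynomial.aeval (var v : BigField κ V) q = 0 := by
      have := Polynomial.aeval_algHom_apply (subfield κ Γ).subtype.toIntAlgHom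
        (⟨var v, mon_mem hΓ⟩ : subfield κ Γ) q
      rw [h3, map_zero] at this
      exact this
    have h5 : Polynomial.aeval (var v : BigField κ V) (q.map (Int.castRingHom κ)) = 0 := by
      rw [← h4, Polynomial.aeval_def, Polynomial.eval₂_map, Polynomial.aeval_def]
      congr 1
      exact RingHom.ext_int _ _
    exact hq ((transcendental_iff_injective.1 (algebraicIndependent_var.transcendental v))
      (h5.trans (map_zero _).symm))

end BigField

namespace BigField

open Filter

variable {κ V : Type} [Field κ]

/-! ### Changing the signs of the square roots -/

/-- For a finite set `S` of vertices there is an endomorphism that fixes the monomials and changes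
the sign of `√(1 + x_v)` exactly for `v ∈ S`. -/
theorem exists_signs_finset {p : ℕ} [ExpChar κ p] (hp : p ≠ 2) [DecidableEq V] (S : Finset V) :
    ∃ Θ : BigField κ V →+* BigField κ V, (∀ γ, Θ (mon γ) = mon γ) ∧
      ∀ v, Θ (sqrtVar v) = if v ∈ S then -sqrtVar v else sqrtVar v := by
  induction S using Finset.induction with
  | empty => exact ⟨RingHom.id _, fun _ => rfl, fun v => by simp⟩
  | insert w S hw ih =>
    obtain ⟨Θ, h1, h2⟩ := ih
    obtain ⟨y, hy⟩ := exists_conj_sqrtVar (κ := κ) p hp w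
    have hfix : ∀ a ∈ baseField (κ := κ) w, y.σ a = a := fun a ha => y.σ.commutes ⟨a, ha⟩
    refine ⟨Θ.comp (y.σ : BigField κ V →+* BigField κ V), fun γ => ?_, fun v => ?_⟩
    · have h3 : mon (κ := κ) γ = mon (γ.erase w) * mon (Finsupp.single w (γ w)) := by
        rw [← mon_add, Finsupp.erase_add_single]
      have h4 : y.σ (mon γ) = mon γ := by
        rw [h3, map_mul, hfix _ (mon_mem_baseField (γ := γ.erase w) (by simp))]
        congr 1
        exact y.σ_e (γ w)
      rw [RingHom.comp_apply]
      exact (congrArg Θ h4).trans (h1 γ)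
    · rw [RingHom.comp_apply]
      by_cases hv : v = w
      · subst hv
        have h3 : y.σ (sqrtVar v) = -sqrtVar v := by rw [← hy, y.σ_s]
        rw [if_pos (Finset.mem_insert_self _ _)]
        refine (congrArg Θ h3).trans ?_
        rw [map_neg, h2, if_neg hw]
      · refine (congrArg Θ (hfix _ (sqrtVar_mem_baseField hv))).trans ?_
        rw [h2]
        simp [Finset.mem_insert, hv]

/-- The signs of the square roots can be changed independently by homomorphisms that fix the
monomials. They are obtained as the limits of the homomorphisms that change finitely many signs. -/
theorem exists_signs {p : ℕ} [ExpChar κ p] (hp : p ≠ 2) (Γ : AddSubgroup (V →₀ ℚ)) (S : Set V) :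
    ∃ θ : subfield κ Γ →+* subfield κ Γ, (∀ γ (h : γ ∈ Γ), (θ ⟨mon γ, mon_mem h⟩ : BigField κ V) =
      mon γ) ∧ (∀ v ∈ S, (θ ⟨sqrtVar v, sqrtVar_mem v⟩ : BigField κ V) = -sqrtVar v) ∧
      ∀ v ∉ S, (θ ⟨sqrtVar v, sqrtVar_mem v⟩ : BigField κ V) = sqrtVar v := by
  classical
  choose Θ hmon hsqrt using fun W : Finset V =>
    exists_signs_finset (κ := κ) hp (W.filter (· ∈ S))
  have hmon' : ∀ γ, ∀ᶠ W in atTop, Θ W (mon γ) = mon γ := fun γ => .of_forall fun W => hmon W γ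
  have hsqrt' : ∀ v, ∀ᶠ W in atTop, Θ W (sqrtVar v) = if v ∈ S then -sqrtVar v else sqrtVar v := by
    intro v
    filter_upwards [eventually_ge_atTop {v}] with W hW
    have : v ∈ W := hW (Finset.mem_singleton_self v)
    rw [hsqrt]
    simp [this]
  have key : ∀ a ∈ subfield κ Γ, ∃ b ∈ subfield κ Γ, ∀ᶠ W in atTop, Θ W a = b := by
    intro a ha
    induction ha using Subfield.closure_induction with
    | mem a h =>
      rcases h with ⟨γ, hγ, rfl⟩ | ⟨v, rfl⟩
      · exact ⟨_, mon_mem hγ, hmon' γ⟩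
      · refine ⟨_, ?_, hsqrt' v⟩
        split_ifs
        · exact neg_mem (sqrtVar_mem v)
        · exact sqrtVar_mem v
    | one => exact ⟨1, one_mem _, .of_forall fun W => map_one _⟩
    | add a b _ _ iha ihb =>
      obtain ⟨a', ha', iha⟩ := iha
      obtain ⟨b', hb', ihb⟩ := ihb
      refine ⟨_, add_mem ha' hb', ?_⟩
      filter_upwards [iha, ihb] with W h1 h2
      rw [map_add, h1, h2]
    | neg a _ iha =>
      obtain ⟨a', ha', iha⟩ := iha
      refine ⟨_, neg_mem ha', ?_⟩
      filter_upwards [iha] with W h1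
      rw [map_neg, h1]
    | inv a _ iha =>
      obtain ⟨a', ha', iha⟩ := iha
      refine ⟨_, inv_mem ha', ?_⟩
      filter_upwards [iha] with W h1
      rw [map_inv₀, h1]
    | mul a b _ _ iha ihb =>
      obtain ⟨a', ha', iha⟩ := iha
      obtain ⟨b', hb', ihb⟩ := ihb
      refine ⟨_, mul_mem ha' hb', ?_⟩
      filter_upwards [iha, ihb] with W h1 h2
      rw [map_mul, h1, h2]
  choose! g hg hgΘ using key
  have huniq : ∀ {a : BigField κ V}, a ∈ subfield κ Γ → ∀ {b}, (∀ᶠ W in atTop, Θ W a = b) →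
      g a = b := by
    intro a ha b hb
    obtain ⟨W, h1, h2⟩ := ((hgΘ a ha).and hb).exists
    rw [← h1, h2]
  let θ : subfield κ Γ → subfield κ Γ := fun a => ⟨g a, hg a a.2⟩
  refine ⟨⟨⟨⟨θ, ?_⟩, ?_⟩, ?_, ?_⟩, fun γ h => huniq (mon_mem h) (hmon' γ), fun v hv => ?_,
    fun v hv => ?_⟩
  · exact Subtype.ext (huniq (one_mem _) (.of_forall fun W => map_one _))
  · intro a b
    refine Subtype.ext (huniq (mul_mem a.2 b.2) ?_)
    filter_upwards [hgΘ a a.2, hgΘ b b.2] with W h1 h2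
    rw [map_mul, h1, h2]
    rfl
  · exact Subtype.ext (huniq (zero_mem _) (.of_forall fun W => map_zero _))
  · intro a b
    refine Subtype.ext (huniq (add_mem a.2 b.2) ?_)
    filter_upwards [hgΘ a a.2, hgΘ b b.2] with W h1 h2
    rw [map_add, h1, h2]
    rfl
  · have := huniq (sqrtVar_mem (Γ := Γ) v) (hsqrt' v)
    rwa [if_pos hv] at this
  · have := huniq (sqrtVar_mem (Γ := Γ) v) (hsqrt' v)
    rwa [if_neg hv] at this

/-- The homomorphisms changing signs are automorphisms. -/
theorem exists_signs_equiv {p : ℕ} [ExpChar κ p] (hp : p ≠ 2) (Γ : AddSubgroup (V →₀ ℚ))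
    (S : Set V) : ∃ θ : subfield κ Γ ≃+* subfield κ Γ,
      (∀ v ∈ S, (θ ⟨sqrtVar v, sqrtVar_mem v⟩ : BigField κ V) = -sqrtVar v) ∧
      ∀ v ∉ S, (θ ⟨sqrtVar v, sqrtVar_mem v⟩ : BigField κ V) = sqrtVar v := by
  obtain ⟨θ, h1, h2, h3⟩ := exists_signs (κ := κ) hp Γ S
  have h1' : ∀ γ (h : γ ∈ Γ), θ ⟨mon γ, mon_mem h⟩ = ⟨mon γ, mon_mem h⟩ :=
    fun γ h => Subtype.ext (h1 γ h)
  have h4 : θ.comp θ = RingHom.id _ := by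
    refine ringHom_ext_of_generators (fun γ h => ?_) fun v => ?_
    · rw [RingHom.comp_apply, h1' γ h, h1' γ h, RingHom.id_apply]
    · rw [RingHom.comp_apply, RingHom.id_apply]
      by_cases hv : v ∈ S
      · have h5 : θ ⟨sqrtVar v, sqrtVar_mem v⟩ = -⟨sqrtVar v, sqrtVar_mem v⟩ :=
          Subtype.ext (h2 v hv)
        rw [h5, map_neg, h5, neg_neg]
      · have h5 : θ ⟨sqrtVar v, sqrtVar_mem v⟩ = ⟨sqrtVar v, sqrtVar_mem v⟩ :=
          Subtype.ext (h3 v hv)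
        rw [h5, h5]
  exact ⟨RingEquiv.ofRingHom θ θ h4 h4, h2, h3⟩

/-- An injection of variables that maps exponents to exponents induces a homomorphism. -/
theorem nonempty_ringHom_of_mapDomain {W : Type} {Γ : AddSubgroup (V →₀ ℚ)}
    {Γ' : AddSubgroup (W →₀ ℚ)} {f : V → W} (hf : Function.Injective f)
    (h : ∀ γ ∈ Γ, Finsupp.mapDomain f γ ∈ Γ') : Nonempty (subfield κ Γ →+* subfield κ Γ') := by
  obtain ⟨Θ, -, hΘ⟩ := exists_substitution (RingHom.id κ) 1
    (Finsupp.mapDomain.addMonoidHom f : (V →₀ ℚ) →+ (W →₀ ℚ)) (Finsupp.mapDomain_injective hf)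
  have hmon : ∀ γ, Θ (mon γ) = mon (Finsupp.mapDomain f γ) := fun γ => by
    rw [hΘ, MonoidHom.one_apply, Units.val_one, map_one, one_mul]
    rfl
  refine ⟨(Θ.comp (subfield κ Γ).subtype).codRestrict (subfield κ Γ') fun a => ?_⟩
  refine map_mem_of_generators Θ (fun γ hγ => ?_) (fun v => ?_) a.2
  · rw [hmon]
    exact mon_mem (h γ hγ)
  · have h1 : Θ (var v) = var (f v) := by rw [var, hmon, Finsupp.mapDomain_single, var]
    rcases map_sqrtVar h1 with h2 | h2
    · rw [h2]; exact sqrtVar_mem _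
    · rw [h2]; exact neg_mem (sqrtVar_mem _)

end BigField

/-! ### Groups of exponents that code labelled forests -/

/-- An injective enumeration of primes larger than `p + 4`. -/
noncomputable def largePrime (p n : ℕ) : ℕ := Nat.nth Nat.Prime (n + p + 5)

theorem prime_largePrime (p n : ℕ) : (largePrime p n).Prime := Nat.prime_nth_prime _

theorem lt_largePrime (p n : ℕ) : p + 4 < largePrime p n := by
  have := Nat.add_two_le_nth_prime (n + p + 5)
  rw [largePrime]
  omega

theorem largePrime_injective (p : ℕ) : Function.Injective (largePrime p) := fun a b h => by
  have := Nat.nth_injective Nat.infinite_setOfPred_prime h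
  omega

theorem largePrime_not_dvd {p n m : ℕ} (h : n ≠ m) : ¬ largePrime p n ∣ largePrime p m := by
  rw [Nat.prime_dvd_prime_iff_eq (prime_largePrime p n) (prime_largePrime p m)]
  exact fun h' => h (largePrime_injective p h')

theorem largePrime_not_dvd_pow {p : ℕ} (hp0 : p ≠ 0) (n i : ℕ) : ¬ largePrime p n ∣ p ^ i := by
  intro h
  have h1 := (prime_largePrime p n).dvd_of_dvd_pow h
  have h2 := lt_largePrime p n
  have := Nat.le_of_dvd (Nat.pos_of_ne_zero hp0) h1
  omega

/-- The rational numbers whose denominator is not divisible by the prime `r`. -/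
def integralAt (r : ℕ) (hr : r.Prime) : AddSubgroup ℚ where
  carrier := {x | ¬ r ∣ x.den}
  zero_mem' := hr.not_dvd_one
  add_mem' {a b} ha hb h := (hr.dvd_mul.1 (h.trans (Rat.add_den_dvd a b))).elim ha hb
  neg_mem' {a} ha := by
    show ¬ r ∣ (-a).den
    rwa [Rat.neg_den]

theorem den_inv_natCast {n : ℕ} (h : n ≠ 0) : ((n : ℚ)⁻¹).den = n :=
  Rat.inv_natCast_den_of_pos (Nat.pos_of_ne_zero h)

theorem inv_mem_integralAt {r : ℕ} (hr : r.Prime) {n : ℕ} (h : n ≠ 0) (hd : ¬ r ∣ n) :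
    (n : ℚ)⁻¹ ∈ integralAt r hr := by
  show ¬ r ∣ ((n : ℚ)⁻¹).den
  rwa [den_inv_natCast h]

theorem mul_inv_notMem_integralAt {r : ℕ} (hr : r.Prime) {m : ℕ} (hd : ¬ r ∣ m) :
    (m : ℚ) * (r : ℚ)⁻¹ ∉ integralAt r hr := by
  have h1 : (m : ℚ) * (r : ℚ)⁻¹ = (m : ℚ) / (r : ℕ) := (div_eq_mul_inv _ _).symm
  have h2 : ((m : ℚ) / (r : ℚ)).den = r := by
    have := Rat.den_div_eq_of_coprime (a := m) (b := r) (by exact_mod_cast hr.pos)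
      (by simpa using ((Nat.Prime.coprime_iff_not_dvd hr).2 hd).symm)
    rw [Int.cast_natCast, Int.cast_natCast] at this
    exact Int.ofNat_injective this
  intro h
  have h3 : ¬ r ∣ ((m : ℚ) * (r : ℚ)⁻¹).den := h
  rw [h1, h2] at h3
  exact h3 dvd_rfl

/-- A forest on the set `V`: the parent and the level of a vertex; the vertices of level zero are
the roots, and their parents are irrelevant. -/
structure Forest (V : Type) where
  /-- the parent of a vertex -/
  par : V → V
  /-- the level of a vertex -/
  lev : V → ℕ
  lev_par : ∀ v, lev v ≠ 0 → lev (par v) + 1 = lev v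

namespace Forest

open BigField Finsupp

variable {V : Type} (F : Forest V) (p : ℕ) (Λ : V → Set ℕ)

/-- The generators of the group of exponents attached to a forest with labels: the variables are
infinitely divisible by a prime, the labels of a vertex are recorded by primes dividing its
variable, and the edges by primes, depending on the level, dividing the product of the variables of
the two vertices. -/
inductive IsExponent : (V →₀ ℚ) → Prop
  | vertex (v : V) (n : ℕ) : IsExponent (single v ((largePrime p 0 ^ n : ℕ) : ℚ)⁻¹)
  | label (v : V) (i : ℕ) (h : i ∈ Λ v) : IsExponent (single v (largePrime p (2 * i + 1) : ℚ)⁻¹)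
  | edge (v : V) (h : F.lev v ≠ 0) : IsExponent
      (single v (largePrime p (2 * F.lev v + 2) : ℚ)⁻¹ +
        single (F.par v) (largePrime p (2 * F.lev v + 2) : ℚ)⁻¹)

/-- The group of exponents attached to a forest with labels. -/
noncomputable def exponents : AddSubgroup (V →₀ ℚ) := AddSubgroup.closure {γ | F.IsExponent p Λ γ}

variable {F p Λ}

theorem exponents_le {H : AddSubgroup (V →₀ ℚ)} (h : ∀ γ, F.IsExponent p Λ γ → γ ∈ H) {γ}
    (hγ : γ ∈ F.exponents p Λ) : γ ∈ H :=
  (AddSubgroup.closure_le H).2 h hγ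

theorem single_inv_mem (v : V) (n : ℕ) :
    single v ((largePrime p 0 ^ n : ℕ) : ℚ)⁻¹ ∈ F.exponents p Λ :=
  AddSubgroup.subset_closure (.vertex v n)

theorem single_one_mem (v : V) : single v 1 ∈ F.exponents p Λ := by
  have := F.single_inv_mem (p := p) (Λ := Λ) v 0
  simpa using this

theorem exists_single_mem (v : V) (k : ℕ) : ∃ n > k, single v (1 / n : ℚ) ∈ F.exponents p Λ := by
  refine ⟨largePrime p 0 ^ k, Nat.lt_pow_self (prime_largePrime p 0).one_lt, ?_⟩
  rw [one_div]
  exact single_inv_mem v k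

theorem largeFactors_largePrime (n : ℕ) : LargeFactors p (largePrime p n) :=
  .of_prime (prime_largePrime p n) (lt_largePrime p n)

theorem largeDenominators : LargeDenominators p (F.exponents p Λ) := by
  classical
  intro γ hγ w
  have hs : ∀ (v : V) (n : ℕ), LargeFactors p n →
      LargeFactors p ((single v (n : ℚ)⁻¹ : V →₀ ℚ) w).den := by
    intro v n hn
    rw [single_apply]
    split_ifs
    · rwa [den_inv_natCast hn.1]
    · exact .one p
  have ha : ∀ a b : ℚ, LargeFactors p a.den → LargeFactors p b.den → LargeFactors p (a + b).den :=
    fun a b h1 h2 => (h1.mul h2).of_dvd (Rat.add_den_dvd a b)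
  induction hγ using AddSubgroup.closure_induction with
  | mem γ h =>
    cases h with
    | vertex v n => exact hs v _ ((largeFactors_largePrime 0).pow n)
    | label v i h => exact hs v _ (largeFactors_largePrime _)
    | edge v h =>
      exact ha _ _ (hs v _ (largeFactors_largePrime _)) (hs _ _ (largeFactors_largePrime _))
  | zero => exact .one p
  | add a b _ _ h1 h2 => exact ha _ _ h1 h2
  | neg a _ h => rwa [Finsupp.neg_apply, Rat.neg_den]

/-- The labels of a vertex can be read off the exponents. -/
theorem mem_label_of_mem {w : V} {i m : ℕ} (hm : ¬ largePrime p (2 * i + 1) ∣ m)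
    (h : single w ((m : ℚ) * (largePrime p (2 * i + 1) : ℚ)⁻¹) ∈ F.exponents p Λ) : i ∈ Λ w := by
  classical
  by_contra hi
  set r := largePrime p (2 * i + 1) with hr
  have hrp : r.Prime := prime_largePrime p _
  -- the coordinate of `w` is integral at `r`
  have hs : ∀ (v : V) (n : ℕ), n ≠ 0 → (v = w → ¬ r ∣ n) →
      (single v (n : ℚ)⁻¹ : V →₀ ℚ) w ∈ integralAt r hrp := by
    intro v n hn hd
    rw [single_apply]
    split_ifs with hv
    · exact inv_mem_integralAt hrp hn (hd hv)
    · exact zero_mem _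
  have h1 := exponents_le (H := (integralAt r hrp).comap (applyAddHom w)) (fun γ hγ => by
    cases hγ with
    | vertex v n =>
      exact hs v _ (pow_ne_zero _ (prime_largePrime p 0).ne_zero) fun _ hd =>
        largePrime_not_dvd (by omega) (hrp.dvd_of_dvd_pow hd)
    | label v j hj =>
      refine hs v _ (prime_largePrime p _).ne_zero fun hv => largePrime_not_dvd fun hij => hi ?_
      have : i = j := by omega
      rwa [← hv, this]
    | edge v _ =>
      exact add_mem (hs v _ (prime_largePrime p _).ne_zero fun _ => largePrime_not_dvd (by omega))
        (hs _ _ (prime_largePrime p _).ne_zero fun _ => largePrime_not_dvd (by omega))) h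
  have h2 : (single w ((m : ℚ) * (r : ℚ)⁻¹) : V →₀ ℚ) w ∈ integralAt r hrp := h1
  rw [single_eq_same] at h2
  exact mul_inv_notMem_integralAt hrp hm h2

/-- The parent of a vertex can be read off the exponents. -/
theorem par_eq_of_mem {a b : V} (hab : F.lev b + 1 = F.lev a) {m n : ℕ}
    (hn : ¬ largePrime p (2 * F.lev a + 2) ∣ n)
    (h : single a ((m : ℚ) * (largePrime p (2 * F.lev a + 2) : ℚ)⁻¹) +
      single b ((n : ℚ) * (largePrime p (2 * F.lev a + 2) : ℚ)⁻¹) ∈ F.exponents p Λ) :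
    F.par a = b := by
  classical
  by_contra hpar
  set r := largePrime p (2 * F.lev a + 2) with hr
  have hrp : r.Prime := prime_largePrime p _
  -- the sum of the coordinates of the children of `b` minus the coordinate of `b` is integral
  let χ : (V →₀ ℚ) →+ ℚ := liftAddHom fun s =>
    if s = b then -AddMonoidHom.id ℚ else if F.par s = b ∧ F.lev s ≠ 0 then AddMonoidHom.id ℚ else 0
  have hχ : ∀ s x, χ (single s x) =
      if s = b then -x else if F.par s = b ∧ F.lev s ≠ 0 then x else 0 := by
    intro s x
    rw [liftAddHom_apply_single]
    split_ifs <;> rfl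
  have hs : ∀ (v : V) (n : ℕ), n ≠ 0 → ¬ r ∣ n → χ (single v (n : ℚ)⁻¹) ∈ integralAt r hrp := by
    intro v n hn hd
    have := inv_mem_integralAt hrp hn hd
    rw [hχ]
    split_ifs
    · exact neg_mem this
    · exact this
    · exact zero_mem _
  have h1 := exponents_le (H := (integralAt r hrp).comap χ) (fun γ hγ => by
    cases hγ with
    | vertex v n =>
      exact hs v _ (pow_ne_zero _ (prime_largePrime p 0).ne_zero) fun hd =>
        largePrime_not_dvd (by omega) (hrp.dvd_of_dvd_pow hd)
    | label v j hj => exact hs v _ (prime_largePrime p _).ne_zero (largePrime_not_dvd (by omega))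
    | edge v hv =>
      rw [AddSubgroup.mem_comap, map_add]
      by_cases hl : F.lev v = F.lev a
      · have hvb : v ≠ b := by
          rintro rfl
          omega
        have hpv := F.lev_par v hv
        by_cases hvp : F.par v = b
        · rw [hχ, hχ, if_neg hvb, if_pos ⟨hvp, hv⟩, if_pos hvp, add_neg_cancel]
          exact zero_mem _
        · have hpp : ¬ (F.par (F.par v) = b ∧ F.lev (F.par v) ≠ 0) := by
            rintro ⟨h2, h3⟩
            have := F.lev_par _ h3
            rw [h2] at this
            omega
          rw [hχ, hχ, if_neg hvb, if_neg (fun h => hvp h.1), if_neg hvp, if_neg hpp, add_zero]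
          exact zero_mem _
      · exact add_mem (hs v _ (prime_largePrime p _).ne_zero (largePrime_not_dvd (by omega)))
          (hs _ _ (prime_largePrime p _).ne_zero (largePrime_not_dvd (by omega)))) h
  have hab' : a ≠ b := by
    rintro rfl
    omega
  rw [AddSubgroup.mem_comap, map_add, hχ, hχ, if_neg hab', if_neg (fun h => hpar h.1), if_pos rfl,
    zero_add, neg_mem_iff] at h1
  exact mul_inv_notMem_integralAt hrp hn h1

/-! ### Homomorphisms between the fields attached to labelled forests -/

/-- The field attached to a forest with labels. -/
noncomputable abbrev field (κ : Type) [Field κ] (F : Forest V) (p : ℕ) (Λ : V → Set ℕ) :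
    Subfield (BigField κ V) :=
  subfield κ (F.exponents p Λ)

variable {κ : Type} [Field κ]

theorem mon_injective : Function.Injective (mon : (V →₀ ℚ) → BigField κ V) := by
  intro γ δ h
  have h1 := congrArg AddMonoidAlgebra.coeff (algebraMap_injective' h)
  rw [AddMonoidAlgebra.coeff_single, AddMonoidAlgebra.coeff_single] at h1
  exact Finsupp.single_left_injective one_ne_zero h1

/-- A map of vertices that preserves levels, parents, and labels. -/
structure IsEmbedding (F : Forest V) (Λ Λ' : V → Set ℕ) (f : V → V) : Prop where
  injective : Function.Injective f
  lev : ∀ v, F.lev (f v) = F.lev v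
  par : ∀ v, F.lev v ≠ 0 → F.par (f v) = f (F.par v)
  label : ∀ v, Λ v ⊆ Λ' (f v)

/-- Embeddings of labelled forests induce homomorphisms of the fields. -/
theorem nonempty_ringHom {Λ Λ' : V → Set ℕ} {f : V → V} (hf : F.IsEmbedding Λ Λ' f) :
    Nonempty (F.field κ p Λ →+* F.field κ p Λ') := by
  refine nonempty_ringHom_of_mapDomain hf.injective fun γ hγ => ?_
  refine exponents_le (H := (F.exponents p Λ').comap (mapDomain.addMonoidHom f)) (fun γ hγ => ?_) hγ
  show mapDomain f γ ∈ F.exponents p Λ'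
  refine AddSubgroup.subset_closure ?_
  cases hγ with
  | vertex v n =>
    rw [mapDomain_single]
    exact .vertex _ n
  | label v i h =>
    rw [mapDomain_single]
    exact .label _ i (hf.label v h)
  | edge v h =>
    rw [mapDomain_add, mapDomain_single, mapDomain_single, ← hf.lev v, ← hf.par v h]
    exact .edge (f v) (by rwa [hf.lev])

/-- The variables in the field attached to a forest with labels. -/
noncomputable def x (κ : Type) [Field κ] (F : Forest V) (p : ℕ) (Λ : V → Set ℕ) (v : V) :
    F.field κ p Λ :=
  ⟨var v, mon_mem (single_one_mem v)⟩

/-- The square roots in the field attached to a forest with labels. -/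
noncomputable def s (κ : Type) [Field κ] (F : Forest V) (p : ℕ) (Λ : V → Set ℕ) (v : V) :
    F.field κ p Λ :=
  ⟨sqrtVar v, sqrtVar_mem v⟩

variable [IsAlgClosed κ] [ExpChar κ p] [Nonempty V]

theorem exists_map_x (hp : p ≠ 2) (hκ : IsConstantField κ p) {Λ Λ' : V → Set ℕ}
    (φ : F.field κ p Λ →+* F.field κ p Λ') (v : V) :
    ∃ (w : V) (i : ℕ), φ (F.x κ p Λ v) = F.x κ p Λ' w ^ p ^ i := by
  obtain ⟨w, i, h⟩ := exists_map_var_eq hp hκ largeDenominators φ v (exists_single_mem v)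
    (single_one_mem v)
  exact ⟨w, i, Subtype.ext h⟩

omit [IsAlgClosed κ] [ExpChar κ p] [Nonempty V] in
theorem x_pow (Λ : V → Set ℕ) (v : V) (n : ℕ) :
    ((F.x κ p Λ v ^ n : F.field κ p Λ) : BigField κ V) = mon (single v (n : ℚ)) := by
  show var v ^ n = _
  rw [var, ← mon_nsmul]
  simp

omit [Nonempty V] in
/-- If the image of a monomial is a root, of one of the large primes as order, of a monomial with
exponent in the target group, then the exponent of the root belongs to the target group. -/
theorem mem_exponents_of_root {Λ Λ' : V → Set ℕ} {φ : F.field κ p Λ →+* F.field κ p Λ'} {n : ℕ}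
    {γ δ : V →₀ ℚ} (hγ : γ ∈ F.exponents p Λ) (hδ : largePrime p n • δ ∈ F.exponents p Λ')
    (h : (φ ⟨mon γ, mon_mem hγ⟩ : BigField κ V) ^ largePrime p n = mon (largePrime p n • δ)) :
    δ ∈ F.exponents p Λ' := by
  have hl := lt_largePrime p n
  exact mem_of_pow_eq_mon (κ := κ) single_one_mem (Subtype.property _) (prime_largePrime p n)
    (by omega) (largeFactors_largePrime n).cast_ne_zero hδ h

/-- Homomorphisms of the fields come from injective maps of vertices that preserve labels, and, if
they preserve levels, also edges. -/
theorem exists_map (hp : p ≠ 2) (hκ : IsConstantField κ p) {Λ Λ' : V → Set ℕ}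
    (φ : F.field κ p Λ →+* F.field κ p Λ') :
    ∃ (f : V → V) (j : V → ℕ), (∀ v, φ (F.x κ p Λ v) = F.x κ p Λ' (f v) ^ p ^ j v) ∧
      Function.Injective f ∧ (∀ v, Λ v ⊆ Λ' (f v)) ∧
      ((∀ v, F.lev (f v) = F.lev v) → ∀ v, F.lev v ≠ 0 → F.par (f v) = f (F.par v)) := by
  choose f j hf using exists_map_x hp hκ φ
  have hp0 : p ≠ 0 := expChar_ne_zero κ p
  have hnsmul : ∀ (r : ℕ) (v : V) (m : ℕ), r ≠ 0 →
      r • (single v ((m : ℚ) * (r : ℚ)⁻¹) : V →₀ ℚ) = single v (m : ℚ) := by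
    intro r v m hr
    have : (r : ℚ) ≠ 0 := Nat.cast_ne_zero.2 hr
    rw [smul_single, nsmul_eq_mul]
    congr 1
    field_simp
  have hint : ∀ (v : V) (m : ℕ), single v (m : ℚ) ∈ F.exponents p Λ' := by
    intro v m
    have := nsmul_mem (F.single_one_mem (p := p) (Λ := Λ') v) m
    simpa using this
  have hφ : ∀ v, (φ ⟨mon (single v 1), mon_mem (single_one_mem v)⟩ : BigField κ V) =
      mon (single (f v) ((p ^ j v : ℕ) : ℚ)) := fun v =>
    (congrArg Subtype.val (hf v)).trans (x_pow Λ' (f v) _)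
  have hφpow : ∀ (γ : V →₀ ℚ) (hγ : γ ∈ F.exponents p Λ) (r : ℕ) (δ : V →₀ ℚ)
      (hδ : δ ∈ F.exponents p Λ), r • γ = δ →
      (φ ⟨mon γ, mon_mem hγ⟩ : BigField κ V) ^ r = φ ⟨mon δ, mon_mem hδ⟩ := by
    rintro γ hγ r δ hδ rfl
    rw [← SubmonoidClass.coe_pow, ← map_pow]
    congr 2
    exact Subtype.ext (mon_nsmul r γ).symm
  have hcancel : ∀ (r : ℕ) (v : V), r ≠ 0 → r • (single v (r : ℚ)⁻¹ : V →₀ ℚ) = single v 1 := by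
    intro r v hr
    have := hnsmul r v 1 hr
    simpa using this
  refine ⟨f, j, hf, fun v w hvw => ?_, fun v i hi => ?_, fun hlev v hv => ?_⟩
  · have h1 : F.x κ p Λ v ^ p ^ j w = F.x κ p Λ w ^ p ^ j v := by
      apply φ.injective
      rw [map_pow, map_pow, hf, hf, hvw, ← pow_mul, ← pow_mul, mul_comm]
    have h2 := congrArg Subtype.val h1
    rw [x_pow, x_pow] at h2
    have h3 := mon_injective h2
    rcases single_eq_single_iff _ _ _ _ |>.1 h3 with h4 | h4
    · exact h4.1
    · exact absurd h4.1 (by exact_mod_cast pow_ne_zero _ hp0)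
  · have hr := prime_largePrime p (2 * i + 1)
    refine mem_label_of_mem (largePrime_not_dvd_pow hp0 _ (j v))
      (mem_exponents_of_root (φ := φ) (n := 2 * i + 1)
        (AddSubgroup.subset_closure (IsExponent.label v i hi)) ?_ ?_)
    · rw [hnsmul _ _ _ hr.ne_zero]
      exact hint _ _
    · rw [hnsmul _ _ _ hr.ne_zero, hφpow _ _ _ _ (single_one_mem v) (hcancel _ _ hr.ne_zero), hφ]
      exact AddSubgroup.subset_closure (IsExponent.label v i hi)
  · have hr := prime_largePrime p (2 * F.lev v + 2)
    have hpar := F.lev_par v hv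
    have h1 : single v 1 + single (F.par v) 1 ∈ F.exponents p Λ :=
      add_mem (single_one_mem v) (single_one_mem _)
    refine par_eq_of_mem (m := p ^ j v) (by rw [hlev, hlev, hpar])
      (largePrime_not_dvd_pow hp0 _ (j (F.par v)))
      (mem_exponents_of_root (φ := φ) (n := 2 * F.lev v + 2)
        (AddSubgroup.subset_closure (IsExponent.edge v hv)) ?_ ?_)
    · rw [hlev, smul_add, hnsmul _ _ _ hr.ne_zero, hnsmul _ _ _ hr.ne_zero]
      exact add_mem (hint _ _) (hint _ _)
    · rw [hlev, smul_add, hnsmul _ _ _ hr.ne_zero, hnsmul _ _ _ hr.ne_zero,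
        hφpow _ _ _ _ h1 (by rw [smul_add, hcancel _ _ hr.ne_zero, hcancel _ _ hr.ne_zero])]
      have h2 : (⟨mon (single v 1 + single (F.par v) 1), mon_mem h1⟩ : F.field κ p Λ) =
          F.x κ p Λ v * F.x κ p Λ (F.par v) := Subtype.ext (mon_add _ _)
      exact (congrArg (fun a => (φ a : BigField κ V)) h2).trans
        ((congrArg Subtype.val (map_mul φ _ _)).trans
          ((congrArg₂ (· * ·) (hφ v) (hφ _)).trans (mon_add _ _).symm))
      exact AddSubgroup.subset_closure (IsExponent.edge v hv)

/-- Embeddability of the fields is embeddability of the labelled forests, provided the labels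
determine the levels. -/
theorem nonempty_ringHom_iff (hp : p ≠ 2) (hκ : IsConstantField κ p) {Λ Λ' : V → Set ℕ}
    (hlev : ∀ v w, Λ v ⊆ Λ' w → F.lev w = F.lev v) :
    Nonempty (F.field κ p Λ →+* F.field κ p Λ') ↔ ∃ f, F.IsEmbedding Λ Λ' f := by
  refine ⟨fun ⟨φ⟩ => ?_, fun ⟨f, hf⟩ => nonempty_ringHom hf⟩
  obtain ⟨f, j, -, h1, h2, h3⟩ := exists_map hp hκ φ
  have h4 : ∀ v, F.lev (f v) = F.lev v := fun v => hlev _ _ (h2 v)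
  exact ⟨f, h1, h4, h3 h4, h2⟩

/-- Isomorphisms of the fields come from isomorphisms of the labelled forests. -/
theorem exists_map_of_equiv (hp : p ≠ 2) (hκ : IsConstantField κ p) {Λ Λ' : V → Set ℕ}
    (hlev : ∀ v w, Λ v ⊆ Λ' w → F.lev w = F.lev v) (φ : F.field κ p Λ ≃+* F.field κ p Λ') :
    ∃ f : V → V, (∀ v, φ (F.x κ p Λ v) = F.x κ p Λ' (f v)) ∧ Function.Bijective f ∧
      (∀ v, Λ v = Λ' (f v)) ∧ F.IsEmbedding Λ Λ' f := by
  obtain ⟨f, j, hf, h1, h2, h3⟩ := exists_map hp hκ (φ : F.field κ p Λ →+* F.field κ p Λ')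
  obtain ⟨g, k, hg, h1', h2', -⟩ := exists_map hp hκ (φ.symm : F.field κ p Λ' →+* F.field κ p Λ)
  have hp0 : p ≠ 0 := expChar_ne_zero κ p
  have h4 : ∀ v, F.lev (f v) = F.lev v := fun v => hlev _ _ (h2 v)
  have key : ∀ v, g (f v) = v ∧ p ^ j v = 1 := by
    intro v
    have h5 : F.x κ p Λ (g (f v)) ^ (p ^ k (f v) * p ^ j v) = F.x κ p Λ v ^ 1 := by
      have h6 := congrArg φ.symm (hf v)
      rw [map_pow] at h6
      have h7 : φ.symm (F.x κ p Λ' (f v)) = F.x κ p Λ (g (f v)) ^ p ^ k (f v) := hg (f v)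
      rw [h7] at h6
      rw [pow_mul, ← h6, pow_one]
      exact φ.symm_apply_apply _
    have h6 := congrArg Subtype.val h5
    rw [x_pow, x_pow] at h6
    rcases single_eq_single_iff _ _ _ _ |>.1 (mon_injective h6) with h7 | h7
    · refine ⟨h7.1, ?_⟩
      have h8 : p ^ k (f v) * p ^ j v = 1 := by exact_mod_cast h7.2
      exact Nat.eq_one_of_mul_eq_one_left h8
    · exact absurd h7.2 (by norm_num)
  have hsurj : Function.Surjective f := fun w => by
    refine ⟨g w, h1' ?_⟩
    rw [(key (g w)).1]
  refine ⟨f, fun v => ?_, ⟨h1, hsurj⟩, fun v => (h2 v).antisymm ?_, h1, h4, h3 h4, h2⟩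
  · have := hf v
    rwa [(key v).2, pow_one] at this
  · have := h2' (f v)
    rwa [(key v).1] at this

omit [ExpChar κ p] [Nonempty V] in
/-- Endomorphisms that fix the variables fix all monomials: they can only multiply a monomial by a
root of unity, whose order has large prime factors. -/
theorem map_mon_of_map_x (hκ : IsConstantField κ p) {Λ : V → Set ℕ}
    (φ : F.field κ p Λ →+* F.field κ p Λ) (h : ∀ v, φ (F.x κ p Λ v) = F.x κ p Λ v)
    {γ : V →₀ ℚ} (hγ : γ ∈ F.exponents p Λ) : φ ⟨mon γ, mon_mem hγ⟩ = ⟨mon γ, mon_mem hγ⟩ := by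
  classical
  -- integral exponents
  have h1 : ∀ δ : V →₀ ℚ, (∀ v, (δ v).den = 1) → ∃ h' : δ ∈ F.exponents p Λ,
      φ ⟨mon δ, mon_mem h'⟩ = ⟨mon δ, mon_mem h'⟩ := by
    intro δ
    induction δ using Finsupp.induction with
    | zero =>
      intro _
      refine ⟨zero_mem _, ?_⟩
      have : (⟨mon 0, mon_mem (zero_mem _)⟩ : F.field κ p Λ) = 1 := Subtype.ext mon_zero
      exact (congrArg φ this).trans ((map_one φ).trans this.symm)
    | single_add w α δ hw hα ih =>
      intro hd
      have hδ : ∀ v, (δ v).den = 1 := by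
        intro v
        by_cases hv : v = w
        · rw [hv, notMem_support_iff.1 hw]; rfl
        · have := hd v
          rwa [Finsupp.add_apply, single_eq_of_ne hv, zero_add] at this
      obtain ⟨h2, h3⟩ := ih hδ
      have hα1 : α.den = 1 := by
        have := hd w
        rwa [Finsupp.add_apply, single_eq_same, notMem_support_iff.1 hw, add_zero] at this
      have h4 : (single w α : V →₀ ℚ) = α.num • single w 1 := by
        rw [smul_single, zsmul_eq_mul, mul_one]
        congr 1
        exact (Rat.den_eq_one_iff α).1 hα1 |>.symm
      have h5 : single w α ∈ F.exponents p Λ := h4 ▸ zsmul_mem (single_one_mem w) _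
      have h6 : (⟨mon (single w α), mon_mem h5⟩ : F.field κ p Λ) = F.x κ p Λ w ^ α.num := by
        refine Subtype.ext ?_
        show mon (single w α) = ((F.x κ p Λ w ^ α.num : F.field κ p Λ) : BigField κ V)
        have h8 : ((F.x κ p Λ w ^ α.num : F.field κ p Λ) : BigField κ V) = var w ^ α.num :=
          map_zpow₀ (F.field κ p Λ).subtype _ _
        rw [h8]
        rw [h4]
        rcases Int.eq_nat_or_neg α.num with ⟨n, hn | hn⟩
        · rw [hn, natCast_zsmul, zpow_natCast, mon_nsmul, var]
        · rw [hn, neg_smul, natCast_zsmul, zpow_neg, zpow_natCast, mon_neg, mon_nsmul, var]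
      refine ⟨add_mem h5 h2, ?_⟩
      have h7 : (⟨mon (single w α + δ), mon_mem (add_mem h5 h2)⟩ : F.field κ p Λ) =
          F.x κ p Λ w ^ α.num * ⟨mon δ, mon_mem h2⟩ := by
        rw [← h6]
        exact Subtype.ext (mon_add _ _)
      rw [h7, map_mul, map_zpow₀, h, h3]
  -- a multiple of the exponent is integral
  set N := ∏ v ∈ γ.support, (γ v).den with hN
  have hNl : LargeFactors p N := by
    rw [hN]
    induction γ.support using Finset.induction with
    | empty => exact .one p
    | insert v S hv ih =>
      rw [Finset.prod_insert hv]
      exact (largeDenominators γ hγ v).mul ih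
  have hd : ∀ v, ((N • γ) v).den = 1 := by
    intro v
    rw [Finsupp.smul_apply, nsmul_eq_mul]
    by_cases hv : v ∈ γ.support
    · obtain ⟨M, hM⟩ := Finset.dvd_prod_of_mem (fun v => (γ v).den) hv
      rw [hN, hM]
      have : (((γ v).den * M : ℕ) : ℚ) * γ v = ((M * (γ v).num : ℤ) : ℚ) := by
        push_cast
        rw [← Rat.den_mul_eq_num (γ v)]
        ring
      rw [this]
      exact Rat.den_intCast _
    · rw [notMem_support_iff.1 hv, mul_zero]
      rfl
  obtain ⟨h2, h3⟩ := h1 _ hd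
  have h4 : (φ ⟨mon γ, mon_mem hγ⟩) ^ N = ⟨mon (N • γ), mon_mem h2⟩ := by
    rw [← h3, ← map_pow]
    congr 1
    exact Subtype.ext (mon_nsmul N γ).symm
  obtain ⟨ζ, hζ, h5⟩ := eq_algebraMap_mul_mon hNl.1 (congrArg Subtype.val h4)
  have h6 : algebraMap κ (BigField κ V) ζ ∈ F.field κ p Λ := by
    have h7 : algebraMap κ (BigField κ V) ζ =
        (φ ⟨mon γ, mon_mem hγ⟩ : BigField κ V) / mon γ := by
      rw [h5, mul_div_cancel_right₀ _ (mon_ne_zero γ)]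
    rw [h7]
    exact div_mem (Subtype.property _) (mon_mem hγ)
  have h7 := eq_one_of_pow_eq_one (single_one_mem) hκ h6 hNl hζ
  rw [h7, map_one, one_mul] at h5
  exact Subtype.ext h5

omit [IsAlgClosed κ] [ExpChar κ p] [Nonempty V] in
/-- Homomorphisms that send variables to variables send the square roots to square roots, up to
sign. -/
theorem map_s {Λ Λ' : V → Set ℕ} {φ : F.field κ p Λ →+* F.field κ p Λ'} {v w : V}
    (h : φ (F.x κ p Λ v) = F.x κ p Λ' w) :
    φ (F.s κ p Λ v) = F.s κ p Λ' w ∨ φ (F.s κ p Λ v) = -F.s κ p Λ' w := by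
  have h1 : ∀ Λ v, F.s κ p Λ v ^ 2 = 1 + F.x κ p Λ v := fun Λ v => Subtype.ext (sqrtVar_sq v)
  rw [← sq_eq_sq_iff_eq_or_eq_neg, ← map_pow, h1, h1, map_add, map_one, h]

end Forest

/-! ### The fields of constants -/

instance : Algebra.IsAlgebraic ℚ (AlgebraicClosure ℚ) := by
  have h := AlgebraicClosure.isAlgebraic ℚ
  convert h
  · rfl
  · exact Subsingleton.elim _ _

/-- A primitive `r`-th root of unity `c` is conjugate to `c ^ 2`, and `c ^ 4 ≠ c` if `r > 3`. -/
theorem isConstantField_algebraicClosure_rat : IsConstantField (AlgebraicClosure ℚ) 1 where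
  algebraic c := by
    have h1 : IsAlgebraic ℚ c := Algebra.IsAlgebraic.isAlgebraic c
    obtain ⟨q, hq, hqc⟩ := (IsFractionRing.isAlgebraic_iff ℤ ℚ (AlgebraicClosure ℚ)).2 h1
    refine ⟨q, ?_, hqc⟩
    exact (Polynomial.map_ne_zero_iff (Int.cast_injective)).2 hq
  moved r hr hr5 c hc hc1 := by
    have : Fact r.Prime := ⟨hr⟩
    have hprim : IsPrimitiveRoot c r := IsPrimitiveRoot.iff_orderOf.2 (orderOf_eq_prime hc hc1)
    have h2 : Nat.Coprime 2 r := (Nat.coprime_primes Nat.prime_two hr).2 (by omega)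
    have hprim2 : IsPrimitiveRoot (c ^ 2) r := hprim.pow_of_coprime 2 h2
    have h3 : IsConjRoot ℚ c (c ^ 2) := by
      rw [isConjRoot_def, ← Polynomial.cyclotomic_eq_minpoly_rat hprim hr.pos,
        ← Polynomial.cyclotomic_eq_minpoly_rat hprim2 hr.pos]
    have : Normal ℚ (AlgebraicClosure ℚ) :=
      normal_iff.2 fun x => ⟨(Algebra.IsAlgebraic.isAlgebraic x).isIntegral, IsAlgClosed.splits _⟩
    obtain ⟨σ, hσ⟩ := isConjRoot_iff_exists_algEquiv.1 h3.symm
    refine ⟨σ, fun h => ?_⟩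
    have h4 : c ^ 4 = c := by
      have h5 : σ (σ c) = c := h
      rw [hσ, map_pow, hσ, ← pow_mul] at h5
      exact h5
    have h5 : c ^ 3 = 1 := by
      have hc0 : c ≠ 0 := by
        rintro rfl
        rw [zero_pow hr.ne_zero] at hc
        exact zero_ne_one hc
      exact mul_left_cancel₀ hc0 (by rw [mul_one, ← pow_succ', h4])
    have := Nat.le_of_dvd (by norm_num) ((hprim.pow_eq_one_iff_dvd 3).1 h5)
    omega

/-- The square of the Frobenius automorphism moves a primitive `r`-th root of unity unless `r`
divides `p ^ 2 - 1`. -/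
theorem isConstantField_algebraicClosure_zmod (p : ℕ) [Fact p.Prime] :
    IsConstantField (AlgebraicClosure (ZMod p)) p where
  algebraic c := by
    obtain ⟨q, hq, hqc⟩ : IsAlgebraic (ZMod p) c := Algebra.IsAlgebraic.isAlgebraic c
    obtain ⟨Q, rfl⟩ := Polynomial.map_surjective (Int.castRingHom (ZMod p))
      (ZMod.intCast_surjective) q
    refine ⟨Q, fun h => hq ?_, ?_⟩
    · have h1 : (Q.map (Int.castRingHom (ZMod p))).map
          (algebraMap (ZMod p) (AlgebraicClosure (ZMod p))) = 0 := by
        rw [Polynomial.map_map, ← h]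
        congr 1
      exact (Polynomial.map_eq_zero _).1 h1
    · rw [← hqc, Polynomial.aeval_def, Polynomial.aeval_def, Polynomial.eval₂_map]
      congr 1
  moved r hr hr5 c hc hc1 := by
    have : Fact r.Prime := ⟨hr⟩
    refine ⟨frobenius (AlgebraicClosure (ZMod p)) p, fun h => ?_⟩
    have hp := (Fact.out : p.Prime)
    have hprim : IsPrimitiveRoot c r := IsPrimitiveRoot.iff_orderOf.2 (orderOf_eq_prime hc hc1)
    have hc0 : c ≠ 0 := by
      rintro rfl
      rw [zero_pow hr.ne_zero] at hc
      exact zero_ne_one hc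
    rw [frobenius_def, frobenius_def, ← pow_mul] at h
    have h2 := hp.two_le
    have h3 : p * p = (p + 1) * (p - 1) + 1 := by
      obtain ⟨k, rfl⟩ : ∃ k, p = k + 1 := ⟨p - 1, by omega⟩
      simp
      ring
    have h4 : c ^ ((p + 1) * (p - 1)) = 1 := by
      refine mul_right_cancel₀ hc0 ?_
      rw [one_mul, ← pow_succ, ← h3, h]
    rcases hr.dvd_mul.1 ((hprim.pow_eq_one_iff_dvd _).1 h4) with h5 | h5
    · have := Nat.le_of_dvd (by omega) h5
      omega
    · have := Nat.le_of_dvd (by omega) h5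
      omega

/-- In every characteristic other than two there is a suitable countable field of constants. -/
theorem exists_constantField {p : ℕ} (hp : p = 0 ∨ p.Prime) (hp2 : p ≠ 2) :
    ∃ (κ : Type) (_ : Field κ) (_ : IsAlgClosed κ) (_ : Countable κ) (_ : CharP κ p) (P : ℕ)
      (_ : ExpChar κ P), P ≠ 2 ∧ IsConstantField κ P := by
  rcases hp with rfl | hp
  · refine ⟨AlgebraicClosure ℚ, inferInstance, inferInstance, ?_, inferInstance, 1, inferInstance,
      by norm_num, isConstantField_algebraicClosure_rat⟩
    have h := Algebra.IsAlgebraic.cardinalMk_le_max ℚ (AlgebraicClosure ℚ)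
    rw [← Cardinal.mk_le_aleph0_iff]
    exact h.trans (max_le (Cardinal.mk_le_aleph0_iff.2 inferInstance) le_rfl)
  · have : Fact p.Prime := ⟨hp⟩
    have : CharP (AlgebraicClosure (ZMod p)) p :=
      charP_of_injective_algebraMap (algebraMap (ZMod p) _).injective p
    refine ⟨AlgebraicClosure (ZMod p), inferInstance, inferInstance, ?_, this, p,
      ExpChar.prime hp, hp2, isConstantField_algebraicClosure_zmod p⟩
    have h := Algebra.IsAlgebraic.cardinalMk_le_max (ZMod p) (AlgebraicClosure (ZMod p))
    rw [← Cardinal.mk_le_aleph0_iff]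
    exact h.trans (max_le (Cardinal.mk_le_aleph0_iff.2 inferInstance) le_rfl)

/-! ### A tree of approximations to an analytic quasi-order on the Cantor space -/

/-- The sequences `a` and `b` have the same first `n` values. -/
def Agree (n : ℕ) (a b : ℕ → Bool) : Prop := ∀ i < n, a i = b i

theorem Agree.refl (n : ℕ) (a : ℕ → Bool) : Agree n a a := fun _ _ => rfl

theorem Agree.symm {n : ℕ} {a b : ℕ → Bool} (h : Agree n a b) : Agree n b a :=
  fun i hi => (h i hi).symm

theorem Agree.trans {n : ℕ} {a b c : ℕ → Bool} (h : Agree n a b) (h' : Agree n b c) :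
    Agree n a c := fun i hi => (h i hi).trans (h' i hi)

theorem agree_zero (a b : ℕ → Bool) : Agree 0 a b := fun _ h => absurd h (Nat.not_lt_zero _)

theorem exists_agree_testBit (n : ℕ) (a : ℕ → Bool) : ∃ k : ℕ, Agree n (Nat.testBit k) a :=
  ⟨Nat.ofBits fun i : Fin n => a i, fun i hi => by rw [Nat.testBit_ofBits_lt _ _ hi]⟩

/-- One step of approximation: up to the first `n` values, the pair `(a, b)` is the value of `g` at
a point whose first `n` values are bounded by `α`; or `a` and `b` agree. -/
def Step (g : (ℕ → ℕ) → (ℕ → Bool) × (ℕ → Bool)) (n : ℕ) (α : ℕ → ℕ) (a b : ℕ → Bool) : Prop :=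
  Agree n a b ∨ ∃ z : ℕ → ℕ, (∀ i < n, z i ≤ α i) ∧ Agree n (g z).1 a ∧ Agree n (g z).2 b

/-- A chain of approximate steps of length `α 0` from `a` to `b`. The length is bounded by `α` for
compactness, and chains are used for transitivity. -/
def Approx (g : (ℕ → ℕ) → (ℕ → Bool) × (ℕ → Bool)) (n : ℕ) (α : ℕ → ℕ) (a b : ℕ → Bool) : Prop :=
  ∃ c : ℕ → ℕ → Bool, Agree n (c 0) a ∧ Agree n (c (α 0)) b ∧
    ∀ j < α 0, Step g n α (c j) (c (j + 1))

variable {g : (ℕ → ℕ) → (ℕ → Bool) × (ℕ → Bool)}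

theorem Step.congr {n : ℕ} {α β : ℕ → ℕ} {a b a' b' : ℕ → Bool} (h : Step g n α a b)
    (hα : ∀ i < n, α i ≤ β i) (ha : Agree n a a') (hb : Agree n b b') : Step g n β a' b' := by
  rcases h with h | ⟨z, h1, h2, h3⟩
  · exact Or.inl (ha.symm.trans (h.trans hb))
  · exact Or.inr ⟨z, fun i hi => (h1 i hi).trans (hα i hi), h2.trans ha, h3.trans hb⟩

theorem Approx.congr {n : ℕ} {α : ℕ → ℕ} {a b a' b' : ℕ → Bool} (h : Approx g n α a b)
    (ha : Agree n a a') (hb : Agree n b b') : Approx g n α a' b' := by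
  obtain ⟨c, h1, h2, h3⟩ := h
  exact ⟨c, h1.trans ha, h2.trans hb, h3⟩

theorem Approx.refl {n : ℕ} {α : ℕ → ℕ} (a : ℕ → Bool) : Approx g n α a a :=
  ⟨fun _ => a, .refl _ _, .refl _ _, fun _ _ => Or.inl (.refl _ _)⟩

/-- Approximate chains can be concatenated, at the cost of adding the bounds. -/
theorem Approx.trans {n : ℕ} {α β γ : ℕ → ℕ} {a b d : ℕ → Bool} (h : Approx g n α a b)
    (h' : Approx g n β b d) (hγ : ∀ i < n, γ i = α i + β i) : Approx g n γ a d := by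
  rcases Nat.eq_zero_or_pos n with rfl | hn
  · exact (Approx.refl a).congr (.refl _ _) (agree_zero _ _)
  obtain ⟨c, h1, h2, h3⟩ := h
  obtain ⟨c', h1', h2', h3'⟩ := h'
  have hα : ∀ i < n, α i ≤ γ i := fun i hi => by rw [hγ i hi]; exact Nat.le_add_right _ _
  have hβ : ∀ i < n, β i ≤ γ i := fun i hi => by rw [hγ i hi]; exact Nat.le_add_left _ _
  have h0 := hγ 0 hn
  refine ⟨fun j => if j < α 0 then c j else c' (j - α 0), ?_, ?_, fun j hj => ?_⟩
  · by_cases hα0 : 0 < α 0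
    · simpa [hα0] using h1
    · have hz : α 0 = 0 := by omega
      rw [hz] at h2
      simpa [hz] using h1'.trans (h2.symm.trans h1)
  · have hz : ¬ γ 0 < α 0 := by omega
    have hz' : γ 0 - α 0 = β 0 := by omega
    simpa [hz, hz'] using h2'
  · by_cases hj1 : j + 1 < α 0
    · have hj0 : j < α 0 := by omega
      simpa [hj1, hj0] using (h3 j hj0).congr hα (.refl _ _) (.refl _ _)
    · by_cases hj0 : j < α 0
      · have hz : j + 1 = α 0 := by omega
        have h4 := h3 j hj0
        rw [hz] at h4
        simpa [hj0, hz] using h4.congr hα (.refl _ _) (h2.trans h1'.symm)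
      · have hz : j + 1 - α 0 = j - α 0 + 1 := by omega
        simpa [hj0, hj1, hz] using (h3' (j - α 0) (by omega)).congr hβ (.refl _ _) (.refl _ _)

theorem Approx.congr_left {n : ℕ} {α β : ℕ → ℕ} {a b : ℕ → Bool} (h : Approx g n α a b)
    (hα : ∀ i < n, α i = β i) : Approx g n β a b :=
  h.trans (β := 0) (Approx.refl b) fun i hi => by simp [hα i hi]

open Filter Topology

theorem exists_eventually_eq_of_bounded {u : ℕ → ℕ} {B : ℕ} {U : Ultrafilter ℕ}
    (h : ∀ᶠ n in (U : Filter ℕ), u n ≤ B) : ∃ m, ∀ᶠ n in (U : Filter ℕ), u n = m := by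
  have h1 : (⋃ m ∈ Set.Iic B, {n | u n = m}) ∈ U := by
    filter_upwards [h] with n hn
    simpa using hn
  obtain ⟨m, -, hm⟩ := (Ultrafilter.finite_biUnion_mem_iff (Set.finite_Iic B)).1 h1
  exact ⟨m, hm⟩

theorem exists_eventually_eq_bool {u : ℕ → Bool} {U : Ultrafilter ℕ} :
    ∃ m, ∀ᶠ n in (U : Filter ℕ), u n = m := by
  by_cases h : ∀ᶠ n in (U : Filter ℕ), u n = true
  · exact ⟨true, h⟩
  · refine ⟨false, ?_⟩
    filter_upwards [Ultrafilter.eventually_not.2 h] with n hn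
    simpa using hn

/-- The approximations determine the relation: by compactness, approximate chains for all `n` with a
common bound converge to a chain for the relation. -/
theorem rel_of_forall_approx {R : (ℕ → Bool) → (ℕ → Bool) → Prop} (hrefl : ∀ a, R a a)
    (htrans : ∀ a b c, R a b → R b c → R a c) (hg : Continuous g)
    (hgR : ∀ z, R (g z).1 (g z).2) {α : ℕ → ℕ} {a b : ℕ → Bool} (h : ∀ n, Approx g n α a b) :
    R a b := by
  classical
  choose c h1 h2 h3 using h
  set U : Ultrafilter ℕ := hyperfilter ℕ with hU
  have hlt : ∀ i, ∀ᶠ n in (U : Filter ℕ), i < n := fun i =>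
    Nat.hyperfilter_le_atTop (eventually_gt_atTop i)
  choose d hd using fun j i => exists_eventually_eq_bool (u := fun n => c n j i) (U := U)
  have h0 : d 0 = a := by
    funext i
    obtain ⟨n, hn, hn'⟩ := ((hd 0 i).and (hlt i)).exists
    rw [← hn, h1 n i hn']
  have hlast : d (α 0) = b := by
    funext i
    obtain ⟨n, hn, hn'⟩ := ((hd (α 0) i).and (hlt i)).exists
    rw [← hn, h2 n i hn']
  have hstep : ∀ j < α 0, R (d j) (d (j + 1)) := by
    intro j hj
    have h4 : ∀ᶠ n in (U : Filter ℕ), Step g n α (c n j) (c n (j + 1)) :=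
      .of_forall fun n => h3 n j hj
    rcases Ultrafilter.eventually_or.1 h4 with h4 | h4
    · have : d j = d (j + 1) := by
        funext i
        obtain ⟨n, ⟨⟨hn, hn'⟩, hn4⟩, hni⟩ :=
          (((hd j i).and (hd (j + 1) i)).and h4).and (hlt i) |>.exists
        rw [← hn, ← hn', hn4 i hni]
      rw [this]
      exact hrefl _
    · have : ∃ z : ℕ → ℕ → ℕ, ∀ᶠ n in (U : Filter ℕ), (∀ i < n, z n i ≤ α i) ∧
          Agree n (g (z n)).1 (c n j) ∧ Agree n (g (z n)).2 (c n (j + 1)) := by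
        refine ⟨fun n => if hn : _ then (Classical.choose (p := fun z : ℕ → ℕ =>
          (∀ i < n, z i ≤ α i) ∧ Agree n (g z).1 (c n j) ∧ Agree n (g z).2 (c n (j + 1))) hn)
          else 0, ?_⟩
        filter_upwards [h4] with n hn
        rw [dif_pos hn]
        exact Classical.choose_spec hn
      obtain ⟨z, hz⟩ := this
      choose y hy using fun i => exists_eventually_eq_of_bounded (u := fun n => z n i) (B := α i)
        (U := U) (by filter_upwards [hz, hlt i] with n hn hi using hn.1 i hi)
      have hzy : Tendsto z U (𝓝 y) := by
        rw [tendsto_pi_nhds]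
        exact fun i => tendsto_nhds_of_eventually_eq (hy i)
      have hgz : Tendsto (fun n => g (z n)) U (𝓝 (g y)) := (hg.tendsto y).comp hzy
      have e1 : (g y).1 = d j := by
        funext i
        have h5 : Tendsto (fun n => (g (z n)).1 i) U (𝓝 ((g y).1 i)) :=
          ((continuous_apply i).comp continuous_fst).tendsto (g y) |>.comp hgz
        refine tendsto_nhds_unique h5 (tendsto_nhds_of_eventually_eq ?_)
        filter_upwards [hz, hlt i, hd j i] with n hn hi hdn
        rw [hn.2.1 i hi, hdn]
      have e2 : (g y).2 = d (j + 1) := by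
        funext i
        have h5 : Tendsto (fun n => (g (z n)).2 i) U (𝓝 ((g y).2 i)) :=
          ((continuous_apply i).comp continuous_snd).tendsto (g y) |>.comp hgz
        refine tendsto_nhds_unique h5 (tendsto_nhds_of_eventually_eq ?_)
        filter_upwards [hz, hlt i, hd (j + 1) i] with n hn hi hdn
        rw [hn.2.2 i hi, hdn]
      rw [← e1, ← e2]
      exact hgR y
  have hchain : ∀ j ≤ α 0, R (d 0) (d j) := by
    intro j
    induction j with
    | zero => exact fun _ => hrefl _
    | succ j ih => exact fun hj => htrans _ _ _ (ih (by omega)) (hstep j (by omega))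
  rw [← h0, ← hlast]
  exact hchain _ le_rfl

/-- The points of the relation are approximated by chains of one step, padded with trivial steps.
The value `α 0` is positive so that the step is present. -/
theorem approx_apply (z : ℕ → ℕ) : ∃ α : ℕ → ℕ, 1 ≤ α 0 ∧ ∀ n, Approx g n α (g z).1 (g z).2 := by
  refine ⟨fun i => z i + 1, Nat.le_add_left 1 _, fun n =>
    ⟨fun j => if j = 0 then (g z).1 else (g z).2, ?_, ?_, fun j hj => ?_⟩⟩
  · exact .refl _ _
  · exact .refl _ _
  · by_cases hj0 : j = 0
    · subst hj0
      exact Or.inr ⟨z, fun i _ => Nat.le_succ _, .refl _ _, .refl _ _⟩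
    · simp only [hj0, if_false, Nat.add_eq_zero_iff, one_ne_zero, and_false]
      exact Or.inl (.refl _ _)

/-! ### The tree of finite sequences with labels coding a quasi-order -/

/-- The tree of finite sequences of natural numbers. -/
def seqTree : Forest (List ℕ) where
  par := List.dropLast
  lev := List.length
  lev_par s hs := by
    rw [List.length_dropLast]
    omega

/-- The values of a finite sequence, continued by zero. -/
def val (s : List ℕ) (i : ℕ) : ℕ := s.getD i 0

/-- The labels of a finite sequence `s` attached to `a`: approximations `u` to `a` along `s`; the
length of `s` and all numbers up to its last entry; and a mark, which is present if the first entry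
of `s` is not zero, and which records the bits of `a` at the sequences with all entries zero. -/
inductive HasLabel (g : (ℕ → ℕ) → (ℕ → Bool) × (ℕ → Bool)) (a : ℕ → Bool) (s : List ℕ) :
    ℕ ⊕ (ℕ × ℕ) ⊕ Unit → Prop
  | approx (k : ℕ) (h : Approx g s.length (val s) (Nat.testBit k) a) : HasLabel g a s (.inl k)
  | level (k : ℕ) (h : s ≠ [] → k ≤ val s (s.length - 1)) :
      HasLabel g a s (.inr (.inl (s.length, k)))
  | mark (hs : s ≠ []) (h : val s 0 = 0 → (∀ i, val s i = 0) ∧ a (s.length - 1) = true) :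
      HasLabel g a s (.inr (.inr ()))

/-- The labels, as natural numbers. -/
def labels (g : (ℕ → ℕ) → (ℕ → Bool) × (ℕ → Bool)) (a : ℕ → Bool) (s : List ℕ) : Set ℕ :=
  Encodable.encode '' {l | HasLabel g a s l}

theorem encode_mem_labels {a : ℕ → Bool} {s : List ℕ} {l : ℕ ⊕ (ℕ × ℕ) ⊕ Unit} :
    Encodable.encode l ∈ labels g a s ↔ HasLabel g a s l :=
  Encodable.encode_injective.mem_set_image

/-- The labels of a sequence determine its length. -/
theorem length_eq_of_labels_subset {a b : ℕ → Bool} {s t : List ℕ}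
    (h : labels g a s ⊆ labels g b t) : t.length = s.length := by
  have h1 := encode_mem_labels.1 (h (encode_mem_labels.2 (.level 0 fun _ => Nat.zero_le _)))
  generalize hl : (s.length, 0) = q at h1
  cases h1
  exact (congrArg Prod.fst hl).symm

theorem hasLabel_level_iff {a : ℕ → Bool} {s : List ℕ} {n k : ℕ} :
    HasLabel g a s (.inr (.inl (n, k))) ↔
      n = s.length ∧ (s ≠ [] → k ≤ val s (s.length - 1)) := by
  constructor
  · intro h
    cases h with
    | level _ h => exact ⟨rfl, h⟩
  · rintro ⟨rfl, h⟩
    exact .level k h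

theorem hasLabel_mark_iff {a : ℕ → Bool} {s : List ℕ} :
    HasLabel g a s (.inr (.inr ())) ↔
      s ≠ [] ∧ (val s 0 = 0 → (∀ i, val s i = 0) ∧ a (s.length - 1) = true) := by
  constructor
  · intro h
    cases h with
    | mark hs h => exact ⟨hs, h⟩
  · rintro ⟨hs, h⟩
    exact .mark hs h

theorem hasLabel_approx_iff {a : ℕ → Bool} {s : List ℕ} {k : ℕ} :
    HasLabel g a s (.inl k) ↔ Approx g s.length (val s) (Nat.testBit k) a := by
  constructor
  · intro h
    cases h with
    | approx _ h => exact h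
  · exact fun h => .approx k h

theorem val_ext {s t : List ℕ} (hl : s.length = t.length) (h : ∀ i < s.length, val s i = val t i) :
    s = t := by
  refine List.ext_getElem hl fun i h1 h2 => ?_
  have := h i h1
  rwa [val, val, List.getD_eq_getElem _ _ h1, List.getD_eq_getElem _ _ h2] at this

theorem val_dropLast {s : List ℕ} {i : ℕ} (h : i + 1 < s.length) : val s.dropLast i = val s i := by
  have h1 : i < s.dropLast.length := by rw [List.length_dropLast]; omega
  rw [val, val, List.getD_eq_getElem _ _ h1, List.getD_eq_getElem _ _ (by omega),
    List.getElem_dropLast]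

/-- The translation of finite sequences by an infinite sequence. -/
def translate (α : ℕ → ℕ) (s : List ℕ) : List ℕ := s.mapIdx fun i k => k + α i

theorem length_translate (α : ℕ → ℕ) (s : List ℕ) : (translate α s).length = s.length :=
  List.length_mapIdx

theorem val_translate {α : ℕ → ℕ} {s : List ℕ} {i : ℕ} (h : i < s.length) :
    val (translate α s) i = val s i + α i := by
  have h1 : i < (translate α s).length := by rwa [length_translate]
  rw [val, val, List.getD_eq_getElem _ _ h1, List.getD_eq_getElem _ _ h]
  exact List.getElem_mapIdx

/-- Translation by a bound for approximations is an embedding of labelled trees. As `α 0` is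
positive, it leads to sequences on which the mark is always present. -/
theorem translate_isEmbedding {α : ℕ → ℕ} (hα : 1 ≤ α 0) {a b : ℕ → Bool}
    (h : ∀ n, Approx g n α a b) :
    seqTree.IsEmbedding (labels g a) (labels g b) (translate α) where
  injective s t hst := by
    have hl : s.length = t.length := by
      rw [← length_translate α s, hst, length_translate]
    refine val_ext hl fun i hi => ?_
    have h1 := val_translate (α := α) hi
    rw [hst, val_translate (hl ▸ hi)] at h1
    omega
  lev s := length_translate α s
  par s _ := by
    refine val_ext ?_ fun i hi => ?_
    · simp [seqTree, length_translate]
    · have hi' : i + 1 < s.length := by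
        simp only [seqTree, List.length_dropLast, length_translate] at hi
        omega
      show val (translate α s).dropLast i = val (translate α s.dropLast) i
      rw [val_dropLast (by rwa [length_translate]), val_translate (by omega),
        val_translate (by rw [List.length_dropLast]; omega), val_dropLast hi']
  label s := by
    rintro _ ⟨l, hl, rfl⟩
    rw [encode_mem_labels]
    cases hl with
    | approx k hk =>
      rw [hasLabel_approx_iff, length_translate]
      exact hk.trans (h _) fun i hi => val_translate hi
    | level k hk =>
      rw [hasLabel_level_iff, length_translate]
      refine ⟨rfl, fun hs => ?_⟩
      have hs' : s ≠ [] := by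
        rintro rfl
        exact hs rfl
      have hpos := List.length_pos_iff.2 hs'
      rw [val_translate (by omega)]
      exact (hk hs').trans (Nat.le_add_right _ _)
    | mark hs hk =>
      have hpos := List.length_pos_iff.2 hs
      rw [hasLabel_mark_iff]
      refine ⟨fun h0 => hs ?_, fun h0 => ?_⟩
      · rw [← List.length_eq_zero_iff, ← length_translate α, h0, List.length_nil]
      · rw [val_translate hpos] at h0
        omega

theorem val_replicate (n i : ℕ) : val (List.replicate n 0) i = 0 := by
  rw [val]
  by_cases h : i < n
  · rw [List.getD_eq_getElem _ _ (by simpa using h), List.getElem_replicate]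
  · exact List.getD_eq_default _ _ (by simpa using h)

/-- An embedding of labelled trees, evaluated at the sequences with all entries zero, yields a
common bound for approximations. -/
theorem exists_forall_approx {a b : ℕ → Bool} {f : List ℕ → List ℕ}
    (hf : seqTree.IsEmbedding (labels g a) (labels g b) f) : ∃ α, ∀ n, Approx g n α a b := by
  set z : ℕ → List ℕ := fun n => List.replicate n 0 with hz
  have hlen : ∀ n, (f (z n)).length = n := fun n => (hf.lev _).trans (by simp [seqTree, hz])
  have hpar : ∀ n, (f (z (n + 1))).dropLast = f (z n) := fun n => by
    refine (hf.par (z (n + 1)) (by simp [seqTree, hz])).trans ?_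
    congr 1
    simp [seqTree, hz]
  refine ⟨fun i => val (f (z (i + 1))) i, fun n => ?_⟩
  have hval : ∀ n, ∀ i < n, val (f (z n)) i = val (f (z (i + 1))) i := by
    intro n
    induction n with
    | zero => exact fun i hi => absurd hi (Nat.not_lt_zero _)
    | succ n ih =>
      intro i hi
      rcases Nat.lt_succ_iff_lt_or_eq.1 hi with h | rfl
      · rw [← ih i h, ← hpar n, val_dropLast (by rw [hlen]; omega)]
      · rfl
  obtain ⟨k, hk⟩ := exists_agree_testBit n a
  have h1 : HasLabel g a (z n) (.inl k) :=
    hasLabel_approx_iff.2 ((Approx.refl a).congr (by simpa [hz] using hk.symm) (.refl _ _))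
  have h2 := hasLabel_approx_iff.1
    (encode_mem_labels.1 (hf.label _ (encode_mem_labels.2 h1)))
  rw [hlen] at h2
  exact (h2.congr hk (.refl _ _)).congr_left (hval n)

/-- Embeddability of the labelled trees is the given quasi-order. -/
theorem exists_isEmbedding_iff {R : (ℕ → Bool) → (ℕ → Bool) → Prop} (hrefl : ∀ a, R a a)
    (htrans : ∀ a b c, R a b → R b c → R a c) (hg : Continuous g)
    (hgR : ∀ a b, R a b ↔ ∃ z, g z = (a, b)) (a b : ℕ → Bool) :
    (∃ f, seqTree.IsEmbedding (labels g a) (labels g b) f) ↔ R a b := by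
  constructor
  · rintro ⟨f, hf⟩
    obtain ⟨α, hα⟩ := exists_forall_approx hf
    exact rel_of_forall_approx hrefl htrans hg (fun z => (hgR _ _).2 ⟨z, rfl⟩) hα
  · intro h
    obtain ⟨z, hz⟩ := (hgR a b).1 h
    obtain ⟨α, h1, h2⟩ := approx_apply (g := g) z
    rw [hz] at h2
    exact ⟨_, translate_isEmbedding h1 h2⟩

/-- The labelled trees are rigid. -/
theorem eq_self_of_labels_eq {a b : ℕ → Bool} {f : List ℕ → List ℕ}
    (hf : seqTree.IsEmbedding (labels g a) (labels g b) f)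
    (h : ∀ s, labels g a s = labels g b (f s)) (s : List ℕ) : f s = s := by
  have hlen : ∀ s, (f s).length = s.length := hf.lev
  induction hn : s.length generalizing s with
  | zero =>
    rw [List.length_eq_zero_iff.1 hn, ← List.length_eq_zero_iff, hlen, List.length_nil]
  | succ n ih =>
    have hpar : (f s).dropLast = s.dropLast :=
      (hf.par s (by simp [seqTree, hn])).trans (ih _ (by simp [seqTree, hn]))
    have hs : s ≠ [] := by
      rintro rfl
      simp at hn
    have hfs : f s ≠ [] := by
      intro h0
      have := hlen s
      rw [h0, hn] at this
      simp at this
    have hlast : ∀ k, k ≤ val (f s) n ↔ k ≤ val s n := by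
      intro k
      have h1 : HasLabel g a s (.inr (.inl (n + 1, k))) ↔
          HasLabel g b (f s) (.inr (.inl (n + 1, k))) := by
        rw [← encode_mem_labels, h s, encode_mem_labels]
      rw [hasLabel_level_iff, hasLabel_level_iff, hlen, hn] at h1
      simpa [hs, hfs] using h1.symm
    refine val_ext (hlen s) fun i hi => ?_
    rw [hlen, hn] at hi
    rcases Nat.lt_succ_iff_lt_or_eq.1 hi with hi | rfl
    · rw [← val_dropLast (by rw [hlen]; omega), hpar, val_dropLast (by omega)]
    · exact le_antisymm ((hlast _).1 le_rfl) ((hlast _).2 le_rfl)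

/-- The labels determine the point of the Cantor space. -/
theorem labels_injective {a b : ℕ → Bool} (h : ∀ s, labels g a s = labels g b s) : a = b := by
  funext n
  have h1 : ∀ c : ℕ → Bool,
      HasLabel g c (List.replicate (n + 1) 0) (.inr (.inr ())) ↔ c n = true := by
    intro c
    rw [hasLabel_mark_iff]
    simp only [val_replicate, forall_const, true_and, List.length_replicate, Nat.add_sub_cancel]
    simp
  have h2 := h1 a
  rw [← encode_mem_labels, h, encode_mem_labels, h1] at h2
  exact (Bool.eq_iff_iff.2 h2).symm

theorem measurableSet_hasLabel (s : List ℕ) (l : ℕ ⊕ (ℕ × ℕ) ⊕ Unit) :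
    MeasurableSet {a : ℕ → Bool | HasLabel g a s l} := by
  have hagree : ∀ (n : ℕ) (b : ℕ → Bool), MeasurableSet {a | Agree n b a} := by
    intro n b
    have : {a : ℕ → Bool | Agree n b a} = ⋂ i ∈ Set.Iio n, {a | b i = a i} := by
      ext a
      simp [Agree]
    rw [this]
    exact .biInter (Set.to_countable _) fun i _ =>
      measurableSet_eq_fun measurable_const (measurable_pi_apply i)
  rcases l with k | ⟨n, k⟩ | ⟨⟩
  · have : {a : ℕ → Bool | HasLabel g a s (.inl k)} = ⋃ m : ℕ,
        {a | Agree s.length (Nat.testBit m) a ∧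
          Approx g s.length (val s) (Nat.testBit k) (Nat.testBit m)} := by
      ext a
      simp only [Set.mem_ofPred_eq, Set.mem_iUnion, hasLabel_approx_iff]
      constructor
      · intro h
        obtain ⟨m, hm⟩ := exists_agree_testBit s.length a
        exact ⟨m, hm, h.congr (.refl _ _) hm.symm⟩
      · rintro ⟨m, hm, h⟩
        exact h.congr (.refl _ _) hm
    rw [this]
    exact .iUnion fun m => (hagree _ _).inter (.const _)
  · simp only [hasLabel_level_iff]
    exact .const _
  · show MeasurableSet {a | HasLabel g a s (.inr (.inr ()))}
    simp only [hasLabel_mark_iff]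
    have h1 : MeasurableSet {a : ℕ → Bool | a (s.length - 1) = true} :=
      measurableSet_eq_fun (measurable_pi_apply _) measurable_const
    by_cases h0 : val s 0 = 0
    · simp only [h0, forall_const]
      exact (MeasurableSet.const _).inter ((MeasurableSet.const _).inter h1)
    · simp only [h0, false_imp_iff]
      exact .const _

theorem measurableSet_mem_labels (s : List ℕ) (i : ℕ) :
    MeasurableSet {a : ℕ → Bool | i ∈ labels g a s} := by
  have : {a : ℕ → Bool | i ∈ labels g a s} =
      ⋃ l : ℕ ⊕ (ℕ × ℕ) ⊕ Unit, {a | HasLabel g a s l ∧ Encodable.encode l = i} := by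
    ext a
    simp [labels]
  rw [this]
  exact .iUnion fun l => (measurableSet_hasLabel s l).inter (.const _)

/-! ### Coding a rigid family of countable fields by points of the space of fields -/

namespace FieldSpace

variable {p : ℕ}

theorem isFieldOfChar_of_equiv {F : Type} [Field F] [CharP F p] (e : ℕ ≃ F) :
    IsFieldOfChar p (fun m n => e.symm (e m + e n), fun m n => e.symm (e m * e n)) := by
  let x : Ops := (fun m n => e.symm (e m + e n), fun m n => e.symm (e m * e n))
  let e' : x.Carrier ≃ F := e
  let i : Field x.Carrier := e'.field
  refine ⟨i, fun _ _ => rfl, fun _ _ => rfl, ?_⟩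
  exact RingHom.charP (e'.ringEquiv : x.Carrier →+* F) e'.ringEquiv.injective p

/-- The point of the space of fields obtained by transporting a field structure along an
enumeration. -/
def ofEquiv {F : Type} [Field F] [CharP F p] (e : ℕ ≃ F) : FieldSpace p :=
  ⟨(fun m n => e.symm (e m + e n), fun m n => e.symm (e m * e n)), isFieldOfChar_of_equiv e⟩

/-- The enumeration as an isomorphism. -/
def ofEquivRingEquiv {F : Type} [Field F] [CharP F p] (e : ℕ ≃ F) :
    (ofEquiv (p := p) e).Carrier ≃+* F :=
  { (e : (ofEquiv (p := p) e).Carrier ≃ F) with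
    map_mul' := fun a b => by
      show e (a * b : (ofEquiv (p := p) e).Carrier) = e a * e b
      rw [mul_def]
      exact e.apply_symm_apply _
    map_add' := fun a b => by
      show e (a + b : (ofEquiv (p := p) e).Carrier) = e a + e b
      rw [add_def]
      exact e.apply_symm_apply _ }

theorem ofEquiv_eq {x : FieldSpace p} {F : Type} [Field F] [CharP F p] (φ : x.Carrier ≃+* F) :
    ofEquiv (φ.toEquiv : ℕ ≃ F) = x := by
  have hadd : ∀ a b : x.Carrier, φ.symm (φ a + φ b) = x.1.add a b := fun a b => by
    rw [← map_add, φ.symm_apply_apply, add_def]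
  have hmul : ∀ a b : x.Carrier, φ.symm (φ a * φ b) = x.1.mul a b := fun a b => by
    rw [← map_mul, φ.symm_apply_apply, mul_def]
  exact Subtype.ext (Prod.ext (funext₂ hadd) (funext₂ hmul))

end FieldSpace

/-- A Borel family of infinite subfields of a countable field that are pairwise non-isomorphic and
contain distinguished elements `s v` whose signs can be changed arbitrarily by automorphisms, such
that there are no other automorphisms. -/
structure IsRigidFamily {Y : Type w} [MeasurableSpace Y] {Ω V : Type} [Field Ω]
    (K : Y → Subfield Ω) (s : V → Ω) : Prop where
  measurable : ∀ a, Measurable fun y => a ∈ K y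
  infinite : ∀ y, (K y : Set Ω).Infinite
  mem : ∀ y v, s v ∈ K y
  ne_neg : ∀ v, s v ≠ -s v
  eq_of_equiv : ∀ y y', Nonempty (K y ≃+* K y') → y = y'
  map_eq : ∀ y (ψ : K y ≃+* K y) v,
    (ψ ⟨s v, mem y v⟩ : Ω) = s v ∨ (ψ ⟨s v, mem y v⟩ : Ω) = -s v
  eq_self : ∀ y (ψ : K y ≃+* K y), (∀ v, (ψ ⟨s v, mem y v⟩ : Ω) = s v) → ∀ a, ψ a = a
  signs : ∀ y (S : Set V), ∃ θ : K y ≃+* K y, (∀ v ∈ S, (θ ⟨s v, mem y v⟩ : Ω) = -s v) ∧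
    ∀ v ∉ S, (θ ⟨s v, mem y v⟩ : Ω) = s v

namespace IsRigidFamily

variable {Y : Type w} [MeasurableSpace Y] {Ω V : Type} [Field Ω] {K : Y → Subfield Ω} {s : V → Ω}

theorem map_neg_eq (h : IsRigidFamily K s) {y y' : Y} (ψ : K y →+* K y') (v : V) :
    (ψ ⟨-s v, neg_mem (h.mem y v)⟩ : Ω) = -(ψ ⟨s v, h.mem y v⟩ : Ω) :=
  congrArg Subtype.val (map_neg ψ ⟨s v, h.mem y v⟩)

/-- The signs of the distinguished elements can be chosen freely. -/
theorem change_signs (h : IsRigidFamily K s) {s' : V → Ω} (hs : ∀ v, s' v = s v ∨ s' v = -s v) :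
    IsRigidFamily K s' := by
  have hmem : ∀ y v, s' v ∈ K y := fun y v => by
    rcases hs v with h1 | h1
    · rw [h1]; exact h.mem y v
    · rw [h1]; exact neg_mem (h.mem y v)
  have h1 : ∀ y (ψ : K y ≃+* K y) v, s' v = s v →
      (ψ ⟨s' v, hmem y v⟩ : Ω) = ψ ⟨s v, h.mem y v⟩ := by
    intro y ψ v hv
    congr 2
    exact Subtype.ext hv
  have h2 : ∀ y (ψ : K y ≃+* K y) v, s' v = -s v →
      (ψ ⟨s' v, hmem y v⟩ : Ω) = -(ψ ⟨s v, h.mem y v⟩ : Ω) := by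
    intro y ψ v hv
    have h3 : (⟨s' v, hmem y v⟩ : K y) = ⟨-s v, neg_mem (h.mem y v)⟩ := Subtype.ext hv
    exact (congrArg (fun a => (ψ a : Ω)) h3).trans (h.map_neg_eq (ψ : K y →+* K y) v)
  refine ⟨h.measurable, h.infinite, hmem, fun v => ?_, h.eq_of_equiv, fun y ψ v => ?_,
    fun y ψ hψ => ?_, fun y S => ?_⟩
  · rcases hs v with hv | hv
    · rw [hv]; exact h.ne_neg v
    · rw [hv, neg_neg]; exact (h.ne_neg v).symm
  · rcases hs v with hv | hv
    · rw [h1 y ψ v hv, hv]; exact h.map_eq y ψ v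
    · rw [h2 y ψ v hv, hv]
      rcases h.map_eq y ψ v with h3 | h3
      · exact Or.inl (by rw [h3])
      · exact Or.inr (by rw [h3])
  · refine h.eq_self y ψ fun v => ?_
    have := hψ v
    rcases hs v with hv | hv
    · rwa [h1 y ψ v hv, hv] at this
    · rw [h2 y ψ v hv, hv] at this
      exact neg_injective this
  · obtain ⟨θ, h3, h4⟩ := h.signs y S
    refine ⟨θ, fun v hvS => ?_, fun v hvS => ?_⟩
    · rcases hs v with hv | hv
      · rw [h1 y θ v hv, hv]; exact h3 v hvS
      · rw [h2 y θ v hv, hv, h3 v hvS]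
    · rcases hs v with hv | hv
      · rw [h1 y θ v hv, hv]; exact h4 v hvS
      · rw [h2 y θ v hv, hv, h4 v hvS]

/-- The pairs of a parameter and an enumeration of the corresponding field in which `s v` precedes
`- s v`. -/
def normalized (K : Y → Subfield Ω) (s : V → Ω) : Set (Y × (ℕ → Ω)) :=
  {z | Function.Injective z.2 ∧ (∀ a, a ∈ K z.1 ↔ ∃ n, z.2 n = a) ∧
    ∀ v, ∃ m n, m < n ∧ z.2 m = s v ∧ z.2 n = -s v}

/-- The enumeration given by a normalized pair. -/
noncomputable def enum (z : normalized K s) : ℕ ≃ K z.1.1 :=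
  Equiv.ofBijective (fun n => ⟨z.1.2 n, (z.2.2.1 _).2 ⟨n, rfl⟩⟩)
    ⟨fun _ _ h => z.2.1 (congrArg Subtype.val h), fun a => by
      obtain ⟨n, hn⟩ := (z.2.2.1 a).1 a.2
      exact ⟨n, Subtype.ext hn⟩⟩

variable {p : ℕ}

instance charP_subfield [CharP Ω p] (L : Subfield Ω) : CharP L p :=
  RingHom.charP L.subtype L.subtype.injective p

/-- The coded field of a normalized pair. -/
noncomputable def code (p : ℕ) [CharP Ω p] (z : normalized K s) : FieldSpace p :=
  FieldSpace.ofEquiv (enum z)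

omit [MeasurableSpace Y] in
/-- The coded field is isomorphic to the field of the family, by the enumeration. -/
theorem exists_equiv_of_code_eq [CharP Ω p] {z : normalized K s} {x : FieldSpace p}
    (h : code p z = x) : ∃ φ : x.Carrier ≃+* K z.1.1, ∀ n : ℕ, (φ n : Ω) = z.1.2 n := by
  subst h
  exact ⟨FieldSpace.ofEquivRingEquiv (enum z), fun _ => rfl⟩

/-- A normalized pair can be recovered from its code: the parameter since the fields are pairwise
not isomorphic, and the enumeration since an automorphism that respects the order of `s v` and `- s
v` is trivial. -/
theorem code_injective [CharP Ω p] (h : IsRigidFamily K s) :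
    Function.Injective (code p : normalized K s → FieldSpace p) := by
  intro z z' hzz
  obtain ⟨φ, hφ⟩ := exists_equiv_of_code_eq hzz
  obtain ⟨φ', hφ'⟩ := exists_equiv_of_code_eq (rfl : code p z' = _)
  obtain ⟨⟨y, j⟩, hz⟩ := z
  obtain ⟨⟨y', j'⟩, hz'⟩ := z'
  obtain rfl := h.eq_of_equiv y y' ⟨φ.symm.trans φ'⟩
  set ψ := φ.symm.trans φ' with hψ
  have hψj : ∀ (n : ℕ) (hn : j n ∈ K y), (ψ ⟨j n, hn⟩ : Ω) = j' n := by
    intro n hn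
    have h1 : φ n = ⟨j n, hn⟩ := Subtype.ext (hφ n)
    rw [← h1]
    exact (congrArg (fun a => (φ' a : Ω)) (φ.symm_apply_apply _)).trans (hφ' n)
  have hfix : ∀ v, (ψ ⟨s v, h.mem y v⟩ : Ω) = s v := by
    intro v
    refine (h.map_eq y ψ v).resolve_right fun hneg => ?_
    obtain ⟨m, n, hmn, hm, hn⟩ := hz.2.2 v
    obtain ⟨m', n', hmn', hm', hn'⟩ := hz'.2.2 v
    simp only at hm hn hm' hn'
    have h1 : j' m = -s v := by
      rw [← hneg, ← hψj m (hm ▸ h.mem y v)]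
      congr 2
      exact Subtype.ext hm
    have h2 : j' n = s v := by
      have hn' : j n ∈ K y := (hz.2.1 _).2 ⟨n, rfl⟩
      have h3 : (⟨j n, hn'⟩ : K y) = ⟨-s v, neg_mem (h.mem y v)⟩ := Subtype.ext hn
      calc j' n = (ψ ⟨j n, hn'⟩ : Ω) := (hψj n hn').symm
        _ = (ψ ⟨-s v, neg_mem (h.mem y v)⟩ : Ω) := congrArg (fun a => (ψ a : Ω)) h3
        _ = -(ψ ⟨s v, h.mem y v⟩ : Ω) := h.map_neg_eq (ψ : K y →+* K y) v
        _ = s v := by rw [hneg, neg_neg]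
    have h3 : m' = n := hz'.1 (hm'.trans h2.symm)
    have h4 : n' = m := hz'.1 (hn'.trans h1.symm)
    omega
  have hid := h.eq_self y ψ hfix
  have : j = j' := by
    funext n
    have hn : j n ∈ K y := (hz.2.1 _).2 ⟨n, rfl⟩
    rw [← hψj n hn, hid]
  subst this
  rfl

/-- Every field isomorphic to a member of the family is coded. -/
theorem mem_range_code [CharP Ω p] (h : IsRigidFamily K s) {x : FieldSpace p} {y : Y}
    (φ : x.Carrier ≃+* K y) : ∃ z : normalized K s, code p z = x ∧ z.1.1 = y := by
  -- choose the signs so that `s v` comes before `- s v`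
  have hneg : ∀ v, -s v ∈ K y := fun v => neg_mem (h.mem y v)
  let idx : K y → ℕ := φ.symm
  obtain ⟨θ, h1, h2⟩ := h.signs y {v | idx ⟨-s v, hneg v⟩ < idx ⟨s v, h.mem y v⟩}
  let φ' : x.Carrier ≃+* K y := φ.trans θ
  have hmem : (y, fun n : ℕ => (φ' n : Ω)) ∈ normalized K s := by
    refine ⟨fun m n hmn => φ'.injective (Subtype.ext hmn), fun a => ⟨fun ha => ?_, ?_⟩, fun v => ?_⟩
    · exact ⟨φ'.symm ⟨a, ha⟩, by simp⟩
    · rintro ⟨n, rfl⟩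
      exact Subtype.property _
    · have hidx : ∀ b : K y, φ (idx b : ℕ) = b := fun b => φ.apply_symm_apply b
      by_cases hv : idx ⟨-s v, hneg v⟩ < idx ⟨s v, h.mem y v⟩
      · refine ⟨_, _, hv, ?_, ?_⟩
        · show (θ (φ _) : Ω) = _
          rw [hidx]
          refine (h.map_neg_eq (θ : K y →+* K y) v).trans ?_
          exact (congrArg Neg.neg (h1 v hv)).trans (neg_neg _)
        · show (θ (φ _) : Ω) = _
          rw [hidx]
          exact h1 v hv
      · have hne : idx ⟨s v, h.mem y v⟩ ≠ idx ⟨-s v, hneg v⟩ := fun h3 =>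
          h.ne_neg v (congrArg Subtype.val (φ.symm.injective h3))
        refine ⟨idx ⟨s v, h.mem y v⟩, idx ⟨-s v, hneg v⟩, by omega, ?_, ?_⟩
        · show (θ (φ _) : Ω) = _
          rw [hidx]
          exact h2 v hv
        · show (θ (φ _) : Ω) = _
          rw [hidx]
          exact (h.map_neg_eq (θ : K y →+* K y) v).trans (congrArg Neg.neg (h2 v hv))
  refine ⟨⟨_, hmem⟩, ?_, rfl⟩
  have : enum ⟨_, hmem⟩ = (φ'.toEquiv : ℕ ≃ K y) := Equiv.ext fun n => rfl
  rw [code, this]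
  exact FieldSpace.ofEquiv_eq φ'

section Measurability

variable [MeasurableSpace Ω] [DiscreteMeasurableSpace Ω] [Countable Ω] [Countable V]

theorem measurableSet_normalized (h : IsRigidFamily K s) : MeasurableSet (normalized K s) := by
  have h2 : ∀ n, Measurable fun z : Y × (ℕ → Ω) => z.2 n := fun n =>
    (measurable_pi_apply n).comp measurable_snd
  have h3 : ∀ (n : ℕ) (a : Ω), Measurable fun z : Y × (ℕ → Ω) => z.2 n = a := fun n a =>
    (h2 n).eq_const a
  have h4 : ∀ m n, Measurable fun z : Y × (ℕ → Ω) => z.2 m = z.2 n := fun m n =>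
    measurableSet_setOfPred.1 (measurableSet_eq_fun (h2 m) (h2 n))
  have h5 : ∀ a, Measurable fun z : Y × (ℕ → Ω) => a ∈ K z.1 := fun a =>
    (h.measurable a).comp measurable_fst
  refine measurableSet_setOfPred.2 (.and ?_ (.and ?_ ?_))
  · exact .forall fun m => .forall fun n => (h4 m n).imp measurable_const
  · exact .forall fun a => (h5 a).iff (.exists fun n => h3 n a)
  · exact .forall fun v => .exists fun m => .exists fun n =>
      measurable_const.and ((h3 m _).and (h3 n _))

omit [Countable V] in
/-- The operations on `ℕ` are computed from the enumeration in a Borel way. -/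
theorem measurable_code [CharP Ω p] : Measurable (code p : normalized K s → FieldSpace p) := by
  have h2 : ∀ n, Measurable fun z : normalized K s => z.1.2 n := fun n =>
    (measurable_pi_apply n).comp (measurable_snd.comp measurable_subtype_coe)
  have key : ∀ F : Ω × Ω → Ω, ∀ m n, ∀ f : normalized K s → ℕ,
      (∀ z : normalized K s, z.1.2 (f z) = F (z.1.2 m, z.1.2 n)) → Measurable f := by
    intro F m n f hf
    refine measurable_to_countable' fun k => ?_
    have : f ⁻¹' {k} = {z : normalized K s | z.1.2 k = F (z.1.2 m, z.1.2 n)} := by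
      ext z
      constructor
      · rintro rfl
        exact hf z
      · intro hk
        exact z.2.1 ((hf z).trans hk.symm)
    rw [this]
    exact measurableSet_eq_fun (h2 k) (Measurable.of_discrete.comp ((h2 m).prodMk (h2 n)))
  have henum : ∀ z : normalized K s, ∀ a : K z.1.1, z.1.2 ((enum z).symm a) = a := fun z a =>
    congrArg Subtype.val ((enum z).apply_symm_apply a)
  refine Measurable.subtype_mk (Measurable.prodMk ?_ ?_)
  · refine measurable_pi_lambda _ fun m => measurable_pi_lambda _ fun n => ?_
    exact key (fun q => q.1 + q.2) m n _ fun z => henum z _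
  · refine measurable_pi_lambda _ fun m => measurable_pi_lambda _ fun n => ?_
    exact key (fun q => q.1 * q.2) m n _ fun z => henum z _

omit [DiscreteMeasurableSpace Ω] [Countable Ω] [Countable V] in
/-- Enumerations of the fields of the family, normalized with respect to `s`, can be chosen in a
Borel way, if `s v` precedes `- s v` in an enumeration of the ambient field. -/
theorem exists_measurable_enumeration (h : IsRigidFamily K s) (d : ℕ ≃ Ω)
    (hd : ∀ v, d.symm (s v) < d.symm (-s v)) :
    ∃ J : Y → ℕ → Ω, Measurable J ∧ ∀ y, (y, J y) ∈ normalized K s := by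
  classical
  have hinf : ∀ y, {n | d n ∈ K y}.Infinite := fun y =>
    (h.infinite y).preimage (by rw [d.surjective.range_eq]; exact Set.subset_univ _)
  have hnth : ∀ y n, d n ∈ K y →
      Nat.nth (fun n => d n ∈ K y) (Nat.count (fun n => d n ∈ K y) n) = n :=
    fun y n hn => Nat.nth_count (p := fun n => d n ∈ K y) hn
  have hcount : ∀ n, Measurable fun y => Nat.count (fun n => d n ∈ K y) n := by
    intro n
    induction n with
    | zero => simp only [Nat.count_zero]; exact measurable_const
    | succ n ih =>
      simp only [Nat.count_succ]
      exact ih.add (Measurable.ite (measurableSet_setOfPred.2 (h.measurable _)) measurable_const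
        measurable_const)
  refine ⟨fun y k => d (Nat.nth (fun n => d n ∈ K y) k), ?_,
    fun y => ⟨?_, fun a => ⟨fun ha => ?_, ?_⟩, fun v => ?_⟩⟩
  · refine measurable_pi_lambda _ fun k => Measurable.of_discrete.comp ?_
    refine measurable_to_countable' fun m => ?_
    have : (fun y => Nat.nth (fun n => d n ∈ K y) k) ⁻¹' {m} =
        {y | d m ∈ K y ∧ Nat.count (fun n => d n ∈ K y) m = k} := by
      ext y
      constructor
      · rintro rfl
        exact ⟨Nat.nth_mem_of_infinite (hinf y) k, Nat.count_nth_of_infinite (hinf y) k⟩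
      · rintro ⟨h1, rfl⟩
        exact hnth y m h1
    rw [this]
    exact measurableSet_setOfPred.2 ((h.measurable _).and ((hcount m).eq_const k))
  · exact d.injective.comp (Nat.nth_injective (hinf y))
  · refine ⟨Nat.count (fun n => d n ∈ K y) (d.symm a), ?_⟩
    show d (Nat.nth _ _) = a
    rw [hnth y _ (by simpa using ha), d.apply_symm_apply]
  · rintro ⟨n, rfl⟩
    exact Nat.nth_mem_of_infinite (hinf y) n
  · have h1 : d (d.symm (s v)) ∈ K y := by simpa using h.mem y v
    have h2 : d (d.symm (-s v)) ∈ K y := by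
      rw [d.apply_symm_apply]
      exact neg_mem (h.mem y v)
    refine ⟨_, _, Nat.count_strict_mono (p := fun n => d n ∈ K y) h1 (hd v), ?_, ?_⟩
    · show d (Nat.nth _ _) = _
      rw [hnth y _ h1, d.apply_symm_apply]
    · show d (Nat.nth _ _) = _
      rw [hnth y _ h2, d.apply_symm_apply]

/-- A rigid family of fields is coded by an invariant Borel set of points of the space of fields;
the parameter can be recovered from the code in a Borel way, by the theorem of Lusin and Souslin. -/
theorem exists_borel_coding [StandardBorelSpace Y] [CharP Ω p] [Infinite Ω]
    (h : IsRigidFamily K s) : ∃ B : Set (FieldSpace p), MeasurableSet B ∧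
      (∀ x x' : FieldSpace p, x.Iso x' → x ∈ B → x' ∈ B) ∧
      ∃ (f : Y → B) (r : B → Y), Measurable f ∧ Measurable r ∧
        (∀ y, Nonempty ((f y).1.Carrier ≃+* K y)) ∧
        ∀ x : B, Nonempty (x.1.Carrier ≃+* K (r x)) := by
  obtain ⟨⟨d⟩⟩ : Nonempty (Nonempty (ℕ ≃ Ω)) := ⟨nonempty_equiv_of_countable⟩
  -- arrange that `s v` precedes `- s v` in the enumeration `d`
  wlog hd : ∀ v, d.symm (s v) < d.symm (-s v) generalizing s
  · let s' : V → Ω := fun v => if d.symm (s v) < d.symm (-s v) then s v else -s v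
    have hs' : ∀ v, s' v = s v ∨ s' v = -s v := fun v => by
      by_cases hv : d.symm (s v) < d.symm (-s v)
      · exact Or.inl (if_pos hv)
      · exact Or.inr (if_neg hv)
    refine this (h.change_signs hs') fun v => ?_
    by_cases hv : d.symm (s v) < d.symm (-s v)
    · have : s' v = s v := if_pos hv
      rwa [this]
    · have h1 : s' v = -s v := if_neg hv
      have h2 : d.symm (s v) ≠ d.symm (-s v) := fun h3 => h.ne_neg v (d.symm.injective h3)
      rw [h1, neg_neg]
      omega
  have : StandardBorelSpace (normalized K s) := h.measurableSet_normalized.standardBorel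
  have hemb : MeasurableEmbedding (code p : normalized K s → FieldSpace p) :=
    measurable_code.measurableEmbedding h.code_injective
  obtain ⟨J, hJ, hJn⟩ := h.exists_measurable_enumeration d hd
  refine ⟨Set.range (code p : normalized K s → FieldSpace p), hemb.measurableSet_range, ?_,
    fun y => ⟨code p ⟨(y, J y), hJn y⟩, ⟨_, rfl⟩⟩, fun x => (hemb.equivRange.symm x).1.1, ?_, ?_,
    fun y => ?_, fun x => ?_⟩
  · rintro x x' ⟨φ⟩ ⟨z, hz⟩
    obtain ⟨φ', -⟩ := exists_equiv_of_code_eq hz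
    obtain ⟨z', hz', -⟩ := h.mem_range_code (φ.symm.trans φ')
    exact ⟨z', hz'⟩
  · exact (measurable_code.comp ((measurable_id.prodMk hJ).subtype_mk)).subtype_mk
  · exact measurable_fst.comp (measurable_subtype_coe.comp hemb.equivRange.symm.measurable)
  · obtain ⟨φ, -⟩ := exists_equiv_of_code_eq (rfl : code p ⟨(y, J y), hJn y⟩ = _)
    exact ⟨φ⟩
  · have h1 : code p (hemb.equivRange.symm x) = x.1 := by
      have h2 := hemb.equivRange.apply_symm_apply x
      rw [hemb.equivRange_apply] at h2
      exact congrArg Subtype.val h2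
    obtain ⟨φ, -⟩ := exists_equiv_of_code_eq h1
    exact ⟨φ⟩

end Measurability

end IsRigidFamily

/-! ### Analyticity of embeddability and isomorphism -/

namespace FieldSpace

variable {p : ℕ}

theorem embeds_iff (x y : FieldSpace p) : x.Embeds y ↔ ∃ h : ℕ → ℕ,
    Function.Injective h ∧ (∀ m n, h (x.1.1 m n) = y.1.1 (h m) (h n)) ∧
      ∀ m n, h (x.1.2 m n) = y.1.2 (h m) (h n) := by
  constructor
  · rintro ⟨φ⟩
    refine ⟨φ, φ.injective, fun m n => ?_, fun m n => ?_⟩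
    · exact (congrArg φ (add_def x m n).symm).trans ((map_add φ _ _).trans (add_def y _ _))
    · exact (congrArg φ (mul_def x m n).symm).trans ((map_mul φ _ _).trans (mul_def y _ _))
  · rintro ⟨h, hinj, hadd, hmul⟩
    let φ : x.Carrier → y.Carrier := h
    have hadd' : ∀ a b, φ (a + b) = φ a + φ b := fun a b => by
      rw [add_def, add_def]
      exact hadd a b
    have hmul' : ∀ a b, φ (a * b) = φ a * φ b := fun a b => by
      rw [mul_def, mul_def]
      exact hmul a b
    have h0 : φ 0 = 0 := by
      have := hadd' 0 0
      rwa [add_zero, left_eq_add] at this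
    have h1 : φ 1 = 1 := by
      have h2 := hmul' 1 1
      rw [mul_one] at h2
      have hinj' : Function.Injective φ := hinj
      have h3 : φ 1 ≠ 0 := fun h3 => one_ne_zero (hinj' (h3.trans h0.symm))
      exact (mul_left_cancel₀ h3 (by rw [mul_one, ← h2])).symm
    exact ⟨⟨⟨⟨φ, h1⟩, hmul'⟩, h0, hadd'⟩⟩

theorem iso_iff (x y : FieldSpace p) : x.Iso y ↔ ∃ h : ℕ → ℕ,
    (∀ k, ∃ m, h m = k) ∧ Function.Injective h ∧ (∀ m n, h (x.1.1 m n) = y.1.1 (h m) (h n)) ∧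
      ∀ m n, h (x.1.2 m n) = y.1.2 (h m) (h n) := by
  constructor
  · rintro ⟨φ⟩
    refine ⟨φ, φ.surjective, φ.injective, fun m n => ?_, fun m n => ?_⟩
    · exact (congrArg φ (add_def x m n).symm).trans ((map_add φ _ _).trans (add_def y _ _))
    · exact (congrArg φ (mul_def x m n).symm).trans ((map_mul φ _ _).trans (mul_def y _ _))
  · rintro ⟨h, hsurj, hinj, hadd, hmul⟩
    let φ : x.Carrier → y.Carrier := h
    exact ⟨{ Equiv.ofBijective φ ⟨hinj, hsurj⟩ with
      map_mul' := fun a b => by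
        show φ (a * b) = φ a * φ b
        rw [mul_def, mul_def]
        exact hmul a b
      map_add' := fun a b => by
        show φ (a + b) = φ a + φ b
        rw [add_def, add_def]
        exact hadd a b }⟩

theorem measurable_isEmbedding : Measurable fun z : (FieldSpace p × FieldSpace p) × (ℕ → ℕ) =>
    Function.Injective z.2 ∧ (∀ m n, z.2 (z.1.1.1.1 m n) = z.1.2.1.1 (z.2 m) (z.2 n)) ∧
      ∀ m n, z.2 (z.1.1.1.2 m n) = z.1.2.1.2 (z.2 m) (z.2 n) := by
  have hv : Measurable (Subtype.val : FieldSpace p → Ops) := measurable_subtype_coe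
  have h1 : Measurable fun z : (FieldSpace p × FieldSpace p) × (ℕ → ℕ) => z.1.1.1 :=
    hv.comp (measurable_fst.comp measurable_fst)
  have h2 : Measurable fun z : (FieldSpace p × FieldSpace p) × (ℕ → ℕ) => z.1.2.1 :=
    hv.comp (measurable_snd.comp measurable_fst)
  have h3 : ∀ n, Measurable fun z : (FieldSpace p × FieldSpace p) × (ℕ → ℕ) => z.2 n := fun n =>
    (measurable_pi_apply n).comp measurable_snd
  have heq : ∀ {f g : (FieldSpace p × FieldSpace p) × (ℕ → ℕ) → ℕ}, Measurable f → Measurable g →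
      Measurable fun z => f z = g z := fun hf hg =>
    measurableSet_setOfPred.1 (measurableSet_eq_fun hf hg)
  refine .and ?_ (.and ?_ ?_)
  · exact .forall fun m => .forall fun n => (heq (h3 m) (h3 n)).imp measurable_const
  · refine .forall fun m => .forall fun n => heq ?_ ?_
    · exact measurable_apply measurable_snd
        (measurable_apply (measurable_apply (measurable_fst.comp h1) measurable_const)
          measurable_const)
    · exact measurable_apply (measurable_apply (measurable_fst.comp h2) (h3 m)) (h3 n)
  · refine .forall fun m => .forall fun n => heq ?_ ?_
    · exact measurable_apply measurable_snd
        (measurable_apply (measurable_apply (measurable_snd.comp h1) measurable_const)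
          measurable_const)
    · exact measurable_apply (measurable_apply (measurable_snd.comp h2) (h3 m)) (h3 n)

theorem isAnalyticRel_embeds : IsAnalyticRel (Embeds (p := p)) :=
  ⟨ℕ → ℕ, inferInstance, inferInstance, _, measurableSet_setOfPred.2 measurable_isEmbedding,
    Set.ext fun q => embeds_iff q.1 q.2⟩

theorem isAnalyticRel_iso : IsAnalyticRel (Iso (p := p)) := by
  have h1 : Measurable fun z : (FieldSpace p × FieldSpace p) × (ℕ → ℕ) => ∀ k, ∃ m, z.2 m = k :=
    .forall fun k => .exists fun m =>
      Measurable.eq_const (f := fun z : (FieldSpace p × FieldSpace p) × (ℕ → ℕ) => z.2 m)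
        ((measurable_pi_apply m).comp measurable_snd) k
  exact ⟨ℕ → ℕ, inferInstance, inferInstance, _,
    measurableSet_setOfPred.2 (h1.and measurable_isEmbedding), Set.ext fun q => iso_iff q.1 q.2⟩

end FieldSpace

open MeasureTheory

/-! ### Reduction to analytic quasi-orders on the Cantor space -/

/-- An analytic quasi-order is the restriction, along a Borel injection, of a quasi-order on the
Cantor space that is a continuous image of the Baire space. -/
theorem exists_cantor_quasiOrder {Y : Type w} [MeasurableSpace Y] [StandardBorelSpace Y]
    {R : Y → Y → Prop} (hR : IsAnalyticQuasiOrder R) :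
    ∃ (ι : Y → ℕ → Bool) (R' : (ℕ → Bool) → (ℕ → Bool) → Prop)
      (g : (ℕ → ℕ) → (ℕ → Bool) × (ℕ → Bool)), Measurable ι ∧ Function.Injective ι ∧
      (∀ x y, R' (ι x) (ι y) ↔ R x y) ∧ (∀ a, R' a a) ∧ (∀ a b c, R' a b → R' b c → R' a c) ∧
      Continuous g ∧ ∀ a b, R' a b ↔ ∃ z, g z = (a, b) := by
  obtain ⟨ι, hι, hinj⟩ := MeasurableSpace.measurable_injection_nat_bool_of_countablySeparated Y
  obtain ⟨Z, _, _, C, hC, hRC⟩ := hR.analytic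
  have hRC' : ∀ x y, R x y ↔ ∃ z, ((x, y), z) ∈ C := fun x y => Set.ext_iff.1 hRC (x, y)
  let R' : (ℕ → Bool) → (ℕ → Bool) → Prop := fun a b =>
    a = b ∨ ∃ x y, a = ι x ∧ b = ι y ∧ R x y
  have h1 : AnalyticSet {q : (ℕ → Bool) × (ℕ → Bool) | R' q.1 q.2} := by
    have h2 : AnalyticSet (Set.diagonal (ℕ → Bool)) := by
      have h3 := MeasurableSet.univ.analyticSet_image (f := (Function.diag : (ℕ → Bool) → _))
        (measurable_id.prodMk measurable_id)
      rwa [Set.image_univ, Set.range_diag] at h3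
    have h3 : AnalyticSet ((fun w : (Y × Y) × Z => (ι w.1.1, ι w.1.2)) '' C) :=
      hC.analyticSet_image ((hι.comp (measurable_fst.comp measurable_fst)).prodMk
        (hι.comp (measurable_snd.comp measurable_fst)))
    have h4 := AnalyticSet.iUnion (s := fun b : Bool => if b then Set.diagonal (ℕ → Bool) else
      ((fun w : (Y × Y) × Z => (ι w.1.1, ι w.1.2)) '' C)) (by
        intro b
        cases b
        · exact h3
        · exact h2)
    convert h4
    ext ⟨a, b⟩
    simp only [R', Set.mem_ofPred_eq, Set.mem_iUnion, Bool.exists_bool, Bool.false_eq_true,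
      if_false, if_true, Set.mem_image, Set.mem_diagonal_iff, Prod.mk.injEq]
    rw [or_comm]
    refine or_congr ⟨?_, ?_⟩ Iff.rfl
    · rintro ⟨x, y, rfl, rfl, h⟩
      obtain ⟨z, hz⟩ := (hRC' x y).1 h
      exact ⟨((x, y), z), hz, rfl, rfl⟩
    · rintro ⟨⟨⟨x, y⟩, z⟩, hz, rfl, rfl⟩
      exact ⟨x, y, rfl, rfl, (hRC' x y).2 ⟨z, hz⟩⟩
  rw [AnalyticSet] at h1
  rcases h1 with h1 | ⟨g, hg, hgR⟩
  · exact absurd (Or.inl rfl : R' (fun _ => true) (fun _ => true))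
      (Set.eq_empty_iff_forall_notMem.1 h1 (fun _ => true, fun _ => true))
  refine ⟨ι, R', g, hι, hinj, fun x y => ⟨?_, fun h => Or.inr ⟨x, y, rfl, rfl, h⟩⟩,
    fun a => Or.inl rfl, ?_, hg, fun a b => ?_⟩
  · rintro (h | ⟨x', y', hx, hy, h⟩)
    · rw [hinj h]
      exact hR.refl y
    · rwa [hinj hx, hinj hy]
  · rintro a b c (rfl | ⟨x, y, rfl, rfl, h⟩) h'
    · exact h'
    · rcases h' with rfl | ⟨y', z, hy, rfl, h'⟩
      · exact Or.inr ⟨x, y, rfl, rfl, h⟩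
      · obtain rfl := hinj hy
        exact Or.inr ⟨x, z, rfl, rfl, hR.trans _ _ _ h h'⟩
  · exact (Set.ext_iff.1 hgR (a, b)).symm

/-! ### Borel dependence of generated subgroups and subfields on the generators -/

/-- The closure of a Borel family of subsets of a countable set under a finitary closure operator is
again a Borel family. -/
theorem measurable_mem_of_finitary {Y : Type w} [MeasurableSpace Y] {X : Type} [Countable X]
    {cl : Set X → Set X} (hmono : Monotone cl)
    (hfin : ∀ T, ∀ a ∈ cl T, ∃ S : Finset X, (S : Set X) ⊆ T ∧ a ∈ cl S) {T : Y → Set X}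
    (hT : ∀ x, Measurable fun y => x ∈ T y) (a : X) : Measurable fun y => a ∈ cl (T y) := by
  have : (fun y => a ∈ cl (T y)) =
      fun y => ∃ S : Finset X, (∀ x : X, x ∈ S → x ∈ T y) ∧ a ∈ cl S := by
    funext y
    refine propext ⟨hfin _ a, ?_⟩
    rintro ⟨S, hS, ha⟩
    exact hmono hS ha
  rw [this]
  exact .exists fun S => (Measurable.forall fun x => measurable_const.imp (hT x)).and
    measurable_const

theorem exists_finset_mem_addSubgroup_closure {A : Type} [AddCommGroup A] {T : Set A} {a : A}
    (h : a ∈ AddSubgroup.closure T) :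
    ∃ S : Finset A, (S : Set A) ⊆ T ∧ a ∈ AddSubgroup.closure (S : Set A) := by
  classical
  induction h using AddSubgroup.closure_induction with
  | mem a h => exact ⟨{a}, by simpa using h, AddSubgroup.subset_closure (by simp)⟩
  | zero => exact ⟨∅, by simp, zero_mem _⟩
  | add a b _ _ iha ihb =>
    obtain ⟨S, hS, ha⟩ := iha
    obtain ⟨S', hS', hb⟩ := ihb
    exact ⟨S ∪ S', by simp [hS, hS'], add_mem (AddSubgroup.closure_mono (by simp) ha)
      (AddSubgroup.closure_mono (by simp) hb)⟩
  | neg a _ iha =>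
    obtain ⟨S, hS, ha⟩ := iha
    exact ⟨S, hS, neg_mem ha⟩

theorem exists_finset_mem_subfield_closure {A : Type} [Field A] {T : Set A} {a : A}
    (h : a ∈ Subfield.closure T) :
    ∃ S : Finset A, (S : Set A) ⊆ T ∧ a ∈ Subfield.closure (S : Set A) := by
  classical
  induction h using Subfield.closure_induction with
  | mem a h => exact ⟨{a}, by simpa using h, Subfield.subset_closure (by simp)⟩
  | one => exact ⟨∅, by simp, one_mem _⟩
  | add a b _ _ iha ihb =>
    obtain ⟨S, hS, ha⟩ := iha
    obtain ⟨S', hS', hb⟩ := ihb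
    exact ⟨S ∪ S', by simp [hS, hS'], add_mem (Subfield.closure_mono (by simp) ha)
      (Subfield.closure_mono (by simp) hb)⟩
  | neg a _ iha =>
    obtain ⟨S, hS, ha⟩ := iha
    exact ⟨S, hS, neg_mem ha⟩
  | inv a _ iha =>
    obtain ⟨S, hS, ha⟩ := iha
    exact ⟨S, hS, inv_mem ha⟩
  | mul a b _ _ iha ihb =>
    obtain ⟨S, hS, ha⟩ := iha
    obtain ⟨S', hS', hb⟩ := ihb
    exact ⟨S ∪ S', by simp [hS, hS'], mul_mem (Subfield.closure_mono (by simp) ha)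
      (Subfield.closure_mono (by simp) hb)⟩

namespace Forest

open BigField

variable {V : Type} [Countable V] {F : Forest V} {P : ℕ} {Y : Type w} [MeasurableSpace Y]
  {Λ : Y → V → Set ℕ}

theorem measurable_mem_exponents (hΛ : ∀ v i, Measurable fun y => i ∈ Λ y v) (γ : V →₀ ℚ) :
    Measurable fun y => γ ∈ F.exponents P (Λ y) := by
  refine measurable_mem_of_finitary (cl := fun T => (AddSubgroup.closure T : Set (V →₀ ℚ)))
    (T := fun y => {γ | F.IsExponent P (Λ y) γ}) (fun _ _ h => AddSubgroup.closure_mono h)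
    (fun _ _ h => exists_finset_mem_addSubgroup_closure h) (fun γ => ?_) γ
  have : (fun y => γ ∈ {γ | F.IsExponent P (Λ y) γ}) = fun y =>
      F.IsExponent P (fun _ => ∅) γ ∨ ∃ v i, i ∈ Λ y v ∧
        γ = Finsupp.single v (largePrime P (2 * i + 1) : ℚ)⁻¹ := by
    funext y
    refine propext ⟨fun h => ?_, ?_⟩
    · cases h with
      | vertex v n => exact Or.inl (.vertex v n)
      | label v i h => exact Or.inr ⟨v, i, h, rfl⟩
      | edge v h => exact Or.inl (.edge v h)
    · rintro (h | ⟨v, i, h, rfl⟩)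
      · cases h with
        | vertex v n => exact .vertex v n
        | label v i h => exact absurd h (Set.notMem_empty _)
        | edge v h => exact .edge v h
      · exact .label v i h
  rw [this]
  exact measurable_const.or (.exists fun v => .exists fun i => (hΛ v i).and measurable_const)

theorem measurable_mem_field {κ : Type} [Field κ] [Countable κ]
    (hΛ : ∀ v i, Measurable fun y => i ∈ Λ y v) (a : BigField κ V) :
    Measurable fun y => a ∈ F.field κ P (Λ y) := by
  refine measurable_mem_of_finitary (cl := fun T => (Subfield.closure T : Set (BigField κ V)))
    (T := fun y => mon '' (F.exponents P (Λ y) : Set (V →₀ ℚ)) ∪ Set.range sqrtVar)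
    (fun _ _ h => Subfield.closure_mono h) (fun _ _ h => exists_finset_mem_subfield_closure h)
    (fun a => ?_) a
  exact Measurable.or (.exists fun γ => (measurable_mem_exponents hΛ γ).and measurable_const)
    measurable_const

end Forest

/-! ### Invariant universality -/

open BigField in
theorem sqrtVar_ne_neg {κ V : Type} [Field κ] {P : ℕ} [ExpChar κ P] (hP : P ≠ 2) (v : V) :
    sqrtVar (κ := κ) v ≠ -sqrtVar v := by
  intro h
  have h1 : (algebraMap κ (BigField κ V) 2) * sqrtVar v = 0 := by
    rw [map_ofNat, two_mul]
    nth_rewrite 1 [h]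
    exact neg_add_cancel _
  rcases mul_eq_zero.1 h1 with h2 | h2
  · exact two_ne_zero_of_expChar P hP ((map_eq_zero _).1 h2)
  · have h3 := sqrtVar_sq (κ := κ) v
    rw [h2, zero_pow two_ne_zero] at h3
    have h4 : IsAlgebraic κ (var (κ := κ) v) := by
      have : var (κ := κ) v = algebraMap κ _ (-1) := by
        rw [map_neg, map_one]
        exact eq_neg_of_add_eq_zero_right h3.symm
      rw [this]
      exact isAlgebraic_algebraMap _
    exact algebraicIndependent_var.transcendental v h4

open BigField Forest in
/-- The fields attached to the labelled trees of an analytic quasi-order form a rigid family. -/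
theorem isRigidFamily_field {κ : Type} [Field κ] [IsAlgClosed κ] {P : ℕ} [ExpChar κ P] [Countable κ]
    (hP : P ≠ 2) (hκ : IsConstantField κ P) (g : (ℕ → ℕ) → (ℕ → Bool) × (ℕ → Bool))
    {Y : Type w} [MeasurableSpace Y] {ι : Y → ℕ → Bool} (hι : Measurable ι)
    (hinj : Function.Injective ι) : IsRigidFamily (Ω := BigField κ (List ℕ))
      (fun y => seqTree.field κ P (labels g (ι y))) sqrtVar := by
  have hlev : ∀ a b v w, labels g a v ⊆ labels g b w → seqTree.lev w = seqTree.lev v :=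
    fun a b v w h => length_eq_of_labels_subset h
  have hequiv : ∀ a b (ψ : seqTree.field κ P (labels g a) ≃+* seqTree.field κ P (labels g b)),
      a = b ∧ ∀ v, ψ (seqTree.x κ P (labels g a) v) = seqTree.x κ P (labels g b) v := by
    intro a b ψ
    obtain ⟨f, h1, -, h2, h3⟩ := exists_map_of_equiv hP hκ (hlev a b) ψ
    have hf := eq_self_of_labels_eq h3 h2
    refine ⟨labels_injective (g := g) fun s => ?_, fun v => ?_⟩
    · rw [h2 s, hf s]
    · rw [h1 v, hf v]
  refine ⟨fun a => ?_, fun y => ?_, fun y v => sqrtVar_mem v, fun v => sqrtVar_ne_neg hP v,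
    fun y y' ⟨ψ⟩ => hinj (hequiv _ _ ψ).1, fun y ψ v => ?_, fun y ψ hψ a => ?_,
    fun y S => exists_signs_equiv hP _ S⟩
  · refine measurable_mem_field (fun s i => ?_) a
    exact (measurableSet_setOfPred.1 (measurableSet_mem_labels s i)).comp hι
  · refine Set.infinite_of_injective_forall_mem (f := fun v => var (κ := κ) v)
      algebraicIndependent_var.injective fun v => mon_mem (single_one_mem v)
  · rcases map_s (φ := (ψ : seqTree.field κ P (labels g (ι y)) →+*
      seqTree.field κ P (labels g (ι y)))) ((hequiv _ _ ψ).2 v) with h | h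
    · exact Or.inl (congrArg Subtype.val h)
    · exact Or.inr (congrArg Subtype.val h)
  · have h1 : (ψ : seqTree.field κ P (labels g (ι y)) →+* seqTree.field κ P (labels g (ι y))) =
        RingHom.id _ :=
      ringHom_ext_of_generators
        (fun γ hγ => map_mon_of_map_x hκ (ψ : _ →+* _) (hequiv _ _ ψ).2 hγ)
        fun v => Subtype.ext (hψ v)
    exact RingHom.congr_fun h1 a

end InvUniv

theorem mainTheorem2 (p : ℕ) (hp : p = 0 ∨ p.Prime) (hp2 : p ≠ 2) :
    InvUniv.InvariantlyUniversal.{0, u}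
      (InvUniv.FieldSpace.Embeds (p := p)) (InvUniv.FieldSpace.Iso (p := p)) := by
  refine ⟨⟨fun x => ⟨RingHom.id _⟩, fun x y z ⟨φ⟩ ⟨ψ⟩ => ⟨ψ.comp φ⟩,
    InvUniv.FieldSpace.isAnalyticRel_embeds⟩, ⟨fun x => ⟨RingEquiv.refl _⟩, fun ⟨φ⟩ => ⟨φ.symm⟩,
    fun ⟨φ⟩ ⟨ψ⟩ => ⟨φ.trans ψ⟩⟩, InvUniv.FieldSpace.isAnalyticRel_iso,
    fun x y ⟨φ⟩ => ⟨(φ : x.Carrier →+* y.Carrier)⟩, fun Y _ _ R hR => ?_⟩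
  obtain ⟨ι, R', g, hι, hinj, hRR', hrefl, htrans, hg, hgR⟩ := InvUniv.exists_cantor_quasiOrder hR
  obtain ⟨κ, _, _, _, _, P, _, hP, hκ⟩ := InvUniv.exists_constantField hp hp2
  let _ : MeasurableSpace (InvUniv.BigField κ (List ℕ)) := ⊤
  have : DiscreteMeasurableSpace (InvUniv.BigField κ (List ℕ)) := ⟨fun _ => trivial⟩
  have : CharP (InvUniv.BigField κ (List ℕ)) p :=
    charP_of_injective_algebraMap (algebraMap κ _).injective p
  have : Infinite (InvUniv.BigField κ (List ℕ)) :=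
    Infinite.of_injective _ (InvUniv.BigField.algebraicIndependent_var (κ := κ)).injective
  obtain ⟨B, hB, hinv, f, r, hf, hr, hfK, hrK⟩ :=
    (InvUniv.isRigidFamily_field hP hκ g hι hinj).exists_borel_coding (p := p)
  have key : ∀ y y', Nonempty (InvUniv.seqTree.field κ P (InvUniv.labels g (ι y)) →+*
      InvUniv.seqTree.field κ P (InvUniv.labels g (ι y'))) ↔ R y y' := fun y y' => by
    rw [InvUniv.Forest.nonempty_ringHom_iff hP hκ
      (fun v w h => InvUniv.length_eq_of_labels_subset h),
      InvUniv.exists_isEmbedding_iff hrefl htrans hg hgR, hRR']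
  refine ⟨B, hB, hinv, ⟨r, hr, fun x x' => ?_⟩, ⟨f, hf, fun y y' => ?_⟩⟩
  · obtain ⟨φ⟩ := hrK x
    obtain ⟨φ'⟩ := hrK x'
    rw [← key]
    exact ⟨fun ⟨ψ⟩ => ⟨(φ' : _ →+* _).comp (ψ.comp (φ.symm : _ →+* _))⟩,
      fun ⟨ψ⟩ => ⟨(φ'.symm : _ →+* _).comp (ψ.comp (φ : _ →+* _))⟩⟩
  · obtain ⟨φ⟩ := hfK y
    obtain ⟨φ'⟩ := hfK y'
    rw [← key]
    exact ⟨fun ⟨ψ⟩ => ⟨(φ'.symm : _ →+* _).comp (ψ.comp (φ : _ →+* _))⟩,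
      fun ⟨ψ⟩ => ⟨(φ' : _ →+* _).comp (ψ.comp (φ.symm : _ →+* _))⟩⟩
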